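/- **Notation.** A Bernstein function with characteristics $(a,b,\mu)$ is a function $f(s)=a+bs+\int_{(0,\infty)}(1-e^{-sy})\,\mu(dy)$, $s>0$, where $a,b\ge 0$ and $\mu$ is a measure on $(0,\infty)$ with $\int (1\wedge y)\,\mu(dy)<\infty$. Let $\mathfrak B$ be the set of unbounded Bernstein functions with $a=0$. The measure $\mu$ is sub-homogeneous (resp. super-homogeneous) if for every $\lambda>0$ there is $C(\lambda)>0$ such that $\mu(C(\lambda)x,\infty)\le\lambda\,\mu(x,\infty)$ (resp. $\lambda\,\mu(x,\infty)\le\mu(C(\lambda)x,\infty)$) for all $x>0$. Let $\mathfrak L$ be the set of probability measures on $[0,\infty)$, and write $\hat\nu(s)=\int e^{-sx}\nu(dx)$. For a function $\psi$ let $\mathfrak L_\psi$ be the set of $\nu\in\mathfrak L$ for which there is a function $L$, slowly varying at infinity, with $|\hat\nu(s)-1|/(\psi(s)L(1/s))\to 1$ as $s\to0^+$; $\mathfrak L_s$ is this class for $\psi(s)=s$. For $\psi\in\mathfrak B$ and $\nu\in\mathfrak L$ let $\Phi_\psi(\nu)\in\mathfrak L$ be the measure with Laplace transform $\hat\nu(\psi(s))$,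 and let $\mathfrak L_s^\psi=\Phi_\psi(\mathfrak L_s)$. A random variable is said to be in one of these classes if its law is. The CTRW with space-time jumps $(J_k,W_k)_{k\ge1}$, where the $(J_k,W_k)\in\mathbb R^d\times[0,\infty)$ are i.i.d. ($J_k$ and $W_k$ may be dependent), is $X_t=\sum_{n\ge1}J_n\mathbf 1\{T_n\le t\}$, $T_n=W_1+\dots+W_n$. A subordinator $D$ with symbol $\psi$ is a nondecreasing Lévy process with $\mathbb E e^{-sD_t}=e^{-t\psi(s)}$, and its inverse is $E_t=\inf\{u:D_u>t\}$. The process $(X_{E_t-})^+$ is the right limit in $t$ of $t\mapsto X_{E_t-}$, where $X_{u-}$ is the left limit of $X$ at $u$. For processes with a.s. càdlàg paths, $\overset{J_1}{\sim}$ means equality of the laws on the Borel sets of the Skorokhod $J_1$ topology of $\mathbb D([0,\infty),\mathbb R^d)$. **Proposition.** Let $\psi\in\mathfrak B$ and let $Y$ be a CTRW with i.i.d. space-time jumps $(J_k,W_k^\psi)$. 1. If $W_1^\psi\in\mathfrak L_s^\psi$, then there exist, on some probability space, a CTRW $X$ with i.i.d. space-time jumps $(J'_k,W_k)$, where $W_1\in\mathfrak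 L_s$, and an inverse $E$ of a subordinator with symbol $\psi$, independent of $\{W_k\}$, such that $Y_t\overset{J_1}{\sim}(X_{E_t-})^+$. 2. Conversely, suppose that $W_1^\psi\in\mathfrak L_\psi$ and that $Y_t\overset{J_1}{\sim}(X_{E_t-})^+$, where $X$ is a CTRW with i.i.d. space-time jumps $(J'_k,W_k)$, $W_k>0$ a.s., and $E$ is the inverse of a subordinator with symbol $\psi$, independent of $\{W_k\}$. Suppose that the spatial jumps are real jumps, i.e. $J_1\ne0$ a.s. and $J'_1\neq 0$ a.s., and that $\psi$ has characteristics $(0,b,\mu)$ with $\mu$ sub-homogeneous or super-homogeneous. Then $W_1^\psi\in\mathfrak L_s^\psi$ and $W_1\in\mathfrak L_s$. -/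

import Mathlib

open MeasureTheory ProbabilityTheory Filter Topology
open scoped NNReal ENNReal

namespace CTRW

noncomputable section

/-! ### Bernstein functions -/

/-- `f` is, on `(0, ∞)`, the Bernstein function with characteristics `(a, b, μ)`:
`f s = a + b s + ∫ (1 - e^{-s y}) μ(dy)`, where `a, b ≥ 0` and `μ` is a measure on `(0, ∞)`
with `∫ min(1, y) μ(dy) < ∞`. -/
structure HasCharacteristics (f : ℝ → ℝ) (a b : ℝ) (μ : Measure ℝ) : Prop where
  a_nonneg : 0 ≤ a
  b_nonneg : 0 ≤ b
  concentrated : μ (Set.Iic 0) = 0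
  integrable : ∫⁻ y, ENNReal.ofReal (min 1 y) ∂μ < ∞
  eq : ∀ s : ℝ, 0 < s → f s = a + b * s + ∫ y, (1 - Real.exp (-(s * y))) ∂μ

/-- The class `𝔅` of unbounded Bernstein functions with characteristics `(0, b, μ)`. -/
def unboundedBernstein : Set (ℝ → ℝ) :=
  {ψ | (∃ (b : ℝ) (μ : Measure ℝ), HasCharacteristics ψ 0 b μ) ∧ ¬ BddAbove (ψ '' Set.Ioi 0)}

/-- Sub-homogeneous measures on `(0, ∞)`. -/
def SubHomogeneous (μ : Measure ℝ) : Prop :=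
  ∀ l : ℝ, 0 < l → ∃ C : ℝ, 0 < C ∧
    ∀ x : ℝ, 0 < x → μ (Set.Ioi (C * x)) ≤ ENNReal.ofReal l * μ (Set.Ioi x)

/-- Super-homogeneous measures on `(0, ∞)`. -/
def SuperHomogeneous (μ : Measure ℝ) : Prop :=
  ∀ l : ℝ, 0 < l → ∃ C : ℝ, 0 < C ∧
    ∀ x : ℝ, 0 < x → ENNReal.ofReal l * μ (Set.Ioi x) ≤ μ (Set.Ioi (C * x))

/-! ### Classes of waiting time distributions -/

/-- The Laplace transform of a measure. -/
def laplace (ν : Measure ℝ) (s : ℝ) : ℝ := ∫ x, Real.exp (-(s * x)) ∂ν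

/-- `L` is slowly varying at infinity. -/
def SlowlyVarying (L : ℝ → ℝ) : Prop :=
  ∀ l : ℝ, 0 < l → Tendsto (fun x => L (l * x) / L x) atTop (𝓝 1)

/-- The class `𝔏` of probability measures on `[0, ∞)`. -/
def probHalfLine : Set (Measure ℝ) :=
  {ν | IsProbabilityMeasure ν ∧ ν (Set.Iio 0) = 0}

/-- The class `𝔏_ψ`: the Laplace transform is `∼ 1 - ψ(s) L(1/s)` as `s → 0+`, for some slowly
varying `L`. The class `𝔏_s` is `layer id`. -/
def layer (ψ : ℝ → ℝ) : Set (Measure ℝ) :=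
  {ν | ν ∈ probHalfLine ∧ ∃ L : ℝ → ℝ, SlowlyVarying L ∧
    Tendsto (fun s => |laplace ν s - 1| / (ψ s * L s⁻¹)) (𝓝[>] 0) (𝓝 1)}

/-- `ρ = Φ_ψ(ν)`: the Laplace transform of `ρ` is that of `ν` composed with `ψ`. -/
def IsPhi (ψ : ℝ → ℝ) (ν ρ : Measure ℝ) : Prop :=
  ν ∈ probHalfLine ∧ ρ ∈ probHalfLine ∧ ∀ s : ℝ, 0 < s → laplace ρ s = laplace ν (ψ s)

/-- The class `𝔏_{ψ₁}^{ψ₂}`, the image of `𝔏_{ψ₁}` under `Φ_{ψ₂}`.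
The class `𝔏_s^ψ` is `layerImage id ψ`. -/
def layerImage (ψ₁ ψ₂ : ℝ → ℝ) : Set (Measure ℝ) :=
  {ρ | ∃ ν ∈ layer ψ₁, IsPhi ψ₂ ν ρ}

/-! ### The Skorokhod space and the `J₁` topology -/

/-- Right continuity with left limits, on `[0, ∞)`. -/
def IsCadlag {E : Type*} [TopologicalSpace E] (f : ℝ≥0 → E) : Prop :=
  ∀ t, ContinuousWithinAt f (Set.Ici t) t ∧ ∃ l, Tendsto f (𝓝[<] t) (𝓝 l)

/-- The space `𝔻[0, ∞)` of càdlàg functions with values in `E`. -/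
def Skorokhod (E : Type*) [TopologicalSpace E] : Type _ := {f : ℝ≥0 → E // IsCadlag f}

variable {E : Type*} [NormedAddCommGroup E]

/-- The basic `J₁` neighbourhood of `f`: the functions `g` for which some increasing homeomorphism
`τ` of `[0, ∞)` is `ε`-close to the identity, and `g ∘ τ` is `ε`-close to `f` on `[0, 1/ε]`. -/
def Skorokhod.nbhd (f : Skorokhod E) (ε : ℝ) : Set (Skorokhod E) :=
  {g | ∃ τ : ℝ≥0 ≃o ℝ≥0, (∀ t, dist (τ t) t < ε) ∧
    ∀ t : ℝ≥0, (t : ℝ) ≤ 1 / ε → ‖g.1 (τ t) - f.1 t‖ < ε}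

theorem Skorokhod.nbhd_mono (f : Skorokhod E) {δ ε : ℝ} (hδ : 0 < δ) (h : δ ≤ ε) :
    f.nbhd δ ⊆ f.nbhd ε := by
  rintro g ⟨τ, h1, h2⟩
  exact ⟨τ, fun t => (h1 t).trans_le h, fun t ht =>
    (h2 t (ht.trans (one_div_le_one_div_of_le hδ h))).trans_le h⟩

/-- The `J₁` topology on `𝔻[0, ∞)`. A sequence `fₙ` converges to `f` in it if and only if there are
increasing homeomorphisms `τₙ` of `[0, ∞)` such that `τₙ` tends to the identity uniformly and
`fₙ ∘ τₙ` tends to `f` uniformly on every `[0, T]`. -/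
instance Skorokhod.instTopologicalSpace : TopologicalSpace (Skorokhod E) where
  IsOpen U := ∀ f ∈ U, ∃ ε : ℝ, 0 < ε ∧ f.nbhd ε ⊆ U
  isOpen_univ := fun _ _ => ⟨1, one_pos, Set.subset_univ _⟩
  isOpen_inter := by
    rintro U V hU hV f ⟨hfU, hfV⟩
    obtain ⟨ε, hε, h1⟩ := hU f hfU
    obtain ⟨δ, hδ, h2⟩ := hV f hfV
    exact ⟨min ε δ, lt_min hε hδ, Set.subset_inter
      ((f.nbhd_mono (lt_min hε hδ) (min_le_left _ _)).trans h1)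
      ((f.nbhd_mono (lt_min hε hδ) (min_le_right _ _)).trans h2)⟩
  isOpen_sUnion := by
    rintro S hS f ⟨U, hU, hfU⟩
    obtain ⟨ε, hε, h⟩ := hS U hU f hfU
    exact ⟨ε, hε, h.trans (Set.subset_sUnion_of_mem hU)⟩

instance Skorokhod.instMeasurableSpace : MeasurableSpace (Skorokhod E) := borel _

instance Skorokhod.instBorelSpace : BorelSpace (Skorokhod E) := ⟨rfl⟩

/-- The process `Z` has almost surely paths in `𝔻[0, ∞)`, and its law on the Borel sets of the
`J₁` topology is `Q`. -/
def HasJ1Law {Ω : Type*} [MeasurableSpace Ω] (Z : ℝ≥0 → Ω → E) (Q : Measure (Skorokhod E))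
    (P : Measure Ω) : Prop :=
  ∃ z : Ω → Skorokhod E, HasLaw z Q P ∧ ∀ᵐ ω ∂P, ∀ t, (z ω).1 t = Z t ω

/-- Two processes, possibly on different probability spaces, have the same `J₁` law. -/
def SameJ1Law {Ω Ω' : Type*} [MeasurableSpace Ω] [MeasurableSpace Ω']
    (Z : ℝ≥0 → Ω → E) (P : Measure Ω) (Z' : ℝ≥0 → Ω' → E) (P' : Measure Ω') : Prop :=
  ∃ Q : Measure (Skorokhod E), HasJ1Law Z Q P ∧ HasJ1Law Z' Q P'

/-! ### Continuous time random walks, subordinators, time change -/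

/-- The space-time jumps `(J k, W k)`, `k = 0, 1, …`, are i.i.d.; `J k` and `W k` of the same index
may be dependent. -/
structure IsIIDJumps {Ω : Type*} [MeasurableSpace Ω] [MeasurableSpace E]
    (J : ℕ → Ω → E) (W : ℕ → Ω → ℝ) (P : Measure Ω) : Prop where
  measurable_jump : ∀ k, Measurable (J k)
  measurable_wait : ∀ k, Measurable (W k)
  indep : iIndepFun (fun k ω => (J k ω, W k ω)) P
  identDistrib : ∀ k, IdentDistrib (fun ω => (J k ω, W k ω)) (fun ω => (J 0 ω, W 0 ω)) P P

/-- The time `W 0 + ⋯ + W n` of the jump `J n`. -/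
def jumpTime {Ω : Type*} (W : ℕ → Ω → ℝ) (n : ℕ) (ω : Ω) : ℝ :=
  ∑ i ∈ Finset.range (n + 1), W i ω

/-- The CTRW with space-time jumps `(J k, W k)`: the sum of the jumps whose time is at most `t`. -/
def ctrw {Ω : Type*} (J : ℕ → Ω → E) (W : ℕ → Ω → ℝ) (t : ℝ≥0) (ω : Ω) : E :=
  ∑' n, Set.indicator (Set.Ici (jumpTime W n ω)) (fun _ => J n ω) (t : ℝ)

/-- `D` is a subordinator with symbol `ψ`: a Lévy process with nondecreasing paths and
`𝔼 e^{-s D_t} = e^{-t ψ(s)}`. -/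
structure IsSubordinator {Ω : Type*} [MeasurableSpace Ω] (ψ : ℝ → ℝ) (D : ℝ≥0 → Ω → ℝ)
    (P : Measure Ω) : Prop where
  measurable : ∀ t, Measurable (D t)
  zero : ∀ᵐ ω ∂P, D 0 ω = 0
  paths : ∀ᵐ ω ∂P, Monotone (fun t => D t ω) ∧ IsCadlag (fun t => D t ω)
  indepIncrements : HasIndepIncrements D P
  stationary : ∀ t h, IdentDistrib (fun ω => D (t + h) ω - D t ω) (D h) P P
  laplace_eq : ∀ (t : ℝ≥0) (s : ℝ), 0 < s →
    ∫ ω, Real.exp (-(s * D t ω)) ∂P = Real.exp (-(t * ψ s))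

/-- `T` is the inverse `T_t = inf {u : D_u > t}` of a subordinator `D` with symbol `ψ`. -/
def IsInverseSubordinator {Ω : Type*} [MeasurableSpace Ω] (ψ : ℝ → ℝ) (T : ℝ≥0 → Ω → ℝ≥0)
    (P : Measure Ω) : Prop :=
  (∀ t, Measurable (T t)) ∧ ∃ D : ℝ≥0 → Ω → ℝ, IsSubordinator ψ D P ∧
    ∀ᵐ ω ∂P, ∀ t : ℝ≥0, T t ω = sInf {u : ℝ≥0 | (t : ℝ) < D u ω}

/-- The process `(X_{T_t -})^+`: first the left limit of `X` is taken and evaluated at `T_t`, and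
then the right limit in `t`. -/
def timeChange {Ω : Type*} (X : ℝ≥0 → Ω → E) (T : ℝ≥0 → Ω → ℝ≥0) (t : ℝ≥0) (ω : Ω) : E :=
  Function.rightLim (fun r => Function.leftLim (fun v => X v ω) (T r ω)) t

end

end CTRW

namespace CTRW

/-! ### Laplace transforms of measures on the half line -/

/-! Everything rests on a pathwise fact, `rightLim_leftLim_jumpPath`. If `D` is nondecreasing,
right-continuous, starts at 0 and tends to infinity, then taking the left limit of a jump path at
the inverse of `D`, and then the right limit in time, moves the jump at `S n` to `D (S n)` and
leaves its size unchanged. The time-changed CTRW is thus a jump path whose waiting times are the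
increments of `D` over the original waiting times. For `D` independent of the waiting times these
increments are i.i.d., and their law has Laplace transform `ν̂ ∘ ψ`, where `ν` is the law of the
original waits.

Direct part. Take `ν` in `𝔏_s` whose image under `Φ_ψ` is the law of the given waits, a subordinator
`D` built from a Poisson process of jumps, and independent marks `(W_k, U_k)` with `W_k` of law `ν`
and `U_k` uniform. The increments `V'_k` of `D` along the walk have the given waiting law
(`IsSubordinator.map_walkIncrement`, `IsSubordinator.map_eq_of_isPhi`). The variable `U_k` serves to
sample `J'_k` from the conditional law of the spatial jump given the wait, evaluated at `V'_k`. So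
`(J'_k, V'_k)` has the law of the given space-time jumps, and the laws on path space agree because
the path is a Borel function of the jump sequence (`measurable_toSkorokhod`).

Converse part. Leaving the origin before time `a` is an open event for `J₁`. Since the spatial jumps
do not vanish, comparing these events identifies the law of the first wait of `Y` with that of `D (W
0)`, hence `ρ̂ = ν̂ ∘ ψ`. It remains to see that `F u = (1 - ν̂ u) / u`, which is nonincreasing, has
a slowly varying `x ↦ F (1/x)`. Membership of `ρ` in `𝔏_ψ` says that `F (ψ s) ∼ L (1/s)`, so `F (ψ
(c s)) / F (ψ s)` tends to 1. Homogeneity of `μ` gives `l ψ(s) ≤ ψ(c s)` for a suitable `c`, and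
monotonicity squeezes `F (l u) / F u` between that ratio and 1 (`HasCharacteristics.scale`,
`HasCharacteristics.mem_layer_id`). -/

theorem ae_nonneg_of_mem_probHalfLine {ν : Measure ℝ} (h : ν ∈ probHalfLine) :
    ∀ᵐ x ∂ν, 0 ≤ x := by
  rw [ae_iff]
  convert h.2 using 2
  ext x; simp

/-- Probability measures on `[0, 1]` are determined by their moments. -/
theorem ext_of_moments {ν ρ : Measure ℝ} [IsProbabilityMeasure ν] [IsProbabilityMeasure ρ]
    (hν : ∀ᵐ x ∂ν, x ∈ Set.Icc (0 : ℝ) 1) (hρ : ∀ᵐ x ∂ρ, x ∈ Set.Icc (0 : ℝ) 1)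
    (h : ∀ n : ℕ, ∫ x, x ^ n ∂ν = ∫ x, x ^ n ∂ρ) : ν = ρ := by
  have int_pow : ∀ {m : Measure ℝ} [IsProbabilityMeasure m], (∀ᵐ x ∂m, x ∈ Set.Icc (0 : ℝ) 1) →
      ∀ n : ℕ, Integrable (fun x => x ^ n) m := by
    intro m _ hm n
    refine Integrable.of_bound (by fun_prop) 1 ?_
    filter_upwards [hm] with x hx
    rw [Real.norm_eq_abs, abs_pow, abs_of_nonneg hx.1]
    exact pow_le_one₀ hx.1 hx.2
  have eval_eq : ∀ p : Polynomial ℝ, (fun x => p.eval x)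
      = fun x => ∑ i ∈ Finset.range (p.natDegree + 1), p.coeff i * x ^ i :=
    fun p => funext fun x => p.eval_eq_sum_range x
  have int_poly : ∀ {m : Measure ℝ} [IsProbabilityMeasure m], (∀ᵐ x ∂m, x ∈ Set.Icc (0 : ℝ) 1) →
      ∀ p : Polynomial ℝ, Integrable (fun x => p.eval x) m := by
    intro m _ hm p
    rw [eval_eq]
    exact integrable_finsetSum _ fun i _ => (int_pow hm i).const_mul _
  have eq_poly : ∀ p : Polynomial ℝ, ∫ x, p.eval x ∂ν = ∫ x, p.eval x ∂ρ := by
    intro p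
    rw [eval_eq, integral_finsetSum _ fun i _ => (int_pow hν i).const_mul _,
      integral_finsetSum _ fun i _ => (int_pow hρ i).const_mul _]
    simp_rw [integral_const_mul, h]
  refine ext_of_forall_integral_eq_of_IsFiniteMeasure fun f => ?_
  refine eq_of_forall_dist_le fun ε hε => ?_
  obtain ⟨p, hp⟩ := exists_polynomial_near_of_continuousOn 0 1 f f.continuous.continuousOn (ε / 2)
    (half_pos hε)
  have key : ∀ {m : Measure ℝ} [IsProbabilityMeasure m], (∀ᵐ x ∂m, x ∈ Set.Icc (0 : ℝ) 1) →
      dist (∫ x, p.eval x ∂m) (∫ x, f x ∂m) ≤ ε / 2 := by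
    intro m _ hm
    rw [dist_eq_norm, ← integral_sub (int_poly hm p) (f.integrable m)]
    refine (norm_integral_le_of_norm_le_const (C := ε / 2) ?_).trans (by simp)
    filter_upwards [hm] with x hx
    exact (hp x hx).le
  have h1 := key hν
  have h2 := key hρ
  rw [← eq_poly, dist_comm] at h2
  rw [dist_comm] at h1 h2
  calc dist (∫ x, f x ∂ν) (∫ x, f x ∂ρ)
      ≤ dist (∫ x, f x ∂ν) (∫ x, p.eval x ∂ν) + dist (∫ x, p.eval x ∂ν) (∫ x, f x ∂ρ) :=
        dist_triangle _ _ _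
    _ ≤ ε / 2 + ε / 2 := add_le_add h1 h2
    _ = ε := add_halves ε

/-- Probability measures on `[0, ∞)` are determined by their Laplace transforms. -/
theorem ext_of_laplace {ν ρ : Measure ℝ} (hν : ν ∈ probHalfLine) (hρ : ρ ∈ probHalfLine)
    (h : ∀ s : ℝ, 0 < s → laplace ν s = laplace ρ s) : ν = ρ := by
  have := hν.1
  have := hρ.1
  -- The substitution `y = e^{-x}` carries `[0, ∞)` into `[0, 1]` and turns the Laplace transform at
  -- the integers into moments.
  have hc : Continuous fun x : ℝ => Real.exp (-x) := by fun_prop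
  have he : MeasurableEmbedding fun x : ℝ => Real.exp (-x) :=
    hc.measurableEmbedding fun x y hxy => by simpa using hxy
  have mem : ∀ {m : Measure ℝ}, m ∈ probHalfLine →
      ∀ᵐ y ∂(m.map fun x : ℝ => Real.exp (-x)), y ∈ Set.Icc (0 : ℝ) 1 := by
    intro m hm
    rw [he.ae_map_iff]
    filter_upwards [ae_nonneg_of_mem_probHalfLine hm] with x hx
    exact ⟨(Real.exp_pos _).le, Real.exp_le_one_iff.2 (by linarith)⟩
  have hpν : IsProbabilityMeasure (ν.map fun x : ℝ => Real.exp (-x)) :=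
    Measure.isProbabilityMeasure_map hc.aemeasurable
  have hpρ : IsProbabilityMeasure (ρ.map fun x : ℝ => Real.exp (-x)) :=
    Measure.isProbabilityMeasure_map hc.aemeasurable
  have hmap : (ν.map fun x : ℝ => Real.exp (-x)) = ρ.map fun x : ℝ => Real.exp (-x) := by
    refine ext_of_moments (mem hν) (mem hρ) fun n => ?_
    rw [he.integral_map, he.integral_map]
    rcases Nat.eq_zero_or_pos n with rfl | hn
    · simp
    · have := h n (by exact_mod_cast hn)
      simpa [laplace, ← Real.exp_nat_mul] using this
  calc ν = (ν.map fun x : ℝ => Real.exp (-x)).comap fun x : ℝ => Real.exp (-x) :=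
        (he.comap_map ν).symm
    _ = ρ := by rw [hmap, he.comap_map]

theorem integrable_exp_neg_mul {ν : Measure ℝ} (hν : ν ∈ probHalfLine) {s : ℝ} (hs : 0 ≤ s) :
    Integrable (fun x => Real.exp (-(s * x))) ν := by
  have := hν.1
  refine Integrable.of_bound (by fun_prop) 1 ?_
  filter_upwards [ae_nonneg_of_mem_probHalfLine hν] with x hx
  rw [Real.norm_eq_abs, Real.abs_exp]
  exact Real.exp_le_one_iff.2 (by nlinarith)

theorem one_sub_laplace {ν : Measure ℝ} (hν : ν ∈ probHalfLine) {s : ℝ} (hs : 0 ≤ s) :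
    1 - laplace ν s = ∫ x, (1 - Real.exp (-(s * x))) ∂ν := by
  have := hν.1
  rw [integral_sub (integrable_const _) (integrable_exp_neg_mul hν hs)]
  simp [laplace]

theorem laplace_le_one {ν : Measure ℝ} (hν : ν ∈ probHalfLine) {s : ℝ} (hs : 0 ≤ s) :
    laplace ν s ≤ 1 := by
  have : 0 ≤ 1 - laplace ν s := by
    rw [one_sub_laplace hν hs]
    refine integral_nonneg_of_ae ?_
    filter_upwards [ae_nonneg_of_mem_probHalfLine hν] with x hx
    simpa using mul_nonneg hs hx
  linarith

theorem laplace_lt_one {ν : Measure ℝ} (hν : ν ∈ probHalfLine) (h0 : ν (Set.Ioi 0) ≠ 0)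
    {s : ℝ} (hs : 0 < s) : laplace ν s < 1 := by
  have := hν.1
  refine lt_of_le_of_ne (laplace_le_one hν hs.le) fun h => h0 ?_
  have hz : ∫ x, (1 - Real.exp (-(s * x))) ∂ν = 0 := by
    rw [← one_sub_laplace hν hs.le, h, sub_self]
  have hint : Integrable (fun x => 1 - Real.exp (-(s * x))) ν :=
    (integrable_const _).sub (integrable_exp_neg_mul hν hs.le)
  rw [integral_eq_zero_iff_of_nonneg_ae ?_ hint] at hz
  · rw [← nonpos_iff_eq_zero]
    refine (measure_mono ?_).trans (ae_iff.1 hz).le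
    intro x (hx : 0 < x) h
    have : Real.exp (-(s * x)) = 1 := by
      have h' : 1 - Real.exp (-(s * x)) = 0 := h
      linarith
    rw [Real.exp_eq_one_iff] at this
    nlinarith
  · filter_upwards [ae_nonneg_of_mem_probHalfLine hν] with x hx
    simpa using mul_nonneg hs.le hx

theorem laplace_eq_one_of_null {ν : Measure ℝ} (hν : ν ∈ probHalfLine) (h0 : ν (Set.Ioi 0) = 0)
    (s : ℝ) : laplace ν s = 1 := by
  have := hν.1
  have : ∀ᵐ x ∂ν, Real.exp (-(s * x)) = 1 := by
    have h1 : ∀ᵐ x ∂ν, x ∉ Set.Ioi (0 : ℝ) := measure_eq_zero_iff_ae_notMem.1 h0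
    filter_upwards [ae_nonneg_of_mem_probHalfLine hν, h1] with x hx hx'
    have : x = 0 := le_antisymm (not_lt.1 hx') hx
    simp [this]
  rw [laplace, integral_congr_ae this]
  simp

/-- A law in one of the classes `𝔏_ψ` is not concentrated at `0`. -/
theorem measure_Ioi_ne_zero_of_mem_layer {ψ : ℝ → ℝ} {ν : Measure ℝ} (h : ν ∈ layer ψ) :
    ν (Set.Ioi 0) ≠ 0 := by
  intro h0
  obtain ⟨hν, L, -, hL⟩ := h
  -- The numerator vanishes, so the quotient is 0 whatever the denominator, even where that is 0.
  have : (fun s => |laplace ν s - 1| / (ψ s * L s⁻¹)) = fun _ => 0 := by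
    ext s
    simp [laplace_eq_one_of_null hν h0]
  rw [this] at hL
  exact zero_ne_one (tendsto_nhds_unique tendsto_const_nhds hL)

/-- Convexity of the exponential between `-z` and `0`. Integrated, it gives the monotonicity of `(1
- ν̂(s)) / s`. -/
theorem mul_one_sub_exp_le {c z : ℝ} (hc : 0 ≤ c) (hc1 : c ≤ 1) :
    c * (1 - Real.exp (-z)) ≤ 1 - Real.exp (-(c * z)) := by
  have h := convexOn_exp.2 (Set.mem_univ (-z)) (Set.mem_univ 0) hc (sub_nonneg.2 hc1)
    (add_sub_cancel c 1)
  simp only [smul_eq_mul, mul_zero, add_zero, Real.exp_zero, mul_one] at h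
  rw [show c * -z = -(c * z) by ring] at h
  linarith

/-- The function `s ↦ (1 - ν̂(s)) / s` is nonincreasing. -/
theorem one_sub_laplace_div_antitone {ν : Measure ℝ} (hν : ν ∈ probHalfLine) {s t : ℝ}
    (hs : 0 < s) (hst : s ≤ t) : (1 - laplace ν t) / t ≤ (1 - laplace ν s) / s := by
  have := hν.1
  have ht := hs.trans_le hst
  have h : s / t * (1 - laplace ν t) ≤ 1 - laplace ν s := by
    rw [one_sub_laplace hν ht.le, one_sub_laplace hν hs.le, ← integral_const_mul]
    refine integral_mono_ae
      (((integrable_const _).sub (integrable_exp_neg_mul hν ht.le)).const_mul _)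
      ((integrable_const _).sub (integrable_exp_neg_mul hν hs.le)) ?_
    refine ae_of_all _ fun x => ?_
    have := mul_one_sub_exp_le (c := s / t) (z := t * x) (by positivity)
      ((div_le_one ht).2 hst)
    rwa [← mul_assoc, div_mul_cancel₀ _ ht.ne'] at this
  rw [div_le_div_iff₀ ht hs]
  rw [div_mul_eq_mul_div, div_le_iff₀ ht] at h
  linarith

/-! ### Bernstein functions -/

namespace HasCharacteristics

variable {ψ : ℝ → ℝ} {b : ℝ} {μ : Measure ℝ}

theorem ae_pos (h : HasCharacteristics ψ 0 b μ) : ∀ᵐ y ∂μ, 0 < y := by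
  rw [ae_iff]
  convert h.concentrated using 2
  ext x; simp

theorem integrable_min (h : HasCharacteristics ψ 0 b μ) : Integrable (fun y : ℝ => min 1 y) μ := by
  refine ⟨by fun_prop, ?_⟩
  rw [hasFiniteIntegral_iff_ofReal]
  · exact h.integrable
  · filter_upwards [h.ae_pos] with y hy
    exact le_min zero_le_one hy.le

/-- Turns the Lévy condition on `min 1 y` into a domination locally uniform in `s`; integrability,
continuity and the limit at 0 all come from it. -/
theorem one_sub_exp_le_min {s y : ℝ} (hy : 0 ≤ y) :
    1 - Real.exp (-(s * y)) ≤ max 1 s * min 1 y := by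
  have h1 : 1 - Real.exp (-(s * y)) ≤ s * y := by
    have := Real.add_one_le_exp (-(s * y)); linarith
  have h2 : 1 - Real.exp (-(s * y)) ≤ 1 := by
    have := Real.exp_pos (-(s * y)); linarith
  rcases le_total y 1 with h | h
  · rw [min_eq_right h]
    exact h1.trans (mul_le_mul_of_nonneg_right (le_max_right _ _) hy)
  · rw [min_eq_left h, mul_one]
    exact h2.trans (le_max_left _ _)

theorem one_sub_exp_nonneg {s y : ℝ} (hs : 0 ≤ s) (hy : 0 ≤ y) :
    0 ≤ 1 - Real.exp (-(s * y)) := by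
  have : Real.exp (-(s * y)) ≤ 1 := Real.exp_le_one_iff.2 (by nlinarith)
  linarith

theorem integrable_one_sub_exp (h : HasCharacteristics ψ 0 b μ) {s : ℝ} (hs : 0 ≤ s) :
    Integrable (fun y => 1 - Real.exp (-(s * y))) μ := by
  refine (h.integrable_min.const_mul (max 1 s)).mono' (by fun_prop) ?_
  filter_upwards [h.ae_pos] with y hy
  rw [Real.norm_of_nonneg (one_sub_exp_nonneg hs hy.le)]
  exact one_sub_exp_le_min hy.le

theorem nonneg (h : HasCharacteristics ψ 0 b μ) {s : ℝ} (hs : 0 < s) : 0 ≤ ψ s := by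
  rw [h.eq s hs, zero_add]
  refine add_nonneg (mul_nonneg h.b_nonneg hs.le) (integral_nonneg_of_ae ?_)
  filter_upwards [h.ae_pos] with y hy
  exact one_sub_exp_nonneg hs.le hy.le

theorem mono (h : HasCharacteristics ψ 0 b μ) {s t : ℝ} (hs : 0 < s) (hst : s ≤ t) :
    ψ s ≤ ψ t := by
  have ht := hs.trans_le hst
  rw [h.eq s hs, h.eq t ht]
  refine add_le_add (by gcongr; exact h.b_nonneg) ?_
  refine integral_mono_ae (h.integrable_one_sub_exp hs.le) (h.integrable_one_sub_exp ht.le) ?_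
  filter_upwards [h.ae_pos] with y hy
  have : Real.exp (-(t * y)) ≤ Real.exp (-(s * y)) :=
    Real.exp_le_exp.2 (by nlinarith)
  linarith

theorem continuousAt (h : HasCharacteristics ψ 0 b μ) {s : ℝ} (hs : 0 < s) :
    ContinuousAt ψ s := by
  have hc : ContinuousAt (fun t => b * t + ∫ y, (1 - Real.exp (-(t * y))) ∂μ) s := by
    refine ContinuousAt.add (by fun_prop) ?_
    refine continuousAt_of_dominated (bound := fun y => (s + 1 + 1) * min 1 y)
      (Eventually.of_forall fun t => by fun_prop) ?_ (h.integrable_min.const_mul _)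
      (ae_of_all _ fun y => by fun_prop)
    filter_upwards [Ioo_mem_nhds hs (lt_add_one s)] with t ht
    filter_upwards [h.ae_pos] with y hy
    rw [Real.norm_of_nonneg (one_sub_exp_nonneg ht.1.le hy.le)]
    refine (one_sub_exp_le_min hy.le).trans ?_
    refine mul_le_mul_of_nonneg_right ?_ (le_min zero_le_one hy.le)
    exact max_le (by linarith) (by linarith [ht.2])
  refine hc.congr ?_
  filter_upwards [Ioi_mem_nhds hs] with t ht
  rw [h.eq t ht, zero_add]

theorem tendsto_zero (h : HasCharacteristics ψ 0 b μ) : Tendsto ψ (𝓝[>] 0) (𝓝 0) := by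
  have hc : Tendsto (fun t => b * t + ∫ y, (1 - Real.exp (-(t * y))) ∂μ) (𝓝[>] 0)
      (𝓝 (b * 0 + ∫ y, (0 : ℝ) ∂μ)) := by
    refine Tendsto.add (Tendsto.mono_left (Continuous.tendsto (by fun_prop) _)
      nhdsWithin_le_nhds) ?_
    refine tendsto_integral_filter_of_dominated_convergence (fun y => min 1 y)
      (Eventually.of_forall fun t => by fun_prop) ?_ h.integrable_min ?_
    · filter_upwards [Ioo_mem_nhdsGT (zero_lt_one (α := ℝ))] with t ht
      filter_upwards [h.ae_pos] with y hy
      rw [Real.norm_of_nonneg (one_sub_exp_nonneg ht.1.le hy.le)]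
      simpa [max_eq_left ht.2.le] using one_sub_exp_le_min (s := t) hy.le
    · refine ae_of_all _ fun y => Tendsto.mono_left ?_ nhdsWithin_le_nhds
      have : Continuous fun t : ℝ => 1 - Real.exp (-(t * y)) := by fun_prop
      simpa using this.tendsto 0
  simp only [mul_zero, integral_zero, add_zero] at hc
  refine hc.congr' ?_
  filter_upwards [self_mem_nhdsWithin] with t ht
  rw [h.eq t ht, zero_add]

theorem tendsto_atTop_atTop (h : HasCharacteristics ψ 0 b μ) (hb : ¬ BddAbove (ψ '' Set.Ioi 0)) :
    Tendsto ψ atTop atTop := by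
  refine tendsto_atTop.2 fun c => ?_
  rw [bddAbove_def] at hb
  push Not at hb
  obtain ⟨_, ⟨s, hs, rfl⟩, hc⟩ := hb c
  filter_upwards [eventually_ge_atTop s] with t ht
  exact hc.le.trans (h.mono hs ht)

/-- A zero of `ψ` at one point kills both the drift and the Lévy measure, so `ψ` would vanish
identically and be bounded. -/
theorem pos (h : HasCharacteristics ψ 0 b μ) (hb : ¬ BddAbove (ψ '' Set.Ioi 0)) {s : ℝ}
    (hs : 0 < s) : 0 < ψ s := by
  refine lt_of_le_of_ne (h.nonneg hs) fun h0 => hb ?_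
  have hi : 0 ≤ ∫ y, (1 - Real.exp (-(s * y))) ∂μ := by
    refine integral_nonneg_of_ae ?_
    filter_upwards [h.ae_pos] with y hy
    exact one_sub_exp_nonneg hs.le hy.le
  have heq := h.eq s hs
  have hbs : 0 ≤ b * s := mul_nonneg h.b_nonneg hs.le
  have hb0 : b = 0 := by
    have : b * s = 0 := by linarith
    exact (mul_eq_zero.1 this).resolve_right hs.ne'
  have hz : ∫ y, (1 - Real.exp (-(s * y))) ∂μ = 0 := by linarith
  rw [integral_eq_zero_iff_of_nonneg_ae ?_ (h.integrable_one_sub_exp hs.le)] at hz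
  · have hF : ∀ᵐ y ∂μ, False := by
      filter_upwards [h.ae_pos, hz] with y hy hz
      have h1 : Real.exp (-(s * y)) = 1 := by
        have h' : 1 - Real.exp (-(s * y)) = 0 := hz
        linarith
      rw [Real.exp_eq_one_iff] at h1
      nlinarith
    have hμ : μ = 0 := by
      rw [← Measure.measure_univ_eq_zero]
      simpa [ae_iff] using hF
    refine ⟨0, ?_⟩
    rintro _ ⟨t, ht, rfl⟩
    rw [h.eq t ht, hb0, hμ]
    simp
  · filter_upwards [h.ae_pos] with y hy
    exact one_sub_exp_nonneg hs.le hy.le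

/-- By the layer-cake formula the integral is `∫ μ(-log(1 - t)/s, ∞) dt` over `0 < t < 1`. A
comparison of the tails of `μ` at proportional points therefore becomes a comparison of the
integrals at proportional values of `s`. -/
theorem laplaceExponent_scale (h : HasCharacteristics ψ 0 b μ)
    (hμ : SubHomogeneous μ ∨ SuperHomogeneous μ) {l : ℝ} (hl : 1 < l) :
    ∃ c : ℝ, 0 < c ∧ ∀ s : ℝ, 0 < s → l * ∫ y, (1 - Real.exp (-(s * y))) ∂μ
      ≤ ∫ y, (1 - Real.exp (-(c * s * y))) ∂μ := by
  have hl0 : 0 < l := zero_lt_one.trans hl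
  -- Both kinds of homogeneity become one tail inequality: `D = 1` in the sub-homogeneous case, used
  -- with factor `l⁻¹`, and `C = 1` in the super-homogeneous one.
  obtain ⟨C, D, hC, hD, htail⟩ : ∃ C D : ℝ, 0 < C ∧ 0 < D ∧ ∀ x : ℝ, 0 < x →
      ENNReal.ofReal l * μ (Set.Ioi (C * x)) ≤ μ (Set.Ioi (D * x)) := by
    rcases hμ with hμ | hμ
    · obtain ⟨C, hC, h1⟩ := hμ l⁻¹ (by positivity)
      refine ⟨C, 1, hC, one_pos, fun x hx => ?_⟩
      calc ENNReal.ofReal l * μ (Set.Ioi (C * x))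
          ≤ ENNReal.ofReal l * (ENNReal.ofReal l⁻¹ * μ (Set.Ioi x)) := by
            gcongr; exact h1 x hx
        _ = μ (Set.Ioi (1 * x)) := by
            rw [← mul_assoc, ← ENNReal.ofReal_mul hl0.le, mul_inv_cancel₀ hl0.ne']
            simp
    · obtain ⟨D, hD, h1⟩ := hμ l hl0
      exact ⟨1, D, one_pos, hD, fun x hx => by simpa using h1 x hx⟩
  refine ⟨C / D, by positivity, fun s hs => ?_⟩
  have hset : ∀ {r : ℝ}, 0 < r → ∀ t : ℝ, t < 1 →
      {y : ℝ | t < 1 - Real.exp (-(r * y))} = Set.Ioi (-Real.log (1 - t) / r) := by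
    intro r hr t ht
    ext y
    rw [Set.mem_Ioi, div_lt_iff₀ hr, neg_lt, Set.mem_ofPred_eq,
      Real.lt_log_iff_exp_lt (by linarith), mul_comm y r]
    constructor <;> intro h <;> linarith
  have hlint : ∀ {r : ℝ}, 0 < r → ∫⁻ y, ENNReal.ofReal (1 - Real.exp (-(r * y))) ∂μ
      = ∫⁻ t in Set.Ioi (0 : ℝ), μ {y | t < 1 - Real.exp (-(r * y))} := by
    intro r hr
    refine lintegral_eq_lintegral_meas_lt μ ?_ (by fun_prop)
    filter_upwards [h.ae_pos] with y hy
    exact one_sub_exp_nonneg hr.le hy.le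
  have hnn : ∀ {r : ℝ}, 0 < r → 0 ≤ᵐ[μ] fun y => 1 - Real.exp (-(r * y)) := by
    intro r hr
    filter_upwards [h.ae_pos] with y hy
    exact one_sub_exp_nonneg hr.le hy.le
  have hcs : 0 < C / D * s := by positivity
  have key : ENNReal.ofReal l * ∫⁻ y, ENNReal.ofReal (1 - Real.exp (-(s * y))) ∂μ
      ≤ ∫⁻ y, ENNReal.ofReal (1 - Real.exp (-(C / D * s * y))) ∂μ := by
    rw [hlint hs, hlint hcs, ← lintegral_const_mul' _ _ ENNReal.ofReal_ne_top]
    refine setLIntegral_mono' measurableSet_Ioi fun t ht => ?_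
    rcases lt_or_ge t 1 with ht1 | ht1
    · rw [hset hs t ht1, hset hcs t ht1]
      have hlog : 0 < -Real.log (1 - t) :=
        neg_pos.2 (Real.log_neg (by linarith) (by linarith [Set.mem_Ioi.1 ht]))
      -- This point is chosen so that multiplying by `C` gives the threshold for `s`, and by `D` the
      -- threshold for `C / D * s`.
      have := htail (-Real.log (1 - t) / (C * s)) (by positivity)
      convert this using 4
      · field_simp
      · field_simp
    · have : {y : ℝ | t < 1 - Real.exp (-(s * y))} = ∅ := by
        ext y
        have := Real.exp_pos (-(s * y))
        simp only [Set.mem_ofPred_eq, Set.mem_empty_iff_false, iff_false]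
        intro h
        linarith
      rw [this]
      simp
  rw [← ofReal_integral_eq_lintegral_ofReal (h.integrable_one_sub_exp hs.le) (hnn hs),
    ← ofReal_integral_eq_lintegral_ofReal (h.integrable_one_sub_exp hcs.le) (hnn hcs),
    ← ENNReal.ofReal_mul hl0.le, ENNReal.ofReal_le_ofReal_iff (integral_nonneg_of_ae (hnn hcs))]
    at key
  exact key

/-- If the Lévy measure is sub- or super-homogeneous, the Bernstein function grows by any given
factor when its argument is multiplied by a suitable constant. -/
theorem scale (h : HasCharacteristics ψ 0 b μ) (hμ : SubHomogeneous μ ∨ SuperHomogeneous μ)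
    {l : ℝ} (hl : 1 < l) : ∃ c : ℝ, 0 < c ∧ ∀ s : ℝ, 0 < s → l * ψ s ≤ ψ (c * s) := by
  obtain ⟨c, hc, hcs⟩ := h.laplaceExponent_scale hμ hl
  -- The integral part needs a factor at least `c`, the linear drift a factor at least `l`.
  refine ⟨max c l, lt_max_of_lt_left hc, fun s hs => ?_⟩
  have hms : 0 < max c l * s := mul_pos (lt_max_of_lt_left hc) hs
  have hmono : ∫ y, (1 - Real.exp (-(c * s * y))) ∂μ
      ≤ ∫ y, (1 - Real.exp (-(max c l * s * y))) ∂μ := by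
    refine integral_mono_ae (h.integrable_one_sub_exp (by positivity))
      (h.integrable_one_sub_exp hms.le) ?_
    filter_upwards [h.ae_pos] with y hy
    have h1 : c * s * y ≤ max c l * s * y := by gcongr; exact le_max_left _ _
    have : Real.exp (-(max c l * s * y)) ≤ Real.exp (-(c * s * y)) :=
      Real.exp_le_exp.2 (by linarith)
    linarith
  have hdrift : l * (b * s) ≤ b * (max c l * s) := by
    have : l * (b * s) ≤ max c l * (b * s) :=
      mul_le_mul_of_nonneg_right (le_max_right _ _) (mul_nonneg h.b_nonneg hs.le)
    linarith
  rw [h.eq s hs, h.eq _ hms]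
  linarith [hcs s hs]

/-- If `ρ̂ = ν̂ ∘ ψ` and `ρ` is in `𝔏_ψ`, then `ν` is in `𝔏_s`. -/
theorem mem_layer_id (h : HasCharacteristics ψ 0 b μ) (hb : ¬ BddAbove (ψ '' Set.Ioi 0))
    (hμ : SubHomogeneous μ ∨ SuperHomogeneous μ) {ν ρ : Measure ℝ} (hΦ : IsPhi ψ ν ρ)
    (hρ : ρ ∈ layer ψ) : ν ∈ layer id := by
  obtain ⟨hν, hρ', hνρ⟩ := hΦ
  have hρ0 := measure_Ioi_ne_zero_of_mem_layer hρ
  have hν0 : ν (Set.Ioi 0) ≠ 0 := by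
    intro h0
    have h1 := hνρ 1 one_pos
    rw [laplace_eq_one_of_null hν h0] at h1
    exact (laplace_lt_one hρ.1 hρ0 one_pos).ne h1
  obtain ⟨-, L, hLs, hL⟩ := hρ
  -- The candidate slowly varying factor is `x ↦ F (1/x)`; with it the defining quotient of `𝔏_s` is
  -- exactly 1.
  set F : ℝ → ℝ := fun u => (1 - laplace ν u) / u with hF
  have Fpos : ∀ u, 0 < u → 0 < F u := fun u hu =>
    div_pos (sub_pos.2 (laplace_lt_one hν hν0 hu)) hu
  have Fanti : ∀ {u v}, 0 < u → u ≤ v → F v ≤ F u := one_sub_laplace_div_antitone hν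
  have hFL : Tendsto (fun s => F (ψ s) / L s⁻¹) (𝓝[>] 0) (𝓝 1) := by
    refine hL.congr' ?_
    filter_upwards [self_mem_nhdsWithin] with s hs
    have h1 : laplace ρ s ≤ 1 := laplace_le_one hρ' (le_of_lt hs)
    rw [abs_sub_comm, abs_of_nonneg (by linarith), hνρ s hs, hF, div_div]
  have hratio : ∀ c : ℝ, 0 < c → Tendsto (fun s => F (ψ (c * s)) / F (ψ s)) (𝓝[>] 0) (𝓝 1) := by
    intro c hc
    have hcs : Tendsto (fun s : ℝ => c * s) (𝓝[>] 0) (𝓝[>] 0) := by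
      refine tendsto_nhdsWithin_iff.2 ⟨?_, ?_⟩
      · have : Continuous fun s : ℝ => c * s := by fun_prop
        simpa using (this.tendsto 0).mono_left nhdsWithin_le_nhds
      · filter_upwards [self_mem_nhdsWithin] with s hs
        exact mul_pos hc hs
    have hLc : Tendsto (fun s : ℝ => L (c⁻¹ * s⁻¹) / L s⁻¹) (𝓝[>] 0) (𝓝 1) :=
      (hLs c⁻¹ (inv_pos.2 hc)).comp tendsto_inv_nhdsGT_zero
    have h1 := ((hFL.comp hcs).mul hLc).div hFL one_ne_zero
    simp only [mul_one, div_one] at h1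
    refine h1.congr' ?_
    have hLne : ∀ᶠ s in 𝓝[>] (0 : ℝ), L (c⁻¹ * s⁻¹) / L s⁻¹ ≠ 0 :=
      hLc.eventually_ne one_ne_zero
    filter_upwards [hLne] with s hs
    have hLs0 : L s⁻¹ ≠ 0 := fun h => hs (by rw [h, div_zero])
    have hLc0 : L (c⁻¹ * s⁻¹) ≠ 0 := fun h => hs (by rw [h, zero_div])
    simp only [Function.comp_apply, mul_inv, Pi.div_apply]
    rw [div_mul_div_cancel₀ hLc0, div_div_div_cancel_right₀ hLs0]
  -- With `u = ψ s` and `l u ≤ ψ (c s)`, monotonicity gives `F (ψ (c s)) / F (ψ s) ≤ F (l u) / F u ≤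
  -- 1`, and the left side tends to 1.
  have hratio' : ∀ l : ℝ, 1 < l → Tendsto (fun u => F (l * u) / F u) (𝓝[>] 0) (𝓝 1) := by
    intro l hl
    obtain ⟨c, hc, hcl⟩ := h.scale hμ hl
    rw [tendsto_order]
    refine ⟨fun a ha => ?_, fun a ha => ?_⟩
    · have h1 := (tendsto_order.1 (hratio c hc)).1 a ha
      rw [eventually_nhdsWithin_iff, Metric.eventually_nhds_iff] at h1
      obtain ⟨δ, hδ, h1⟩ := h1
      have hψδ : 0 < ψ (δ / 2) := h.pos hb (half_pos hδ)
      filter_upwards [Ioo_mem_nhdsGT hψδ] with u hu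
      -- Every small `u` is a value of `ψ` at a small argument: `ψ` is continuous and tends to 0, so
      -- the intermediate value theorem applies.
      obtain ⟨s₀, hs₀, hs₀'⟩ : ∃ s₀ ∈ Set.Ioo 0 (δ / 2), ψ s₀ < u := by
        have h2 := (tendsto_order.1 h.tendsto_zero).2 u hu.1
        obtain ⟨s₀, h3, h4⟩ := (h2.and (Ioo_mem_nhdsGT (half_pos hδ))).exists
        exact ⟨s₀, h4, h3⟩
      have hcont : ContinuousOn ψ (Set.Icc s₀ (δ / 2)) := fun s hs =>
        (h.continuousAt (hs₀.1.trans_le hs.1)).continuousWithinAt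
      obtain ⟨s, hs, rfl⟩ := intermediate_value_Icc hs₀.2.le hcont ⟨hs₀'.le, hu.2.le⟩
      have hs0 : 0 < s := hs₀.1.trans_le hs.1
      refine (h1 (y := s) ?_ hs0).trans_le ?_
      · rw [Real.dist_eq, sub_zero, abs_of_pos hs0]
        linarith [hs.2]
      · exact div_le_div_of_nonneg_right
          (Fanti (mul_pos (by linarith) hu.1) (hcl s hs0)) (Fpos _ hu.1).le
    · filter_upwards [self_mem_nhdsWithin] with u (hu : 0 < u)
      refine lt_of_le_of_lt ?_ ha
      rw [div_le_one (Fpos u hu)]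
      exact Fanti hu (by nlinarith)
  refine ⟨hν, fun x => F x⁻¹, ?_, ?_⟩
  · have hge : ∀ l : ℝ, 1 < l → Tendsto (fun x => F (l * x)⁻¹ / F x⁻¹) atTop (𝓝 1) := by
      intro l hl
      have hl0 : 0 < l := by linarith
      have h1 : Tendsto (fun x : ℝ => (l * x)⁻¹) atTop (𝓝[>] 0) :=
        tendsto_inv_atTop_nhdsGT_zero.comp (tendsto_id.const_mul_atTop hl0)
      have h2 := ((hratio' l hl).comp h1).inv₀ one_ne_zero
      rw [inv_one] at h2
      refine h2.congr fun x => ?_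
      simp only [Function.comp_apply, inv_div, mul_inv]
      rw [mul_inv_cancel_left₀ hl0.ne']
    intro l hl
    rcases lt_trichotomy l 1 with h1 | rfl | h1
    · have hx : Tendsto (fun x : ℝ => l * x) atTop atTop := tendsto_id.const_mul_atTop hl
      have h2 := ((hge l⁻¹ ((one_lt_inv₀ hl).2 h1)).comp hx).inv₀ one_ne_zero
      rw [inv_one] at h2
      refine h2.congr fun x => ?_
      simp only [Function.comp_apply, inv_div]
      rw [inv_mul_cancel_left₀ hl.ne']
    · simp only [one_mul]
      refine tendsto_const_nhds.congr' ?_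
      filter_upwards [eventually_gt_atTop 0] with x hx
      rw [div_self (Fpos _ (inv_pos.2 hx)).ne']
    · exact hge l h1
  · refine tendsto_const_nhds.congr' ?_
    filter_upwards [self_mem_nhdsWithin] with s (hs : 0 < s)
    have h1 : 0 < 1 - laplace ν s := sub_pos.2 (laplace_lt_one hν hν0 hs)
    rw [abs_sub_comm, abs_of_pos h1, inv_inv, hF, id, mul_div_cancel₀ _ hs.ne', div_self h1.ne']

end HasCharacteristics

end CTRW

namespace CTRW

variable {E : Type*} [NormedAddCommGroup E]

/-! ### Pure jump paths -/

/-- The path that jumps by `j n` at the time `S n`. -/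
noncomputable def jumpPath (j : ℕ → E) (S : ℕ → ℝ) (t : ℝ≥0) : E :=
  ∑' n, Set.indicator (Set.Ici (S n)) (fun _ => j n) (t : ℝ)

theorem ctrw_eq_jumpPath {Ω : Type*} (J : ℕ → Ω → E) (W : ℕ → Ω → ℝ) (ω : Ω) :
    (fun t => ctrw J W t ω) = jumpPath (fun n => J n ω) (fun n => jumpTime W n ω) := rfl

/-- Only finitely many jumps have happened by time `t`, so no summability question arises. The jump
times need not be ordered. -/
theorem jumpPath_eq_sum {j : ℕ → E} {S : ℕ → ℝ} {K : ℕ} {t : ℝ≥0} (h : ∀ n, K ≤ n → (t : ℝ) < S n) :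
    jumpPath j S t = ∑ n ∈ Finset.range K, if S n ≤ t then j n else 0 := by
  classical
  rw [jumpPath, tsum_eq_sum (s := Finset.range K)]
  · refine Finset.sum_congr rfl fun n _ => ?_
    simp [Set.indicator_apply]
  · intro n hn
    have := h n (by simpa using hn)
    simp [this]

theorem eventually_le_iff_nhdsGE (S : ℝ) (t : ℝ≥0) :
    ∀ᶠ v : ℝ≥0 in 𝓝[≥] t, (S ≤ v ↔ S ≤ t) := by
  rcases le_or_gt S t with h | h
  · filter_upwards [self_mem_nhdsWithin] with v (hv : t ≤ v)
    have : (t : ℝ) ≤ v := hv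
    exact ⟨fun _ => h, fun _ => h.trans this⟩
  · have : ∀ᶠ v : ℝ≥0 in 𝓝 t, (v : ℝ) < S :=
      NNReal.continuous_coe.continuousAt.eventually_lt continuousAt_const h
    filter_upwards [nhdsWithin_le_nhds this] with v hv
    exact ⟨fun h' => absurd h' hv.not_ge, fun h' => absurd h' h.not_ge⟩

theorem eventually_le_iff_nhdsLT (S : ℝ) (t : ℝ≥0) :
    ∀ᶠ v : ℝ≥0 in 𝓝[<] t, (S ≤ v ↔ S < t) := by
  rcases lt_or_ge S t with h | h
  · have : ∀ᶠ v : ℝ≥0 in 𝓝 t, S < v :=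
      continuousAt_const.eventually_lt NNReal.continuous_coe.continuousAt h
    filter_upwards [nhdsWithin_le_nhds this] with v hv
    exact ⟨fun _ => h, fun _ => hv.le⟩
  · filter_upwards [self_mem_nhdsWithin] with v (hv : v < t)
    have : (v : ℝ) < t := hv
    exact ⟨fun h' => by linarith, fun h' => by linarith⟩

theorem tendsto_jumpPath_nhdsLT {j : ℕ → E} {S : ℕ → ℝ} {K : ℕ} {t : ℝ≥0}
    (h : ∀ n, K ≤ n → (t : ℝ) ≤ S n) :
    Tendsto (jumpPath j S) (𝓝[<] t)
      (𝓝 (∑ n ∈ Finset.range K, if S n < t then j n else 0)) := by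
  refine tendsto_const_nhds.congr' ?_
  have h1 : ∀ᶠ v : ℝ≥0 in 𝓝[<] t, ∀ n ∈ Finset.range K, (S n ≤ v ↔ S n < t) :=
    (eventually_all_finset _).2 fun n _ => eventually_le_iff_nhdsLT (S n) t
  filter_upwards [h1, self_mem_nhdsWithin] with v hv (hvt : v < t)
  rw [jumpPath_eq_sum (K := K) fun n hn => (NNReal.coe_lt_coe.2 hvt).trans_le (h n hn)]
  exact Finset.sum_congr rfl fun n hn => by simp only [hv n hn]

theorem exists_forall_lt_of_tendsto {S : ℕ → ℝ} (h : Tendsto S atTop atTop) (c : ℝ) :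
    ∃ K, ∀ n, K ≤ n → c < S n :=
  eventually_atTop.1 (h.eventually_gt_atTop c)

theorem isCadlag_jumpPath (j : ℕ → E) {S : ℕ → ℝ} (h : Tendsto S atTop atTop) :
    IsCadlag (jumpPath j S) := by
  intro t
  obtain ⟨K, hK⟩ := exists_forall_lt_of_tendsto h (t + 1)
  refine ⟨?_, _, tendsto_jumpPath_nhdsLT (K := K) fun n hn => ?_⟩
  · have h1 : ∀ᶠ v : ℝ≥0 in 𝓝[≥] t, ∀ n ∈ Finset.range K, (S n ≤ v ↔ S n ≤ t) :=
      (eventually_all_finset _).2 fun n _ => eventually_le_iff_nhdsGE (S n) t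
    have h2 : ∀ᶠ v : ℝ≥0 in 𝓝[≥] t, v < t + 1 :=
      nhdsWithin_le_nhds (Iio_mem_nhds (lt_add_one t))
    refine tendsto_const_nhds.congr' ?_
    filter_upwards [h1, h2] with v hv hvt
    have hvt' : (v : ℝ) < t + 1 := by exact_mod_cast hvt
    rw [jumpPath_eq_sum (K := K) fun n hn => (lt_add_one _).trans (hK n hn),
      jumpPath_eq_sum (K := K) fun n hn => hvt'.trans (hK n hn)]
    exact Finset.sum_congr rfl fun n hn => by simp only [hv n hn]
  · linarith [hK n hn]

/-- At `t = 0` there is nothing to the left and `leftLim` is by convention the value itself; hence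
the positivity of `t`. -/
theorem leftLim_jumpPath {j : ℕ → E} {S : ℕ → ℝ} {K : ℕ} {t : ℝ≥0} (ht : 0 < t)
    (h : ∀ n, K ≤ n → (t : ℝ) ≤ S n) :
    Function.leftLim (jumpPath j S) t = ∑ n ∈ Finset.range K, if S n < t then j n else 0 := by
  have : (𝓝[<] t).NeBot := nhdsLT_neBot_of_exists_lt ⟨0, ht⟩
  exact leftLim_eq_of_tendsto (tendsto_jumpPath_nhdsLT h)

/-! ### Inverses of nondecreasing paths -/

/-- The right-continuous inverse of a path. -/
noncomputable def pathInverse (D : ℝ≥0 → ℝ) (r : ℝ≥0) : ℝ≥0 := sInf {u : ℝ≥0 | (r : ℝ) < D u}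

section pathInverse

variable {D : ℝ≥0 → ℝ}

theorem pathInverse_le {r u : ℝ≥0} (h : (r : ℝ) < D u) : pathInverse D r ≤ u :=
  csInf_le' h

theorem le_of_lt_pathInverse {r u : ℝ≥0} (h : u < pathInverse D r) : D u ≤ r :=
  not_lt.1 fun h' => (pathInverse_le h').not_gt h

/-- Guards against the default value `sInf ∅ = 0`. -/
theorem nonempty_lt_of_tendsto (h : Tendsto D atTop atTop) (r : ℝ≥0) :
    {u : ℝ≥0 | (r : ℝ) < D u}.Nonempty :=
  (h.eventually_gt_atTop (r : ℝ)).exists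

theorem exists_lt_of_pathInverse_lt (h : Tendsto D atTop atTop) {r u : ℝ≥0}
    (hu : pathInverse D r < u) : ∃ v < u, (r : ℝ) < D v := by
  obtain ⟨v, hv, hvu⟩ := exists_lt_of_csInf_lt (nonempty_lt_of_tendsto h r) hu
  exact ⟨v, hvu, hv⟩

theorem pathInverse_mono (h : Tendsto D atTop atTop) : Monotone (pathInverse D) :=
  fun _ r' hr => csInf_le_csInf' (nonempty_lt_of_tendsto h r') fun _ hu =>
    lt_of_le_of_lt (NNReal.coe_le_coe.2 hr) hu

/-- By right continuity `D` stays below `r` on an interval to the right of `u`, which makes the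
inequality strict. -/
theorem lt_pathInverse (hmono : Monotone D) (hc : ∀ t, ContinuousWithinAt D (Set.Ici t) t)
    (h : Tendsto D atTop atTop) {r u : ℝ≥0} (hu : D u < r) : u < pathInverse D r := by
  have h1 : ∀ᶠ v in 𝓝[≥] u, D v < r := (hc u).eventually_lt tendsto_const_nhds hu
  obtain ⟨w, hw, hw'⟩ := mem_nhdsGE_iff_exists_Ico_subset.1 h1
  obtain ⟨v, huv, hvw⟩ := exists_between (Set.mem_Ioi.1 hw)
  refine huv.trans_le (le_csInf (nonempty_lt_of_tendsto h r) fun x hx => ?_)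
  by_contra! hxv
  exact absurd (hw' ⟨huv.le, hvw⟩) (not_lt.2 ((le_of_lt hx).trans (hmono hxv.le)))

/-- The time change of a jump path by the inverse of `D` moves the jump at `S n` to `D (S n)`. -/
theorem rightLim_leftLim_jumpPath (hmono : Monotone D)
    (hc : ∀ t, ContinuousWithinAt D (Set.Ici t) t) (h : Tendsto D atTop atTop) (h0 : D 0 = 0)
    (j : ℕ → E) {S : ℕ → ℝ≥0} (hS : Tendsto S atTop atTop) (t : ℝ≥0) :
    Function.rightLim
        (fun r => Function.leftLim (jumpPath j fun n => (S n : ℝ)) (pathInverse D r)) t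
      = jumpPath j (fun n => D (S n)) t := by
  obtain ⟨K, hK⟩ := eventually_atTop.1 (hS.eventually_gt_atTop (pathInverse D (t + 1)))
  have hDK : ∀ n, K ≤ n → (t : ℝ) < D (S n) := fun n hn => by
    obtain ⟨v, hv, hv'⟩ := exists_lt_of_pathInverse_lt h (hK n hn)
    push_cast at hv'
    linarith [hmono hv.le]
  have hne : (𝓝[>] t).NeBot := nhdsGT_neBot_of_exists_gt ⟨t + 1, lt_add_one t⟩
  refine rightLim_eq_of_tendsto (tendsto_const_nhds.congr' ?_)
  -- The heart of the matter: the left limit of the jump path sees the jumps with `S n` strictly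
  -- below the inverse at `r`, and for `r` just above `t` these are the jumps with `D (S n) ≤ t`.
  have h1 : ∀ᶠ r : ℝ≥0 in 𝓝[>] t, ∀ n ∈ Finset.range K, (S n < pathInverse D r ↔ D (S n) ≤ t) := by
    refine (eventually_all_finset _).2 fun n _ => ?_
    rcases le_or_gt (D (S n)) t with hn | hn
    · filter_upwards [self_mem_nhdsWithin] with r (hr : t < r)
      exact ⟨fun _ => hn, fun _ => lt_pathInverse hmono hc h
        (hn.trans_lt (NNReal.coe_lt_coe.2 hr))⟩
    · have : ∀ᶠ r : ℝ≥0 in 𝓝 t, (r : ℝ) < D (S n) :=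
        NNReal.continuous_coe.continuousAt.eventually_lt continuousAt_const hn
      filter_upwards [nhdsWithin_le_nhds this] with r hr
      exact ⟨fun h' => absurd h' (pathInverse_le hr).not_gt, fun h' => absurd h' hn.not_ge⟩
  filter_upwards [h1, Ioo_mem_nhdsGT (lt_add_one t)] with r hr hrt
  have hpos : 0 < pathInverse D r := lt_pathInverse hmono hc h (by
    rw [h0]; exact_mod_cast (zero_le (a := t)).trans_lt hrt.1)
  rw [jumpPath_eq_sum hDK, leftLim_jumpPath (K := K) hpos fun n hn => ?_]
  · refine Finset.sum_congr rfl fun n hn => ?_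
    simp only [NNReal.coe_lt_coe, hr n hn]
  · exact NNReal.coe_le_coe.2 ((pathInverse_mono h hrt.2.le).trans (hK n hn).le)

end pathInverse

/-! ### Order isomorphisms matching two sequences of times -/

/-- The map is piecewise linear, with slope `v' k / v k` on the `k`-th step and slope 1 after the
last one; `φ k t` is the time spent in step `k` up to `t`. The displacement is at most `∑ |c k - 1|
v k = ∑ |v' k - v k|`. Steps of length zero cannot be stretched, so they must correspond to each
other. -/
theorem exists_orderIso_matching (K : ℕ) (v v' : ℕ → ℝ≥0) (h : ∀ k < K, v k = 0 ↔ v' k = 0) :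
    ∃ τ : ℝ≥0 ≃o ℝ≥0,
      (∀ k < K, τ (∑ i ∈ Finset.range (k + 1), v i) = ∑ i ∈ Finset.range (k + 1), v' i) ∧
      ∀ t, dist (τ t) t ≤ ∑ i ∈ Finset.range K, dist (v' i) (v i) := by
  set S : ℕ → ℝ≥0 := fun k => ∑ i ∈ Finset.range k, v i with hS
  set φ : ℕ → ℝ≥0 → ℝ≥0 := fun k t => min (t - S k) (v k) with hφ
  set c : ℕ → ℝ≥0 := fun k => if v k = 0 then 1 else v' k / v k with hc
  have hcpos : ∀ k ∈ Finset.range K, 0 < c k := by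
    intro k hk
    simp only [hc]
    split_ifs with h0
    · exact one_pos
    · exact div_pos (pos_iff_ne_zero.2 ((h k (Finset.mem_range.1 hk)).not.1 h0))
        (pos_iff_ne_zero.2 h0)
  have hcv : ∀ k < K, c k * v k = v' k := by
    intro k hk
    simp only [hc]
    split_ifs with h0
    · rw [h0, mul_zero, ((h k hk).1 h0)]
    · exact div_mul_cancel₀ _ h0
  have hid : ∀ t n, ∑ k ∈ Finset.range n, φ k t + (t - S n) = t := by
    intro t n
    induction n with
    | zero => simp [hS]
    | succ n ih =>
      rw [Finset.sum_range_succ, add_assoc]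
      have : φ n t + (t - S (n + 1)) = t - S n := by
        simp only [hφ, hS, Finset.sum_range_succ]
        rw [← tsub_tsub]
        rcases le_total (t - ∑ i ∈ Finset.range n, v i) (v n) with hle | hle
        · rw [min_eq_left hle, tsub_eq_zero_of_le hle, add_zero]
        · rw [min_eq_right hle, add_tsub_cancel_of_le hle]
      rw [this, ih]
  have φmono : ∀ k, Monotone (φ k) := fun k s t hst => min_le_min (tsub_le_tsub_right hst _) le_rfl
  set f : ℝ≥0 → ℝ≥0 := fun t => ∑ k ∈ Finset.range K, c k * φ k t + (t - S K) with hf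
  have f_mono : Monotone f := fun s t hst => add_le_add
    (Finset.sum_le_sum fun k _ => mul_le_mul_right (φmono k hst) _) (tsub_le_tsub_right hst _)
  -- Equality of `f` at two points forces equality of all its monotone summands; as the slopes are
  -- positive, the decomposition `hid` recovers the point.
  have f_strict : StrictMono f := by
    intro s t hst
    refine lt_of_le_of_ne (f_mono hst.le) fun heq => hst.ne ?_
    have h1 : ∀ k ∈ Finset.range K, c k * φ k s ≤ c k * φ k t :=
      fun k _ => mul_le_mul_right (φmono k hst.le) _
    obtain ⟨h2, h3⟩ := (add_eq_add_iff_eq_and_eq (Finset.sum_le_sum h1)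
      (tsub_le_tsub_right hst.le (S K))).1 heq
    have h4 := (Finset.sum_eq_sum_iff_of_le h1).1 h2
    rw [← hid s K, ← hid t K, h3]
    congr 1
    exact Finset.sum_congr rfl fun k hk => mul_left_cancel₀ (hcpos k hk).ne' (h4 k hk)
  have f_cont : Continuous f := by
    simp only [hf, hφ]
    fun_prop
  have f_surj : Function.Surjective f := by
    intro y
    have h0 : f 0 = 0 := by simp [hf, hφ]
    have h1 : y ≤ f (y + S K) := by simp [hf]
    obtain ⟨x, -, hx⟩ := intermediate_value_Icc (zero_le (a := y + S K)) f_cont.continuousOn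
      ⟨by rw [h0]; exact zero_le, h1⟩
    exact ⟨x, hx⟩
  refine ⟨f_strict.orderIsoOfSurjective f f_surj, fun m hm => ?_, fun t => ?_⟩
  · have Smono : Monotone S := fun a b hab =>
      Finset.sum_le_sum_of_subset (Finset.range_mono hab)
    change f (S (m + 1)) = _
    simp only [hf]
    rw [tsub_eq_zero_of_le (Smono (Nat.succ_le_of_lt hm)), add_zero,
      ← Finset.sum_subset (Finset.range_mono (Nat.succ_le_of_lt hm))]
    · refine Finset.sum_congr rfl fun k hk => ?_
      have hk' : k + 1 ≤ m + 1 := Finset.mem_range.1 hk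
      have : v k ≤ S (m + 1) - S k := by
        refine le_tsub_of_add_le_left ?_
        rw [← Finset.sum_range_succ]
        exact Smono hk'
      rw [show φ k (S (m + 1)) = v k from min_eq_right this, hcv k (by omega)]
    · intro k _ hk
      have hk' : m + 1 ≤ k := by simpa using hk
      have : S (m + 1) - S k = 0 := tsub_eq_zero_of_le (Smono hk')
      simp [hφ, this]
  · change dist (f t) t ≤ _
    have ht : ∑ k ∈ Finset.range K, (φ k t : ℝ) + ((t - S K : ℝ≥0) : ℝ) = t := by
      exact_mod_cast hid t K
    simp only [hf, NNReal.dist_eq, NNReal.coe_add, NNReal.coe_sum, NNReal.coe_mul]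
    rw [show ∑ k ∈ Finset.range K, (c k : ℝ) * φ k t + ((t - S K : ℝ≥0) : ℝ) - t
        = ∑ k ∈ Finset.range K, ((c k : ℝ) * φ k t - φ k t) by
      rw [Finset.sum_sub_distrib]; linarith]
    refine (Finset.abs_sum_le_sum_abs _ _).trans (Finset.sum_le_sum fun k hk => ?_)
    have h1 : (v' k : ℝ) = c k * v k := by
      rw [← hcv k (Finset.mem_range.1 hk)]; push_cast; rfl
    rw [h1, ← sub_one_mul, ← sub_one_mul, abs_mul, abs_mul]
    refine mul_le_mul_of_nonneg_left ?_ (abs_nonneg _)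
    rw [abs_of_nonneg (NNReal.coe_nonneg _), abs_of_nonneg (NNReal.coe_nonneg _)]
    exact NNReal.coe_le_coe.2 (min_le_right _ _)

/-! ### Measurability into the Skorokhod space -/

/-- The sequences of space-time jumps with nonnegative waiting times of infinite sum. -/
def regularJumps (E : Type*) : Set (ℕ → E × ℝ) :=
  {x | (∀ n, 0 ≤ (x n).2) ∧
    Tendsto (fun n => ∑ i ∈ Finset.range (n + 1), (x i).2) atTop atTop}

/-- The element of the Skorokhod space given by a càdlàg function. -/
def Skorokhod.mk (f : ℝ≥0 → E) (hf : IsCadlag f) : Skorokhod E := ⟨f, hf⟩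

theorem isCadlag_zero : IsCadlag fun _ : ℝ≥0 => (0 : E) :=
  fun _ => ⟨continuousWithinAt_const, 0, tendsto_const_nhds⟩

open Classical in
/-- The path of the CTRW with the given space-time jumps. -/
noncomputable def toSkorokhod (x : ℕ → E × ℝ) : Skorokhod E :=
  if h : x ∈ regularJumps E then .mk _ (isCadlag_jumpPath (fun n => (x n).1) h.2)
  else .mk _ isCadlag_zero

theorem toSkorokhod_val {x : ℕ → E × ℝ} (h : x ∈ regularJumps E) :
    (toSkorokhod x).1
      = jumpPath (fun n => (x n).1) (fun n => ∑ i ∈ Finset.range (n + 1), (x i).2) := by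
  rw [toSkorokhod, dif_pos h]
  rfl

/-- The map is continuous only when zero waiting times are kept zero: two simultaneous jumps are not
a `J₁` limit of two successive ones. Under this condition a time change matches the first jump times
exactly, and only the jump sizes differ. -/
theorem toSkorokhod_mem_nbhd {x : ℕ → E × ℝ} (hx : x ∈ regularJumps E) {ε : ℝ} (hε : 0 < ε) :
    ∃ (K : ℕ) (δ : ℝ), 0 < δ ∧ ∀ y ∈ regularJumps E,
      (∀ k < K, dist (y k).1 (x k).1 < δ ∧ dist (y k).2 (x k).2 < δ ∧
        ((y k).2 = 0 ↔ (x k).2 = 0)) → toSkorokhod y ∈ Skorokhod.nbhd (toSkorokhod x) ε := by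
  obtain ⟨K, hK⟩ := exists_forall_lt_of_tendsto hx.2 (1 / ε)
  -- The `K + 1` relevant terms contribute at most `ε / (K + 2)` each, for a total below `ε`.
  refine ⟨K + 1, ε / (K + 2), by positivity, fun y hy hxy => ?_⟩
  have hlt : ((K + 1 : ℕ) : ℝ) * (ε / (K + 2)) < ε := by
    rw [← mul_div_assoc, div_lt_iff₀ (by positivity)]
    push_cast
    nlinarith
  set v : ℕ → ℝ≥0 := fun n => ⟨(x n).2, hx.1 n⟩ with hv
  set v' : ℕ → ℝ≥0 := fun n => ⟨(y n).2, hy.1 n⟩ with hv'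
  have hS : ∀ n, ∑ i ∈ Finset.range (n + 1), (x i).2
      = ((∑ i ∈ Finset.range (n + 1), v i : ℝ≥0) : ℝ) := fun n => by
    rw [NNReal.coe_sum]; rfl
  have hS' : ∀ n, ∑ i ∈ Finset.range (n + 1), (y i).2
      = ((∑ i ∈ Finset.range (n + 1), v' i : ℝ≥0) : ℝ) := fun n => by
    rw [NNReal.coe_sum]; rfl
  obtain ⟨τ, hτ, hτd⟩ := exists_orderIso_matching (K + 1) v v' fun k hk => by
    have := (hxy k hk).2.2
    rw [← NNReal.coe_eq_zero, ← NNReal.coe_eq_zero]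
    exact this.symm
  refine ⟨τ, fun t => (hτd t).trans_lt (lt_of_le_of_lt ?_ hlt), fun t ht => ?_⟩
  · refine (Finset.sum_le_card_nsmul _ _ (ε / (K + 2)) fun k hk => ?_).trans (by simp)
    exact (hxy k (Finset.mem_range.1 hk)).2.1.le
  · have h1 : ∀ n, K + 1 ≤ n → (t : ℝ) < ∑ i ∈ Finset.range (n + 1), (x i).2 := fun n hn =>
      ht.trans_lt (hK n (by omega))
    have h2 : ∀ n, K + 1 ≤ n → (τ t : ℝ) < ∑ i ∈ Finset.range (n + 1), (y i).2 := fun n hn => by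
      have h3 : t < ∑ i ∈ Finset.range (K + 1), v i := by
        rw [← NNReal.coe_lt_coe, ← hS]
        exact ht.trans_lt (hK K le_rfl)
      have h4 := τ.strictMono h3
      rw [hτ K (by omega)] at h4
      rw [hS', NNReal.coe_lt_coe]
      exact h4.trans_le (Finset.sum_le_sum_of_subset (Finset.range_mono (by omega)))
    rw [toSkorokhod_val hx, toSkorokhod_val hy, jumpPath_eq_sum h1, jumpPath_eq_sum h2,
      ← Finset.sum_sub_distrib]
    refine (norm_sum_le _ _).trans_lt (lt_of_le_of_lt ?_ hlt)
    refine (Finset.sum_le_card_nsmul _ _ (ε / (K + 2)) fun k hk => ?_).trans (by simp)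
    have hk' := Finset.mem_range.1 hk
    have h5 : (∑ i ∈ Finset.range (k + 1), (y i).2 ≤ (τ t : ℝ))
        ↔ ∑ i ∈ Finset.range (k + 1), (x i).2 ≤ (t : ℝ) := by
      rw [hS, hS', NNReal.coe_le_coe, NNReal.coe_le_coe, ← hτ k hk', τ.le_iff_le]
    simp only [h5]
    split_ifs
    · rw [← dist_eq_norm]
      exact (hxy k hk').1.le
    · rw [sub_zero, norm_zero]
      positivity

theorem measurableSet_regularJumps {F : Type*} [MeasurableSpace F] :
    MeasurableSet (regularJumps F) := by
  refine MeasurableSet.inter (s₁ := {x : ℕ → F × ℝ | ∀ n, 0 ≤ (x n).2}) ?_ ?_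
  · rw [Set.ofPred_forall]
    exact MeasurableSet.iInter fun n => measurableSet_le (by fun_prop) (by fun_prop)
  · exact measurableSet_tendsto _ fun n => by fun_prop

/-- Recording for each waiting time whether it vanishes, by an extra discrete coordinate, restores
continuity on the regular sequences. That coordinate is measurable, and second countability makes
open sets of the countable product measurable. -/
theorem measurable_toSkorokhod [MeasurableSpace E] [BorelSpace E] [SecondCountableTopology E] :
    Measurable (toSkorokhod (E := E)) := by
  refine measurable_of_isOpen fun U hU => ?_
  set i : (ℕ → E × ℝ) → ℕ → E × ℝ × Bool :=
    fun x k => ((x k).1, (x k).2, decide ((x k).2 = 0)) with hi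
  have hi_meas : Measurable i := by
    refine measurable_pi_lambda _ fun k => Measurable.prodMk (by fun_prop)
      (Measurable.prodMk (by fun_prop) ?_)
    refine measurable_to_bool ?_
    have : (fun x : ℕ → E × ℝ => decide ((x k).2 = 0)) ⁻¹' {true} = {x | (x k).2 = 0} := by
      ext x; simp
    rw [this]
    exact measurableSet_eq_fun (by fun_prop) measurable_const
  -- The largest open set whose trace on the regular sequences maps into `U`; finite-dimensional
  -- cylinders show that it covers the whole preimage.
  set O : Set (ℕ → E × ℝ × Bool) :=
    ⋃₀ {V | IsOpen V ∧ ∀ y ∈ regularJumps E, i y ∈ V → toSkorokhod y ∈ U} with hO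
  have hOpen : IsOpen O := isOpen_sUnion fun V hV => hV.1
  have hset : toSkorokhod ⁻¹' U
      = (regularJumps E ∩ i ⁻¹' O) ∪
        ((regularJumps E)ᶜ ∩ {_x | Skorokhod.mk _ isCadlag_zero ∈ U}) := by
    ext x
    by_cases hx : x ∈ regularJumps E
    · simp only [Set.mem_preimage, Set.mem_union, Set.mem_inter_iff, hx, Set.mem_compl_iff,
        true_and, not_true, false_and, or_false]
      constructor
      · intro hxU
        obtain ⟨ε, hε, hεU⟩ := hU _ hxU
        obtain ⟨K, δ, hδ, hK⟩ := toSkorokhod_mem_nbhd hx hε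
        refine ⟨⋂ k ∈ Finset.range K, {z | dist (z k).1 (x k).1 < δ ∧ dist (z k).2.1 (x k).2 < δ ∧
          (z k).2.2 = decide ((x k).2 = 0)}, ⟨?_, ?_⟩, ?_⟩
        · refine isOpen_biInter_finset fun k _ => IsOpen.and ?_ (IsOpen.and ?_ ?_)
          · exact isOpen_lt (by fun_prop) continuous_const
          · exact isOpen_lt (by fun_prop) continuous_const
          · have : Continuous fun z : ℕ → E × ℝ × Bool => (z k).2.2 := by fun_prop
            exact (isOpen_discrete {decide ((x k).2 = 0)}).preimage this
        · intro y hy hyV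
          refine hεU (hK y hy fun k hk => ?_)
          have := Set.mem_iInter₂.1 hyV k (Finset.mem_range.2 hk)
          exact ⟨this.1, this.2.1, by simpa [hi] using this.2.2⟩
        · refine Set.mem_iInter₂.2 fun k _ => ?_
          simp [hi, hδ]
      · rintro ⟨V, hV, hxV⟩
        exact hV.2 x hx hxV
    · have : toSkorokhod x = Skorokhod.mk _ isCadlag_zero := by rw [toSkorokhod, dif_neg hx]
      simp [hx, this]
  rw [hset]
  exact (measurableSet_regularJumps.inter (hi_meas hOpen.measurableSet)).union
    (measurableSet_regularJumps.compl.inter (MeasurableSet.const _))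

/-- Paths that leave `0` before the time `a` form an open set. -/
theorem isOpen_exists_ne_zero (a : ℝ) :
    IsOpen {f : Skorokhod E | ∃ t : ℝ≥0, (t : ℝ) < a ∧ f.1 t ≠ 0} := by
  rintro f ⟨t, hta, hft⟩
  have hn : 0 < ‖f.1 t‖ := norm_pos_iff.2 hft
  -- The three bounds keep `τ t` below `a`, keep `g (τ t)` away from 0, and put `t` inside the
  -- window `[0, 1/ε]`.
  refine ⟨min (min (a - t) ‖f.1 t‖) (1 / (t + 1)), ?_, ?_⟩
  · have := sub_pos.2 hta
    positivity
  · rintro g ⟨τ, h1, h2⟩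
    refine ⟨τ t, ?_, fun hg => ?_⟩
    · have h3 := (h1 t).trans_le ((min_le_left _ _).trans (min_le_left _ _))
      rw [NNReal.dist_eq] at h3
      linarith [le_abs_self ((τ t : ℝ) - t)]
    · have h3 := h2 t ?_
      · rw [hg, zero_sub, norm_neg] at h3
        exact (h3.trans_le ((min_le_left _ _).trans (min_le_right _ _))).false
      · have hm : 0 < min (min (a - t) ‖f.1 t‖) (1 / ((t : ℝ) + 1)) := by
          have := sub_pos.2 hta
          positivity
        rw [le_div_iff₀ hm]
        have h4 : (t : ℝ) * min (min (a - t) ‖f.1 t‖) (1 / ((t : ℝ) + 1))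
            ≤ t * (1 / ((t : ℝ) + 1)) := by gcongr; exact min_le_right _ _
        refine h4.trans ?_
        rw [mul_one_div, div_le_one (by positivity)]
        linarith

end CTRW

namespace CTRW

variable {E : Type*} [NormedAddCommGroup E]

/-! ### Sums of independent waiting times -/

section Divergence

variable {Ω : Type*} [MeasurableSpace Ω] {P : Measure Ω}

theorem exists_measure_Ici_ne_zero {ν : Measure ℝ} (h : ν (Set.Ioi 0) ≠ 0) :
    ∃ ε : ℝ, 0 < ε ∧ ν (Set.Ici ε) ≠ 0 := by
  by_contra! hcon
  refine h ?_
  have : Set.Ioi (0 : ℝ) ⊆ ⋃ n : ℕ, Set.Ici (1 / ((n : ℝ) + 1)) := by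
    intro x hx
    obtain ⟨n, hn⟩ := exists_nat_one_div_lt (Set.mem_Ioi.1 hx)
    exact Set.mem_iUnion.2 ⟨n, hn.le⟩
  exact measure_mono_null this (measure_iUnion_null fun n => hcon _ (by positivity))

/-- Sums of i.i.d. nonnegative random variables that are not almost surely `0` diverge. -/
theorem ae_tendsto_jumpTime [IsProbabilityMeasure P] {W : ℕ → Ω → ℝ} (hm : ∀ k, Measurable (W k))
    (hind : iIndepFun W P) (hid : ∀ k, IdentDistrib (W k) (W 0) P P)
    (hnn : ∀ᵐ ω ∂P, 0 ≤ W 0 ω) (hpos : P.map (W 0) (Set.Ioi 0) ≠ 0) :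
    ∀ᵐ ω ∂P, (∀ k, 0 ≤ W k ω) ∧ Tendsto (fun n => jumpTime W n ω) atTop atTop := by
  obtain ⟨ε, hε, hε'⟩ := exists_measure_Ici_ne_zero hpos
  rw [Measure.map_apply (hm 0) measurableSet_Ici] at hε'
  have hms : ∀ n, MeasurableSet (W n ⁻¹' Set.Ici ε) := fun n => hm n measurableSet_Ici
  have hset : iIndepSet (fun n => W n ⁻¹' Set.Ici ε) P :=
    (iIndepSet_iff_meas_biInter hms).2 fun s =>
      hind.measure_inter_preimage_eq_mul s fun _ _ => measurableSet_Ici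
  have hsum : ∑' n, P (W n ⁻¹' Set.Ici ε) = ∞ := by
    rw [tsum_congr fun n => (hid n).measure_mem_eq measurableSet_Ici]
    exact ENNReal.tsum_const_eq_top_of_ne_zero hε'
  -- Second Borel–Cantelli lemma: infinitely many waiting times are at least `ε`, so their series
  -- cannot converge.
  have hlim := measure_limsup_eq_one hms hset hsum
  have hae : ∀ᵐ ω ∂P, ω ∈ limsup (fun n => W n ⁻¹' Set.Ici ε) atTop :=
    (prob_compl_eq_zero_iff (MeasurableSet.measurableSet_limsup hms)).2 hlim
  have hnn' : ∀ᵐ ω ∂P, ∀ k, 0 ≤ W k ω :=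
    ae_all_iff.2 fun k => (hid k).symm.ae_snd (p := fun x => 0 ≤ x) measurableSet_Ici hnn
  filter_upwards [hae, hnn'] with ω h1 h2
  refine ⟨h2, ?_⟩
  rw [mem_limsup_iff_frequently_mem] at h1
  refine (tendsto_add_atTop_iff_nat (f := fun n => ∑ i ∈ Finset.range n, W i ω) 1).2 ?_
  rw [← not_summable_iff_tendsto_nat_atTop_of_nonneg h2]
  intro hs
  have h3 := hs.tendsto_atTop_zero.eventually_lt_const hε
  obtain ⟨n, h4, h5⟩ := (h1.and_eventually h3).exists
  exact (not_le.2 h5) h4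

namespace IsIIDJumps

variable {F : Type*} [MeasurableSpace F] {J : ℕ → Ω → F} {W : ℕ → Ω → ℝ}

theorem iIndepFun_wait (h : IsIIDJumps J W P) : iIndepFun W P :=
  h.indep.comp (fun _ => Prod.snd) fun _ => measurable_snd

theorem identDistrib_wait (h : IsIIDJumps J W P) (k : ℕ) : IdentDistrib (W k) (W 0) P P :=
  (h.identDistrib k).comp measurable_snd

theorem ae_tendsto_jumpTime [IsProbabilityMeasure P] (h : IsIIDJumps J W P)
    (hnn : ∀ᵐ ω ∂P, 0 ≤ W 0 ω) (hpos : P.map (W 0) (Set.Ioi 0) ≠ 0) :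
    ∀ᵐ ω ∂P, (∀ k, 0 ≤ W k ω) ∧ Tendsto (fun n => jumpTime W n ω) atTop atTop :=
  CTRW.ae_tendsto_jumpTime h.measurable_wait h.iIndepFun_wait h.identDistrib_wait hnn hpos

end IsIIDJumps

end Divergence

/-! ### Paths of subordinators -/

section Subordinator

variable {ψ : ℝ → ℝ} {b : ℝ} {μ : Measure ℝ} {Ω : Type*} [MeasurableSpace Ω] {P : Measure Ω}
  {D : ℝ≥0 → Ω → ℝ}

/-- Chernoff bound. Letting `s → ∞` gives strict positivity of `D u`; letting `u → ∞` with `s` fixed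
gives divergence of the paths. -/
theorem IsSubordinator.measure_le_le (h : IsSubordinator ψ D P)
    (u : ℝ≥0) (c : ℝ) {s : ℝ} (hs : 0 < s) :
    P.real {ω | D u ω ≤ c} ≤ Real.exp (s * c) * Real.exp (-(u * ψ s)) := by
  -- A nonzero integral forces integrability, since otherwise the integral is 0 by convention.
  have hint : Integrable (fun ω => Real.exp (-(s * D u ω))) P :=
    Integrable.of_integral_ne_zero (by rw [h.laplace_eq u s hs]; exact (Real.exp_pos _).ne')
  have h1 := mul_meas_ge_le_integral_of_nonneg (ae_of_all _ fun ω => (Real.exp_pos _).le) hint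
    (Real.exp (-(s * c)))
  have h2 : {ω | Real.exp (-(s * c)) ≤ Real.exp (-(s * D u ω))} = {ω | D u ω ≤ c} := by
    ext ω
    simp [hs]
  rw [h.laplace_eq u s hs, h2, Real.exp_neg, inv_mul_le_iff₀ (Real.exp_pos _)] at h1
  exact h1

theorem IsSubordinator.measure_le_zero [IsFiniteMeasure P] (h : IsSubordinator ψ D P)
    (hψ : Tendsto ψ atTop atTop) {u : ℝ≥0} (hu : 0 < u) : P {ω | D u ω ≤ 0} = 0 := by
  rw [← measureReal_eq_zero_iff]
  refine le_antisymm ?_ measureReal_nonneg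
  have hlim : Tendsto (fun s => Real.exp (-(u * ψ s))) atTop (𝓝 0) :=
    Real.tendsto_exp_neg_atTop_nhds_zero.comp (hψ.const_mul_atTop (NNReal.coe_pos.2 hu))
  refine ge_of_tendsto hlim ?_
  filter_upwards [eventually_gt_atTop 0] with s hs
  simpa using h.measure_le_le u 0 hs

/-- Increments between points of a countable dense set are simultaneously positive; monotonicity
extends this to strict increase everywhere. Divergence is checked along the integers. -/
theorem IsSubordinator.ae_paths [IsFiniteMeasure P] (h : IsSubordinator ψ D P)
    (hψ : Tendsto ψ atTop atTop) :
    ∀ᵐ ω ∂P, D 0 ω = 0 ∧ StrictMono (fun t => D t ω) ∧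
      (∀ t, ContinuousWithinAt (fun t => D t ω) (Set.Ici t) t) ∧
      Tendsto (fun t => D t ω) atTop atTop := by
  obtain ⟨R, hRc, hRd⟩ := TopologicalSpace.exists_countable_dense ℝ≥0
  have h1 : ∀ᵐ ω ∂P, ∀ p ∈ R, ∀ q ∈ R, p < q → 0 < D q ω - D p ω := by
    refine (ae_ball_iff hRc).2 fun p _ => (ae_ball_iff hRc).2 fun q _ => ?_
    by_cases hpq : p < q
    · obtain ⟨u, rfl⟩ := exists_add_of_le hpq.le
      have hu : 0 < u := by simpa using hpq
      have h2 : ∀ᵐ ω ∂P, 0 < D u ω := by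
        rw [ae_iff]
        simpa using h.measure_le_zero hψ hu
      filter_upwards [(h.stationary p u).symm.ae_snd (p := fun x => 0 < x) measurableSet_Ioi h2]
        with ω hω _ using hω
    · exact ae_of_all _ fun ω hpq' => absurd hpq' hpq
  have h3 : ∀ᵐ ω ∂P, ∀ c : ℕ, ∃ n : ℕ, (c : ℝ) < D n ω := by
    refine ae_all_iff.2 fun c => ?_
    rw [ae_iff]
    push Not
    obtain ⟨s, hs, hs'⟩ := ((hψ.eventually_gt_atTop 0).and (eventually_gt_atTop 0)).exists
    have hlim : Tendsto (fun n : ℕ => Real.exp (s * c) * Real.exp (-(n * ψ s))) atTop (𝓝 0) := by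
      have : Tendsto (fun n : ℕ => Real.exp (-(n * ψ s))) atTop (𝓝 0) :=
        Real.tendsto_exp_neg_atTop_nhds_zero.comp
          (tendsto_natCast_atTop_atTop.atTop_mul_const hs)
      simpa using this.const_mul (Real.exp (s * c))
    rw [← measureReal_eq_zero_iff]
    refine le_antisymm (ge_of_tendsto' hlim fun n => ?_) measureReal_nonneg
    refine le_trans (measureReal_mono fun ω hω => ?_) (h.measure_le_le n c hs')
    exact hω n
  filter_upwards [h.zero, h.paths, h1, h3] with ω hω0 hω hω1 hω2
  have hmono := hω.1
  refine ⟨hω0, fun u v huv => ?_, fun t => (hω.2 t).1, ?_⟩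
  · obtain ⟨p, hp, hup, hpv⟩ := hRd.exists_between huv
    obtain ⟨q, hq, hpq, hqv⟩ := hRd.exists_between hpv
    have h4 := hω1 p hp q hq hpq
    have h5 : D u ω ≤ D p ω := hmono hup.le
    have h6 : D q ω ≤ D v ω := hmono hqv.le
    change D u ω < D v ω
    linarith
  · refine tendsto_atTop_atTop_of_monotone hmono fun c => ?_
    obtain ⟨m, hm⟩ := exists_nat_ge c
    obtain ⟨n, hn⟩ := hω2 m
    exact ⟨n, hm.trans hn.le⟩

/-- The value at `w` of the path whose right-continuous inverse is `τ`, computed along the set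
`R` of times. -/
noncomputable def valueOfInverse (R : Set ℝ≥0) (x : (ℝ≥0 → ℝ≥0) × ℝ) : ℝ≥0∞ :=
  ⨅ r ∈ R, Set.indicator {x : (ℝ≥0 → ℝ≥0) × ℝ | (x.1 r : ℝ) ≤ x.2} (fun _ => ∞) x ⊔ (r : ℝ≥0∞)

theorem measurable_valueOfInverse {R : Set ℝ≥0} (hR : R.Countable) :
    Measurable (valueOfInverse R) := by
  refine Measurable.biInf R hR fun r _ => Measurable.sup ?_ measurable_const
  exact measurable_const.indicator (measurableSet_le (by fun_prop) (by fun_prop))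

/-- `D w` is the infimum of the `r` whose inverse exceeds `w`, and by density the `r` in `R`
suffice. Independence is assumed for the inverse only, so `D` has to be recovered measurably from
countably many of its values. -/
theorem valueOfInverse_eq {R : Set ℝ≥0} (hR : Dense R) {D : ℝ≥0 → ℝ} (hmono : Monotone D)
    (hc : ∀ t, ContinuousWithinAt D (Set.Ici t) t) (h : Tendsto D atTop atTop) (h0 : D 0 = 0)
    (w : ℝ≥0) : valueOfInverse R (pathInverse D, w) = ENNReal.ofReal (D w) := by
  have hw : 0 ≤ D w := h0 ▸ hmono zero_le
  refine le_antisymm ?_ (le_iInf₂ fun r _ => ?_)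
  · refine le_of_forall_gt_imp_ge_of_dense fun c hc' => ?_
    obtain ⟨d, hd, hdc⟩ := ENNReal.lt_iff_exists_nnreal_btwn.1 hc'
    have hd' : (D w).toNNReal < d := by
      rwa [ENNReal.ofReal, ENNReal.coe_lt_coe] at hd
    obtain ⟨r, hr, hwr, hrd⟩ := hR.exists_between hd'
    have h1 : w < pathInverse D r := lt_pathInverse hmono hc h (by
      rw [← Real.coe_toNNReal _ hw]; exact_mod_cast hwr)
    refine (iInf₂_le r hr).trans ?_
    rw [Set.indicator_of_notMem]
    · simp only [zero_le, sup_of_le_right]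
      exact (ENNReal.coe_le_coe.2 hrd.le).trans hdc.le
    · simpa using h1
  · by_cases h1 : w < pathInverse D r
    · refine le_sup_of_le_right ?_
      rw [ENNReal.ofReal, ENNReal.coe_le_coe]
      exact Real.toNNReal_le_iff_le_coe.2 (le_of_lt_pathInverse h1)
    · rw [Set.indicator_of_mem]
      · simp
      · simpa using h1

end Subordinator

/-- Strictly increasing jump times ensure that at `S 0` the value is exactly `j 0`; a later return
to the origin is irrelevant. -/
theorem jumpPath_exists_ne_zero_iff {j : ℕ → E} {S : ℕ → ℝ} (hj : j 0 ≠ 0) (h0 : 0 ≤ S 0)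
    (hS : StrictMono S) (a : ℝ) :
    (∃ t : ℝ≥0, (t : ℝ) < a ∧ jumpPath j S t ≠ 0) ↔ S 0 < a := by
  constructor
  · rintro ⟨t, hta, ht⟩
    by_contra! ha
    refine ht ?_
    rw [jumpPath_eq_sum (K := 0) fun n _ => (hta.trans_le ha).trans_le (hS.monotone (zero_le (a := n)))]
    simp
  · intro h
    have hc : ((S 0).toNNReal : ℝ) = S 0 := Real.coe_toNNReal _ h0
    refine ⟨(S 0).toNNReal, hc.symm ▸ h, ?_⟩
    rw [jumpPath_eq_sum (K := 1) fun n hn => hc.symm ▸ hS (Nat.lt_of_lt_of_le one_pos hn)]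
    simpa [h0] using hj

/-! ### The converse direction -/

theorem ae_strictMono_jumpTime {Ω : Type*} [MeasurableSpace Ω] {P : Measure Ω} {W : ℕ → Ω → ℝ}
    (hid : ∀ k, IdentDistrib (W k) (W 0) P P) (hpos : ∀ᵐ ω ∂P, 0 < W 0 ω) :
    ∀ᵐ ω ∂P, StrictMono fun n => jumpTime W n ω := by
  have h : ∀ᵐ ω ∂P, ∀ k, 0 < W k ω :=
    ae_all_iff.2 fun k => (hid k).symm.ae_snd (p := fun x => 0 < x) measurableSet_Ioi hpos
  filter_upwards [h] with ω hω
  refine strictMono_nat_of_lt_succ fun n => ?_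
  rw [jumpTime, jumpTime, Finset.sum_range_succ _ (n + 1)]
  linarith [hω (n + 1)]

theorem mem_probHalfLine_map {Ω : Type*} [MeasurableSpace Ω] {P : Measure Ω}
    [IsProbabilityMeasure P] {X : Ω → ℝ} (hX : Measurable X) (h : ∀ᵐ ω ∂P, 0 ≤ X ω) :
    P.map X ∈ probHalfLine := by
  refine ⟨Measure.isProbabilityMeasure_map hX.aemeasurable, ?_⟩
  rw [Measure.map_apply hX measurableSet_Iio]
  rw [ae_iff] at h
  convert h using 2
  ext ω
  simp

theorem ae_nonneg_of_map_mem {Ω : Type*} [MeasurableSpace Ω] {P : Measure Ω}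
    {X : Ω → ℝ} (hX : Measurable X) (h : P.map X ∈ probHalfLine) : ∀ᵐ ω ∂P, 0 ≤ X ω :=
  ae_of_ae_map hX.aemeasurable (ae_nonneg_of_mem_probHalfLine h)

theorem SameJ1Law.measure_eq {Ω Ω' : Type*} [MeasurableSpace Ω] [MeasurableSpace Ω']
    {Z : ℝ≥0 → Ω → E} {P : Measure Ω} {Z' : ℝ≥0 → Ω' → E} {P' : Measure Ω'}
    (h : SameJ1Law Z P Z' P') {A : Set (Skorokhod E)} (hA : MeasurableSet A)
    {B : Set Ω} {B' : Set Ω'} (hB : ∀ᵐ ω ∂P, ∀ z : Skorokhod E, (∀ t, z.1 t = Z t ω) → (z ∈ A ↔ ω ∈ B))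
    (hB' : ∀ᵐ ω ∂P', ∀ z : Skorokhod E, (∀ t, z.1 t = Z' t ω) → (z ∈ A ↔ ω ∈ B')) :
    P B = P' B' := by
  obtain ⟨Q, ⟨z, hz, hzZ⟩, ⟨z', hz', hzZ'⟩⟩ := h
  have h1 : P B = Q A := by
    rw [← hz.map_eq, Measure.map_apply_of_aemeasurable hz.aemeasurable hA]
    refine measure_congr ?_
    filter_upwards [hB, hzZ] with ω h1 h2
    exact propext (h1 _ h2).symm
  have h2 : P' B' = Q A := by
    rw [← hz'.map_eq, Measure.map_apply_of_aemeasurable hz'.aemeasurable hA]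
    refine measure_congr ?_
    filter_upwards [hB', hzZ'] with ω h1 h2
    exact propext (h1 _ h2).symm
  rw [h1, h2]

theorem jumpTime_zero {Ω : Type*} (W : ℕ → Ω → ℝ) (ω : Ω) : jumpTime W 0 ω = W 0 ω := by
  simp [jumpTime]

/-- The time change of a CTRW by an inverse subordinator is, path by path, the CTRW whose jumps
are at the values of the subordinator at the original jump times. -/
theorem timeChange_ctrw_eq {Ω : Type*} {J : ℕ → Ω → E} {W : ℕ → Ω → ℝ} {T : ℝ≥0 → Ω → ℝ≥0}
    {D : ℝ≥0 → Ω → ℝ} {ω : Ω} (hmono : Monotone fun t => D t ω)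
    (hc : ∀ t, ContinuousWithinAt (fun t => D t ω) (Set.Ici t) t)
    (h : Tendsto (fun t => D t ω) atTop atTop) (h0 : D 0 ω = 0)
    (hT : ∀ t : ℝ≥0, T t ω = sInf {u : ℝ≥0 | (t : ℝ) < D u ω}) (hW : ∀ k, 0 ≤ W k ω)
    (hS : Tendsto (fun n => jumpTime W n ω) atTop atTop) (t : ℝ≥0) :
    timeChange (ctrw J W) T t ω
      = jumpPath (fun n => J n ω) (fun n => D (jumpTime W n ω).toNNReal ω) t := by
  have h1 := rightLim_leftLim_jumpPath hmono hc h h0 (fun n => J n ω)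
    (S := fun n => (jumpTime W n ω).toNNReal) (tendsto_real_toNNReal_atTop.comp hS) t
  rw [← h1, timeChange]
  have h2 : (fun v => ctrw J W v ω)
      = jumpPath (fun n => J n ω) fun n => ((jumpTime W n ω).toNNReal : ℝ) := by
    rw [ctrw_eq_jumpPath]
    congr 1
    ext n
    exact (Real.coe_toNNReal _ (Finset.sum_nonneg fun i _ => hW i)).symm
  simp only [h2, hT]
  rfl

theorem mem_layer_of_sameJ1Law {ψ : ℝ → ℝ} {b : ℝ} {μ : Measure ℝ}
    (hψ : HasCharacteristics ψ 0 b μ) (hψb : ¬ BddAbove (ψ '' Set.Ioi 0))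
    (hμ : SubHomogeneous μ ∨ SuperHomogeneous μ)
    [MeasurableSpace E] [BorelSpace E] {Ω Ω' : Type*} [MeasurableSpace Ω] [MeasurableSpace Ω']
    {P : Measure Ω} [IsProbabilityMeasure P] {P' : Measure Ω'} [IsProbabilityMeasure P']
    {J : ℕ → Ω → E} {V : ℕ → Ω → ℝ} (hY : IsIIDJumps J V P) (hV : P.map (V 0) ∈ layer ψ)
    (hJ : ∀ᵐ ω ∂P, J 0 ω ≠ 0)
    {J' : ℕ → Ω' → E} {W : ℕ → Ω' → ℝ} {T : ℝ≥0 → Ω' → ℝ≥0} (hX : IsIIDJumps J' W P')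
    (hJ' : ∀ᵐ ω ∂P', J' 0 ω ≠ 0) (hW : ∀ᵐ ω ∂P', 0 < W 0 ω) (hT : IsInverseSubordinator ψ T P')
    (hind : IndepFun (fun ω t => T t ω) (fun ω k => W k ω) P')
    (hlaw : SameJ1Law (ctrw J V) P (timeChange (ctrw J' W) T) P') :
    P.map (V 0) ∈ layerImage id ψ ∧ P'.map (W 0) ∈ layer id := by
  obtain ⟨hTm, D, hD, hTD⟩ := hT
  have hDp := hD.ae_paths (hψ.tendsto_atTop_atTop hψb)
  have hVm := hY.measurable_wait 0
  have hWm := hX.measurable_wait 0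
  have hVnn := ae_nonneg_of_map_mem hVm hV.1
  have hVpos := measure_Ioi_ne_zero_of_mem_layer hV
  have hWlaw : P'.map (W 0) ∈ probHalfLine := mem_probHalfLine_map hWm (hW.mono fun ω h => h.le)
  have hWpos : P'.map (W 0) (Set.Ioi 0) ≠ 0 := by
    rw [Measure.map_apply hWm measurableSet_Ioi]
    intro h
    obtain ⟨ω, h1, h2⟩ := (hW.and (measure_eq_zero_iff_ae_notMem.1 h)).exists
    exact h2 h1
  obtain ⟨R, hRc, hRd⟩ := TopologicalSpace.exists_countable_dense ℝ≥0
  -- `H` is `D` at the first waiting time, written as a measurable function of the independent pair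
  -- formed by the inverse and `W 0`.
  set H : Ω' → ℝ := fun ω => (valueOfInverse R (fun t => T t ω, W 0 ω)).toReal with hH
  have hTm' : Measurable fun ω t => T t ω := measurable_pi_lambda _ hTm
  have hHm : Measurable H :=
    ((measurable_valueOfInverse hRc).comp (hTm'.prodMk hWm)).ennreal_toReal
  have hval : ∀ᵐ ω ∂P', ∀ w : ℝ≥0,
      (valueOfInverse R (fun t => T t ω, w)).toReal = D w ω := by
    filter_upwards [hDp, hTD] with ω hω hTω w
    have h1 : (fun t => T t ω) = pathInverse fun t => D t ω := funext hTω
    rw [h1, valueOfInverse_eq hRd hω.2.1.monotone hω.2.2.1 hω.2.2.2 hω.1,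
      ENNReal.toReal_ofReal]
    exact hω.1 ▸ hω.2.1.monotone zero_le
  have hHD : ∀ᵐ ω ∂P', H ω = D (W 0 ω).toNNReal ω ∧ 0 < H ω := by
    filter_upwards [hval, hW, hDp] with ω h1 h2 h3
    have h4 : H ω = D (W 0 ω).toNNReal ω := by
      rw [← h1, Real.coe_toNNReal _ h2.le]
    refine ⟨h4, ?_⟩
    rw [h4]
    exact h3.1 ▸ h3.2.1 (Real.toNNReal_pos.2 h2)
  -- the first time at which the time-changed process leaves the origin
  have hZ : ∀ a : ℝ, ∀ᵐ ω ∂P', ∀ z : Skorokhod E,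
      (∀ t, z.1 t = timeChange (ctrw J' W) T t ω) →
        (z ∈ {f : Skorokhod E | ∃ t : ℝ≥0, (t : ℝ) < a ∧ f.1 t ≠ 0} ↔ ω ∈ {ω | H ω < a}) := by
    intro a
    filter_upwards [hDp, hTD, hHD, hJ', hX.ae_tendsto_jumpTime (hW.mono fun ω h => h.le) hWpos,
      ae_strictMono_jumpTime hX.identDistrib_wait hW] with ω h1 h2 h3 h4 h5 h6 z hz
    have h7 : z.1 = jumpPath (fun n => J' n ω) fun n => D (jumpTime W n ω).toNNReal ω := by
      ext t
      rw [hz, timeChange_ctrw_eq h1.2.1.monotone h1.2.2.1 h1.2.2.2 h1.1 h2 h5.1 h5.2]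
    change (∃ t : ℝ≥0, (t : ℝ) < a ∧ z.1 t ≠ 0) ↔ H ω < a
    rw [h7, h3.1, jumpPath_exists_ne_zero_iff h4, jumpTime_zero]
    · exact h1.1 ▸ h1.2.1.monotone zero_le
    · intro m n hmn
      refine h1.2.1 ((Real.toNNReal_lt_toNNReal_iff_of_nonneg ?_).2 (h6 hmn))
      exact Finset.sum_nonneg fun i _ => h5.1 i
  -- Positivity of the waits of `Y` is not assumed. On `V 0 = 0 < V 1` the path is `J 0 ≠ 0` at time
  -- 0, so it leaves the origin before every `1/(n+1)`; for the time-changed process the probability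
  -- of this tends to 0. Independence gives `P(V 0 = 0) P(V 1 > 0) = 0`, and the second factor is
  -- not 0.
  have hVpos' : ∀ᵐ ω ∂P, 0 < V 0 ω := by
    have h0 : P (V 0 ⁻¹' {0} ∩ V 1 ⁻¹' Set.Ioi 0) = 0 := by
      have hle : ∀ n : ℕ, P (V 0 ⁻¹' {0} ∩ V 1 ⁻¹' Set.Ioi 0)
          ≤ P' {ω | H ω < 1 / ((n : ℝ) + 1)} := by
        intro n
        have ha : (0 : ℝ) < 1 / ((n : ℝ) + 1) := by positivity
        set A := {f : Skorokhod E | ∃ t : ℝ≥0, (t : ℝ) < 1 / ((n : ℝ) + 1) ∧ f.1 t ≠ 0}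
        have hlaw' := hlaw
        obtain ⟨Q, ⟨z, hz, hzZ⟩, -⟩ := hlaw'
        have h1 : P {ω | z ω ∈ A} = P' {ω | H ω < 1 / ((n : ℝ) + 1)} :=
          SameJ1Law.measure_eq (Z := fun t ω => (z ω).1 t) (by
            obtain ⟨Q', ⟨y, hy, hyY⟩, hQ'⟩ := hlaw
            refine ⟨Q', ⟨y, hy, ?_⟩, hQ'⟩
            filter_upwards [hyY, hzZ] with ω h1 h2 t
            rw [h1, h2])
            (isOpen_exists_ne_zero _).measurableSet
            (ae_of_all _ fun ω y hy => by rw [show y = z ω from Subtype.ext (funext hy)]; rfl)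
            (hZ _)
        rw [← h1]
        refine measure_mono_ae ?_
        filter_upwards [hzZ, hJ, hY.ae_tendsto_jumpTime hVnn hVpos] with ω h2 h3 h4 h5
        refine ⟨0, by simpa using ha, ?_⟩
        rw [h2, congrFun (ctrw_eq_jumpPath J V ω) 0, jumpPath_eq_sum (K := 1)]
        · have : V 0 ω = 0 := h5.1
          simpa [jumpTime_zero, this] using h3
        · intro n hn
          have h6 : 0 < V 1 ω := h5.2
          refine lt_of_lt_of_le h6 ?_
          exact Finset.single_le_sum (f := fun i => V i ω) (fun i _ => h4.1 i)
            (Finset.mem_range.2 (by omega))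
      have hlim : Tendsto (fun n : ℕ => P' {ω | H ω < 1 / ((n : ℝ) + 1)}) atTop
          (𝓝 (P' (⋂ n : ℕ, {ω | H ω < 1 / ((n : ℝ) + 1)}))) := by
        refine tendsto_measure_iInter_atTop
          (fun n => (measurableSet_lt hHm measurable_const).nullMeasurableSet) ?_
          ⟨0, measure_ne_top _ _⟩
        intro m n hmn ω hω
        have hω' : H ω < 1 / ((n : ℝ) + 1) := hω
        exact hω'.trans_le (one_div_le_one_div_of_le (by positivity) (by gcongr))
      have hzero : P' (⋂ n : ℕ, {ω | H ω < 1 / ((n : ℝ) + 1)}) = 0 := by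
        refine measure_mono_null ?_ (ae_iff.1 hHD)
        intro ω hω h
        obtain ⟨n, hn⟩ := exists_nat_one_div_lt h.2
        exact lt_asymm (Set.mem_iInter.1 hω n) hn
      rw [hzero] at hlim
      exact le_antisymm (ge_of_tendsto' hlim hle) zero_le
    have hind01 : IndepFun (V 0) (V 1) P := hY.iIndepFun_wait.indepFun zero_ne_one
    rw [hind01.measure_inter_preimage_eq_mul _ _ (measurableSet_singleton 0) measurableSet_Ioi,
      (hY.identDistrib_wait 1).measure_mem_eq measurableSet_Ioi] at h0
    rw [Measure.map_apply hVm measurableSet_Ioi] at hVpos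
    have h1 := (mul_eq_zero.1 h0).resolve_right hVpos
    have h2 : ∀ᵐ ω ∂P, V 0 ω ≠ 0 := by
      exact measure_eq_zero_iff_ae_notMem.1 h1
    filter_upwards [hVnn, h2] with ω h3 h4
    exact lt_of_le_of_ne h3 h4.symm
  have hmap : P.map (V 0) = P'.map H := by
    have := Measure.isProbabilityMeasure_map (μ := P) hVm.aemeasurable
    have := Measure.isProbabilityMeasure_map (μ := P') hHm.aemeasurable
    refine Measure.ext_of_Ici _ _ fun a => ?_
    have hIio : P.map (V 0) (Set.Iio a) = P'.map H (Set.Iio a) := by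
      rw [Measure.map_apply hVm measurableSet_Iio, Measure.map_apply hHm measurableSet_Iio]
      refine hlaw.measure_eq (isOpen_exists_ne_zero a).measurableSet ?_ (hZ a)
      filter_upwards [hJ, hVpos', ae_strictMono_jumpTime hY.identDistrib_wait hVpos'] with
        ω h1 h2 h3 z hz
      have h7 : z.1 = jumpPath (fun n => J n ω) fun n => jumpTime V n ω := funext hz
      change (∃ t : ℝ≥0, (t : ℝ) < a ∧ z.1 t ≠ 0) ↔ V 0 ω < a
      rw [h7, jumpPath_exists_ne_zero_iff h1 _ h3, jumpTime_zero]
      · rw [jumpTime_zero]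
        exact h2.le
    rw [← Set.compl_Iio, prob_compl_eq_one_sub measurableSet_Iio,
      prob_compl_eq_one_sub measurableSet_Iio, hIio]
  have hΦ : IsPhi ψ (P'.map (W 0)) (P.map (V 0)) := by
    refine ⟨hWlaw, hV.1, fun s hs => ?_⟩
    have hind0 : IndepFun (fun ω t => T t ω) (W 0) P' :=
      hind.comp (φ := id) (ψ := fun x : ℕ → ℝ => x 0) measurable_id (measurable_pi_apply 0)
    have hprod := (indepFun_iff_map_prod_eq_prod_map_map hTm'.aemeasurable hWm.aemeasurable).1 hind0
    have := Measure.isProbabilityMeasure_map (μ := P') hTm'.aemeasurable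
    have := hWlaw.1
    set G : (ℝ≥0 → ℝ≥0) × ℝ → ℝ := fun x => Real.exp (-(s * (valueOfInverse R x).toReal)) with hG
    have hGm : Measurable G := by
      have := (measurable_valueOfInverse hRc).ennreal_toReal
      exact Real.measurable_exp.comp (this.const_mul s).neg
    have hGint : Integrable G ((P'.map fun ω t => T t ω).prod (P'.map (W 0))) := by
      refine Integrable.of_bound hGm.aestronglyMeasurable 1 (ae_of_all _ fun x => ?_)
      rw [Real.norm_eq_abs, Real.abs_exp]
      refine Real.exp_le_one_iff.2 ?_
      have : 0 ≤ s * (valueOfInverse R x).toReal := mul_nonneg hs.le ENNReal.toReal_nonneg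
      linarith
    -- Fubini over the product law: for a fixed waiting time `w` the inner integral is `e^{-w
    -- ψ(s)}`.
    calc laplace (P.map (V 0)) s = ∫ ω, G (fun t => T t ω, W 0 ω) ∂P' := by
          rw [hmap, laplace, integral_map hHm.aemeasurable (by fun_prop)]
      _ = ∫ x, G x ∂((P'.map fun ω t => T t ω).prod (P'.map (W 0))) := by
          rw [← hprod, integral_map (hTm'.prodMk hWm).aemeasurable hGm.aestronglyMeasurable]
      _ = ∫ w, ∫ τ, G (τ, w) ∂(P'.map fun ω t => T t ω) ∂(P'.map (W 0)) :=
          integral_prod_symm _ hGint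
      _ = laplace (P'.map (W 0)) (ψ s) := by
          refine integral_congr_ae ?_
          filter_upwards [ae_nonneg_of_mem_probHalfLine hWlaw] with w hw
          have hGw : Measurable fun τ => G (τ, w) := hGm.comp measurable_prodMk_right
          rw [integral_map hTm'.aemeasurable hGw.aestronglyMeasurable]
          have h1 := hD.laplace_eq w.toNNReal s hs
          rw [Real.coe_toNNReal _ hw, mul_comm w] at h1
          rw [← h1]
          refine integral_congr_ae ?_
          filter_upwards [hval] with ω hω
          have h2 := hω w.toNNReal
          rw [Real.coe_toNNReal _ hw] at h2
          simp only [hG, h2]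
  have hWid := hψ.mem_layer_id hψb hμ hΦ hV
  exact ⟨⟨_, hWid, hΦ⟩, hWid⟩

end CTRW

namespace CTRW

/-! ### Poisson point processes -/

section Poisson

variable {S : Type*} [MeasurableSpace S]

theorem exists_smul_probability [Nonempty S] (κ : Measure S) [IsFiniteMeasure κ] :
    ∃ (r : ℝ≥0) (η : Measure S), IsProbabilityMeasure η ∧ κ = r • η := by
  let κ' : FiniteMeasure S := ⟨κ, inferInstance⟩
  refine ⟨κ'.mass, κ'.normalize, inferInstance, ?_⟩
  exact congrArg Subtype.val κ'.self_eq_mass_smul_normalize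

/-- The law of a Poisson number of points with intensity `r`, and of an i.i.d. sequence of points
with law `η`. -/
noncomputable def poissonPoints (r : ℝ≥0) (η : Measure S) : Measure (ℕ × (ℕ → S)) :=
  (poissonMeasure r).prod (Measure.infinitePi fun _ => η)

instance (r : ℝ≥0) (η : Measure S) [IsProbabilityMeasure η] :
    IsProbabilityMeasure (poissonPoints r η) := by
  unfold poissonPoints; infer_instance

/-- The sum of `h` over the points of a finite configuration. -/
def pointSum {M : Type*} [AddCommMonoid M] (h : S → M) (p : ℕ × (ℕ → S)) : M :=
  ∑ i ∈ Finset.range p.1, h (p.2 i)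

theorem measurable_pointSum {M : Type*} [AddCommMonoid M] [MeasurableSpace M] [MeasurableAdd₂ M]
    {h : S → M} (hh : Measurable h) : Measurable (pointSum h) :=
  measurable_from_prod_countable_right fun n =>
    Finset.measurable_fun_sum (Finset.range n) fun i _ => hh.comp (measurable_pi_apply i)

theorem norm_cexp_le_one {z : ℂ} (hz : z.re ≤ 0) : ‖Complex.exp z‖ ≤ 1 := by
  rw [Complex.norm_exp]
  exact Real.exp_le_one_iff.2 hz

theorem re_pointSum_nonpos {S : Type*} {h : S → ℂ} (hre : ∀ x, (h x).re ≤ 0) (p : ℕ × (ℕ → S)) :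
    (pointSum h p).re ≤ 0 := by
  rw [pointSum, Complex.re_sum]
  exact Finset.sum_nonpos fun i _ => hre _

/-- Given `n` points the expectation is `c ^ n`, and the Poisson generating function is `e^{r (c -
1)}`. Complex exponents with nonpositive real part cover Laplace and Fourier transforms at once. -/
theorem integral_cexp_pointSum (r : ℝ≥0) (η : Measure S) [IsProbabilityMeasure η] {h : S → ℂ}
    (hh : Measurable h) (hre : ∀ x, (h x).re ≤ 0) :
    ∫ p, Complex.exp (pointSum h p) ∂(poissonPoints r η)
      = Complex.exp (∫ x, (Complex.exp (h x) - 1) ∂(r • η)) := by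
  set c : ℂ := ∫ x, Complex.exp (h x) ∂η with hc
  have hexp : Measurable fun x => Complex.exp (h x) := Complex.measurable_exp.comp hh
  have hint : Integrable (fun x => Complex.exp (h x)) η :=
    Integrable.of_bound hexp.aestronglyMeasurable 1 (ae_of_all _ fun x => norm_cexp_le_one (hre x))
  have hintp : Integrable (fun p => Complex.exp (pointSum h p)) (poissonPoints r η) :=
    Integrable.of_bound
      (Complex.measurable_exp.comp (measurable_pointSum hh)).aestronglyMeasurable 1
      (ae_of_all _ fun p => norm_cexp_le_one (re_pointSum_nonpos hre p))
  have hfix : ∀ n : ℕ, ∫ x : ℕ → S, Complex.exp (pointSum h (n, x)) ∂(Measure.infinitePi fun _ => η)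
      = c ^ n := by
    intro n
    have hind : iIndepFun (fun (i : Fin n) (x : ℕ → S) => Complex.exp (h (x i)))
        (Measure.infinitePi fun _ => η) :=
      (iIndepFun_infinitePi (P := fun _ : ℕ => η) (X := fun _ x => Complex.exp (h x))
        fun _ => hexp).precomp Fin.val_injective
    have h1 := hind.integral_fun_prod_eq_prod_integral fun i =>
      (hexp.comp (measurable_pi_apply (i : ℕ))).aestronglyMeasurable
    have h2 : ∀ i : ℕ, ∫ x : ℕ → S, Complex.exp (h (x i)) ∂(Measure.infinitePi fun _ => η) = c := by
      intro i
      have h3 := (measurePreserving_eval_infinitePi (fun _ : ℕ => η) i)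
      conv_rhs => rw [hc, ← h3.map_eq, integral_map h3.measurable.aemeasurable hexp.aestronglyMeasurable]
    simp_rw [h2] at h1
    rw [Finset.prod_const, Finset.card_univ, Fintype.card_fin] at h1
    rw [← h1]
    refine integral_congr_ae (ae_of_all _ fun x => ?_)
    simp only [pointSum]
    rw [Complex.exp_sum, Finset.prod_range]
  have h4 : ∫ x, (Complex.exp (h x) - 1) ∂(r • η) = r * c - r := by
    rw [integral_smul_nnreal_measure, integral_sub hint (integrable_const _), integral_const, ← hc]
    simp [NNReal.smul_def, mul_sub]
  have h5 : ∫ p, Complex.exp (pointSum h p) ∂(poissonPoints r η)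
      = ∫ n, c ^ n ∂(poissonMeasure r) := by
    rw [poissonPoints, integral_prod _ hintp]
    simp_rw [hfix]
  have h6 : Complex.exp (r * c) = ∑' n : ℕ, (r * c) ^ n / (n.factorial : ℂ) := by
    rw [Complex.exp_eq_exp_ℂ, NormedSpace.exp_eq_tsum_div]
  rw [h5, integral_poissonMeasure, h4, sub_eq_add_neg, add_comm, Complex.exp_add, h6,
    ← tsum_mul_left]
  refine tsum_congr fun n => ?_
  rw [Complex.real_smul]
  push_cast
  rw [mul_pow]
  ring

/-- The law of a sequence of independent finite Poisson configurations. -/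
noncomputable def poissonProcess (r : ℕ → ℝ≥0) (η : ℕ → Measure S) :
    Measure (ℕ → ℕ × (ℕ → S)) :=
  Measure.infinitePi fun n => poissonPoints (r n) (η n)

variable {r : ℕ → ℝ≥0} {η : ℕ → Measure S} [∀ n, IsProbabilityMeasure (η n)]

instance : IsProbabilityMeasure (poissonProcess r η) := by
  unfold poissonProcess; infer_instance

theorem integral_cexp_sum_pointSum {h : S → ℂ} (hh : Measurable h) (hre : ∀ x, (h x).re ≤ 0)
    (M : ℕ) : ∫ ω, Complex.exp (∑ n ∈ Finset.range M, pointSum h (ω n)) ∂(poissonProcess r η)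
      = Complex.exp (∑ n ∈ Finset.range M, ∫ x, (Complex.exp (h x) - 1) ∂(r n • η n)) := by
  have hexp : Measurable fun p => Complex.exp (pointSum h p) :=
    Complex.measurable_exp.comp (measurable_pointSum hh)
  have hind : iIndepFun (fun (n : Fin M) (ω : ℕ → ℕ × (ℕ → S)) => Complex.exp (pointSum h (ω n)))
      (poissonProcess r η) :=
    (iIndepFun_infinitePi (P := fun n : ℕ => poissonPoints (r n) (η n))
      (X := fun _ p => Complex.exp (pointSum h p)) fun _ => hexp).precomp Fin.val_injective
  have h1 := hind.integral_fun_prod_eq_prod_integral fun i =>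
    (hexp.comp (measurable_pi_apply (i : ℕ))).aestronglyMeasurable
  have h2 : ∀ n : ℕ, ∫ ω, Complex.exp (pointSum h (ω n)) ∂(poissonProcess r η)
      = Complex.exp (∫ x, (Complex.exp (h x) - 1) ∂(r n • η n)) := by
    intro n
    have h3 := measurePreserving_eval_infinitePi (fun n : ℕ => poissonPoints (r n) (η n)) n
    rw [← integral_cexp_pointSum (r n) (η n) hh hre, ← h3.map_eq,
      integral_map h3.measurable.aemeasurable hexp.aestronglyMeasurable]
    rfl
  simp_rw [h2] at h1
  rw [Complex.exp_sum, Finset.prod_range, ← h1]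
  refine integral_congr_ae (ae_of_all _ fun ω => ?_)
  simp only
  rw [Complex.exp_sum, Finset.prod_range]

/-- The characteristic functional of a Poisson process. -/
theorem integral_eq_cexp_of_tendsto {m : Measure S} (hm : m = Measure.sum fun n => r n • η n)
    {h : S → ℂ} (hh : Measurable h) (hre : ∀ x, (h x).re ≤ 0)
    (hint : Integrable (fun x => Complex.exp (h x) - 1) m) {U : (ℕ → ℕ × (ℕ → S)) → ℂ}
    (hU : ∀ᵐ ω ∂(poissonProcess r η), Tendsto
      (fun M => Complex.exp (∑ n ∈ Finset.range M, pointSum h (ω n))) atTop (𝓝 (U ω))) :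
    ∫ ω, U ω ∂(poissonProcess r η) = Complex.exp (∫ x, (Complex.exp (h x) - 1) ∂m) := by
  -- Dominated convergence handles the expectations, and integration against the sum measure `m`
  -- handles the exponents; the two limits are then identified.
  have h1 : Tendsto (fun M => ∫ ω, Complex.exp (∑ n ∈ Finset.range M, pointSum h (ω n))
      ∂(poissonProcess r η)) atTop (𝓝 (∫ ω, U ω ∂(poissonProcess r η))) := by
    refine tendsto_integral_of_dominated_convergence (fun _ => 1) (fun M => ?_)
      (integrable_const _) (fun M => ae_of_all _ fun ω => ?_) hU
    · refine (Complex.measurable_exp.comp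
        (Finset.measurable_fun_sum _ fun n _ => ?_)).aestronglyMeasurable
      exact (measurable_pointSum hh).comp (measurable_pi_apply n)
    · refine norm_cexp_le_one ?_
      rw [Complex.re_sum]
      exact Finset.sum_nonpos fun n _ => re_pointSum_nonpos hre _
  simp_rw [integral_cexp_sum_pointSum hh hre] at h1
  rw [hm] at hint ⊢
  have h2 := (hasSum_integral_measure hint).tendsto_sum_nat
  exact tendsto_nhds_unique h1 ((Complex.continuous_exp.tendsto _).comp h2)

end Poisson

end CTRW

namespace CTRW

/-! ### The jumps of a subordinator as a Poisson point process -/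

/-- `μ` may be infinite, but weighted by `min 1 y` it is finite, and the weight is positive almost
everywhere and can be divided out. The Poisson construction needs a decomposition into finite
pieces. -/
theorem HasCharacteristics.sFinite {ψ : ℝ → ℝ} {b : ℝ} {μ : Measure ℝ}
    (h : HasCharacteristics ψ 0 b μ) : SFinite μ := by
  have hfin : IsFiniteMeasure (μ.withDensity fun y => ENNReal.ofReal (min 1 y)) :=
    isFiniteMeasure_withDensity h.integrable.ne
  rw [← withDensity_inv_same (μ := μ) (f := fun y => ENNReal.ofReal (min 1 y)) (by fun_prop) ?_
    (ae_of_all _ fun y => ENNReal.ofReal_ne_top)]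
  · infer_instance
  · filter_upwards [h.ae_pos] with y hy
    exact (ENNReal.ofReal_pos.2 (lt_min one_pos hy)).ne'

/-- The integral `∫ (e^{z y} - 1) μ(dy)`. -/
noncomputable def levyIntegral (μ : Measure ℝ) (z : ℂ) : ℂ :=
  ∫ y, (Complex.exp (z * (y : ℝ≥0)) - 1) ∂(μ.map Real.toNNReal)

theorem norm_cexp_sub_one_le {z : ℂ} (hz : z.re ≤ 0) (y : ℝ≥0) :
    ‖Complex.exp (z * y) - 1‖ ≤ 2 * max 1 ‖z‖ * min 1 (y : ℝ) := by
  have hre : (z * ((y : ℝ) : ℂ)).re ≤ 0 := by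
    rw [Complex.re_mul_ofReal]
    exact mul_nonpos_of_nonpos_of_nonneg hz y.2
  have h2 : ‖Complex.exp (z * y) - 1‖ ≤ 2 := by
    refine (norm_sub_le _ _).trans ?_
    have := norm_cexp_le_one hre
    rw [norm_one]
    linarith
  have hn : ‖z * ((y : ℝ) : ℂ)‖ = ‖z‖ * y := by
    rw [norm_mul, Complex.norm_real, Real.norm_of_nonneg (NNReal.coe_nonneg y)]
  have h1 : ‖Complex.exp (z * y) - 1‖ ≤ 2 * (‖z‖ * y) := by
    rcases le_total ‖z * ((y : ℝ) : ℂ)‖ 1 with h | h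
    · exact (Complex.norm_exp_sub_one_le h).trans_eq (by rw [hn])
    · rw [hn] at h
      linarith
  rcases le_total (y : ℝ) 1 with hy | hy
  · rw [min_eq_right hy]
    refine h1.trans ?_
    rw [mul_assoc]
    gcongr
    exact le_max_right _ _
  · rw [min_eq_left hy]
    refine h2.trans ?_
    have := le_max_left 1 ‖z‖
    linarith

variable {ψ : ℝ → ℝ} {b : ℝ} {μ : Measure ℝ}

theorem HasCharacteristics.integrable_cexp_sub_one (h : HasCharacteristics ψ 0 b μ) {z : ℂ}
    (hz : z.re ≤ 0) :
    Integrable (fun y : ℝ≥0 => Complex.exp (z * y) - 1) (μ.map Real.toNNReal) := by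
  have hmeas : Measurable fun y : ℝ≥0 => Complex.exp (z * y) - 1 := by fun_prop
  rw [integrable_map_measure hmeas.aestronglyMeasurable measurable_real_toNNReal.aemeasurable]
  refine (h.integrable_min.const_mul (2 * max 1 ‖z‖)).mono'
    (hmeas.comp measurable_real_toNNReal).aestronglyMeasurable ?_
  filter_upwards [h.ae_pos] with y hy
  refine (norm_cexp_sub_one_le hz y.toNNReal).trans_eq ?_
  rw [Real.coe_toNNReal _ hy.le]

/-- The exponent `b z + levyIntegral μ z` is the characteristic exponent at `z = iξ`; here it is
shown to be `-ψ s` at `z = -s`. -/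
theorem HasCharacteristics.levyIntegral_neg (h : HasCharacteristics ψ 0 b μ) {s : ℝ}
    (hs : 0 < s) : (b : ℂ) * (-s : ℝ) + levyIntegral μ (-s : ℝ) = ((-ψ s : ℝ) : ℂ) := by
  have h1 : levyIntegral μ (-s : ℝ) = ((-∫ y, (1 - Real.exp (-(s * y))) ∂μ : ℝ) : ℂ) := by
    rw [levyIntegral, integral_map measurable_real_toNNReal.aemeasurable
      (by fun_prop : Measurable fun y : ℝ≥0 =>
        Complex.exp ((-s : ℝ) * (y : ℝ≥0)) - 1).aestronglyMeasurable, ← integral_neg,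
      ← integral_complex_ofReal]
    refine integral_congr_ae ?_
    filter_upwards [h.ae_pos] with y hy
    rw [Real.coe_toNNReal _ hy.le]
    push_cast
    rw [neg_mul]
    ring
  rw [h1, h.eq s hs]
  push_cast
  ring

/-- The contribution of a point `x = (time, size)` to the sum of the jumps up to the time `t`. -/
noncomputable def jumpUpTo (t : ℝ≥0) (x : ℝ × ℝ≥0) : ℝ≥0 :=
  if 0 < x.1 ∧ x.1 ≤ t then x.2 else 0

theorem measurable_uncurry_jumpUpTo : Measurable fun p : ℝ≥0 × ℝ × ℝ≥0 => jumpUpTo p.1 p.2 := by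
  have h1 : MeasurableSet {p : ℝ≥0 × ℝ × ℝ≥0 | 0 < p.2.1} :=
    measurableSet_lt measurable_const (by fun_prop)
  have h2 : MeasurableSet {p : ℝ≥0 × ℝ × ℝ≥0 | p.2.1 ≤ p.1} :=
    measurableSet_le (by fun_prop) (by fun_prop)
  exact Measurable.ite (h1.inter h2) (by fun_prop) measurable_const

theorem measurable_jumpUpTo (t : ℝ≥0) : Measurable (jumpUpTo t) :=
  measurable_uncurry_jumpUpTo.comp measurable_prodMk_left

theorem jumpUpTo_mono (x : ℝ × ℝ≥0) : Monotone fun t => jumpUpTo t x := by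
  intro s t hst
  have : (s : ℝ) ≤ t := hst
  simp only [jumpUpTo]
  split_ifs with h1 h2
  · rfl
  · exact absurd ⟨h1.1, h1.2.trans this⟩ h2
  · exact zero_le
  · rfl

theorem jumpUpTo_sub {s t : ℝ≥0} (hst : s ≤ t) (x : ℝ × ℝ≥0) :
    (jumpUpTo t x : ℝ) - jumpUpTo s x
      = if x.1 ∈ Set.Ioc (s : ℝ) t then (x.2 : ℝ) else 0 := by
  have : (s : ℝ) ≤ t := hst
  have hs : (0 : ℝ) ≤ s := s.2
  simp only [jumpUpTo, Set.mem_Ioc]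
  by_cases h1 : 0 < x.1
  · by_cases h2 : x.1 ≤ s
    · have h3 : x.1 ≤ t := h2.trans this
      simp [h1, h2, h3]
    · by_cases h3 : x.1 ≤ t
      · simp [h1, h2, h3, not_le.1 h2]
      · simp [h2, h3]
  · have h2 : ¬ (s : ℝ) < x.1 := fun h => h1 (hs.trans_lt h)
    simp [h1, h2]

/-- The exponent of the joint characteristic function of the increments. -/
noncomputable def incrementExponent {n : ℕ} (t : Fin (n + 1) → ℝ≥0) (z : Fin n → ℂ)
    (x : ℝ × ℝ≥0) : ℂ :=
  ∑ j, z j * ((jumpUpTo (t j.succ) x : ℝ) - (jumpUpTo (t j.castSucc) x : ℝ) : ℝ)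

section incrementExponent

variable {n : ℕ} {t : Fin (n + 1) → ℝ≥0} {z : Fin n → ℂ}

theorem measurable_incrementExponent (t : Fin (n + 1) → ℝ≥0) (z : Fin n → ℂ) :
    Measurable (incrementExponent t z) := by
  refine Finset.measurable_fun_sum _ fun j _ => Measurable.const_mul ?_ _
  have h1 := measurable_jumpUpTo (t j.succ)
  have h2 := measurable_jumpUpTo (t j.castSucc)
  fun_prop

theorem re_incrementExponent_nonpos (ht : Monotone t) (hz : ∀ j, (z j).re ≤ 0) (x : ℝ × ℝ≥0) :
    (incrementExponent t z x).re ≤ 0 := by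
  rw [incrementExponent, Complex.re_sum]
  refine Finset.sum_nonpos fun j _ => ?_
  rw [Complex.re_mul_ofReal]
  refine mul_nonpos_of_nonpos_of_nonneg (hz j) (sub_nonneg.2 ?_)
  exact NNReal.coe_le_coe.2 (jumpUpTo_mono x (ht (Fin.castSucc_le_succ j)))

/-- The intervals between successive times are disjoint, so each point contributes to at most one
increment. This additivity is the source of independent increments. -/
theorem cexp_incrementExponent_sub_one (ht : Monotone t) (x : ℝ × ℝ≥0) :
    Complex.exp (incrementExponent t z x) - 1
      = ∑ j : Fin n, (Set.Ioc (t j.castSucc : ℝ) (t j.succ)).indicator (fun _ => (1 : ℂ)) x.1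
        * (Complex.exp (z j * x.2) - 1) := by
  have hj : ∀ j : Fin n, z j * ((jumpUpTo (t j.succ) x : ℝ) - (jumpUpTo (t j.castSucc) x : ℝ) : ℝ)
      = (Set.Ioc (t j.castSucc : ℝ) (t j.succ)).indicator (fun _ => z j * x.2) x.1 := by
    intro j
    rw [jumpUpTo_sub (ht (Fin.castSucc_le_succ j)), Set.indicator_apply]
    split_ifs <;> simp
  rw [incrementExponent, Finset.sum_congr rfl fun j _ => hj j]
  by_cases hx : ∃ j : Fin n, x.1 ∈ Set.Ioc (t j.castSucc : ℝ) (t j.succ)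
  · obtain ⟨j, hxj⟩ := hx
    have hne : ∀ i : Fin n, i ≠ j → x.1 ∉ Set.Ioc (t i.castSucc : ℝ) (t i.succ) := by
      intro i hij hxi
      rcases lt_or_gt_of_ne hij with h | h
      · have : (t i.succ : ℝ) ≤ t j.castSucc :=
          NNReal.coe_le_coe.2 (ht (Fin.succ_le_castSucc_iff.2 h))
        exact absurd (hxi.2.trans this) (not_le.2 hxj.1)
      · have : (t j.succ : ℝ) ≤ t i.castSucc :=
          NNReal.coe_le_coe.2 (ht (Fin.succ_le_castSucc_iff.2 h))
        exact absurd (hxj.2.trans this) (not_le.2 hxi.1)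
    rw [Finset.sum_eq_single j (fun i _ hij => Set.indicator_of_notMem (hne i hij) _) (by simp),
      Finset.sum_eq_single j (fun i _ hij => by rw [Set.indicator_of_notMem (hne i hij), zero_mul])
        (by simp), Set.indicator_of_mem hxj, Set.indicator_of_mem hxj, one_mul]
  · push Not at hx
    rw [Finset.sum_eq_zero fun i _ => Set.indicator_of_notMem (hx i) _,
      Finset.sum_eq_zero fun i _ => by rw [Set.indicator_of_notMem (hx i), zero_mul],
      Complex.exp_zero, sub_self]

/-- The intensity measure of the jumps of a subordinator. -/
noncomputable def jumpIntensity (μ : Measure ℝ) : Measure (ℝ × ℝ≥0) :=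
  (volume : Measure ℝ).prod (μ.map Real.toNNReal)

theorem HasCharacteristics.integrable_cexp_incrementExponent (h : HasCharacteristics ψ 0 b μ)
    (ht : Monotone t) (hz : ∀ j, (z j).re ≤ 0) :
    Integrable (fun x => Complex.exp (incrementExponent t z x) - 1) (jumpIntensity μ) := by
  simp_rw [cexp_incrementExponent_sub_one ht]
  refine integrable_finsetSum _ fun j _ => ?_
  refine Integrable.mul_prod (f := (Set.Ioc (t j.castSucc : ℝ) (t j.succ)).indicator
    fun _ => (1 : ℂ)) (g := fun y : ℝ≥0 => Complex.exp (z j * y) - 1) ?_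
    (h.integrable_cexp_sub_one (hz j))
  exact (integrableOn_const (by simp)).integrable_indicator measurableSet_Ioc

theorem HasCharacteristics.integral_cexp_incrementExponent (h : HasCharacteristics ψ 0 b μ)
    (ht : Monotone t) (hz : ∀ j, (z j).re ≤ 0) :
    ∫ x, (Complex.exp (incrementExponent t z x) - 1) ∂(jumpIntensity μ)
      = ∑ j : Fin n, ((t j.succ : ℝ) - t j.castSucc : ℝ) * levyIntegral μ (z j) := by
  have := h.sFinite
  have hint : ∀ j : Fin n, Integrable
      ((Set.Ioc (t j.castSucc : ℝ) (t j.succ)).indicator fun _ => (1 : ℂ)) volume := fun j =>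
    (integrableOn_const (by simp)).integrable_indicator measurableSet_Ioc
  simp_rw [cexp_incrementExponent_sub_one ht]
  rw [jumpIntensity, integral_finsetSum _ fun j _ => Integrable.mul_prod (hint j)
    (h.integrable_cexp_sub_one (hz j))]
  refine Finset.sum_congr rfl fun j _ => ?_
  rw [integral_prod_mul (μ := (volume : Measure ℝ)) (ν := μ.map Real.toNNReal)
    ((Set.Ioc (t j.castSucc : ℝ) (t j.succ)).indicator fun _ => (1 : ℂ))
    (fun y : ℝ≥0 => Complex.exp (z j * y) - 1), integral_indicator measurableSet_Ioc,
    setIntegral_const, levyIntegral]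
  have hle : (t j.castSucc : ℝ) ≤ t j.succ := NNReal.coe_le_coe.2 (ht (Fin.castSucc_le_succ j))
  rw [Real.volume_real_Ioc_of_le hle, Complex.real_smul, mul_one]

end incrementExponent

/-- The sum of the jumps up to the time `t` of a configuration of points. -/
noncomputable def jumpSum (t : ℝ≥0) (ω : ℕ → ℕ × (ℕ → ℝ × ℝ≥0)) : ℝ≥0∞ :=
  ∑' n, ((pointSum (jumpUpTo t) (ω n) : ℝ≥0) : ℝ≥0∞)

theorem measurable_uncurry_pointSum_jumpUpTo :
    Measurable fun p : ℝ≥0 × ℕ × (ℕ → ℝ × ℝ≥0) => pointSum (jumpUpTo p.1) p.2 := by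
  have h : Measurable fun p : ℕ × ℝ≥0 × (ℕ → ℝ × ℝ≥0) =>
      pointSum (jumpUpTo p.2.1) (p.1, p.2.2) := by
    refine measurable_from_prod_countable_right fun n => ?_
    refine Finset.measurable_fun_sum (Finset.range n) fun i _ => ?_
    exact measurable_uncurry_jumpUpTo.comp
      (measurable_fst.prodMk ((measurable_pi_apply i).comp measurable_snd))
  exact h.comp (measurable_snd.fst.prodMk (measurable_fst.prodMk measurable_snd.snd))

theorem measurable_uncurry_jumpSum :
    Measurable fun p : ℝ≥0 × (ℕ → ℕ × (ℕ → ℝ × ℝ≥0)) => jumpSum p.1 p.2 := by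
  refine Measurable.tsum fun n => Measurable.coe_nnreal_ennreal ?_
  exact measurable_uncurry_pointSum_jumpUpTo.comp
    (measurable_fst.prodMk ((measurable_pi_apply n).comp measurable_snd))

theorem measurable_jumpSum (t : ℝ≥0) : Measurable (jumpSum t) :=
  measurable_uncurry_jumpSum.comp measurable_prodMk_left

theorem pointSum_jumpUpTo_mono (p : ℕ × (ℕ → ℝ × ℝ≥0)) :
    Monotone fun t => pointSum (jumpUpTo t) p :=
  fun _ _ hst => Finset.sum_le_sum fun _ _ => jumpUpTo_mono _ hst

theorem jumpSum_mono (ω : ℕ → ℕ × (ℕ → ℝ × ℝ≥0)) : Monotone fun t => jumpSum t ω :=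
  fun _ _ hst => ENNReal.tsum_le_tsum fun n =>
    ENNReal.coe_le_coe.2 (pointSum_jumpUpTo_mono (ω n) hst)

theorem jumpSum_zero (ω : ℕ → ℕ × (ℕ → ℝ × ℝ≥0)) : jumpSum 0 ω = 0 := by
  have : ∀ x : ℝ × ℝ≥0, jumpUpTo 0 x = 0 := fun x => by
    rw [jumpUpTo, if_neg]
    rintro ⟨h1, h2⟩
    simp only [NNReal.coe_zero] at h2
    linarith
  simp [jumpSum, pointSum, this]

theorem hasSum_jumpSum {t : ℝ≥0} {ω : ℕ → ℕ × (ℕ → ℝ × ℝ≥0)} (h : jumpSum t ω ≠ ∞) :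
    HasSum (fun n => ((pointSum (jumpUpTo t) (ω n) : ℝ≥0) : ℝ)) (jumpSum t ω).toReal := by
  have hs := ENNReal.tsum_coe_ne_top_iff_summable.1 h
  rw [jumpSum, ← ENNReal.coe_tsum hs, ENNReal.coe_toReal, NNReal.coe_tsum]
  exact (NNReal.summable_coe.2 hs).hasSum

theorem pointSum_incrementExponent {n : ℕ} (t : Fin (n + 1) → ℝ≥0) (z : Fin n → ℂ)
    (p : ℕ × (ℕ → ℝ × ℝ≥0)) :
    pointSum (incrementExponent t z) p = ∑ j : Fin n, z j *
      (((pointSum (jumpUpTo (t j.succ)) p : ℝ≥0) : ℝ) - ((pointSum (jumpUpTo (t j.castSucc)) p : ℝ≥0) : ℝ) : ℝ) := by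
  simp only [pointSum, incrementExponent]
  rw [Finset.sum_comm]
  refine Finset.sum_congr rfl fun j _ => ?_
  push_cast
  rw [← Finset.sum_sub_distrib, Finset.mul_sum]

theorem tendsto_sum_pointSum_incrementExponent {n : ℕ} (t : Fin (n + 1) → ℝ≥0) (z : Fin n → ℂ)
    {ω : ℕ → ℕ × (ℕ → ℝ × ℝ≥0)} (h : ∀ j, jumpSum (t j) ω ≠ ∞) :
    Tendsto (fun M => ∑ k ∈ Finset.range M, pointSum (incrementExponent t z) (ω k)) atTop
      (𝓝 (∑ j : Fin n, z j *
        ((jumpSum (t j.succ) ω).toReal - (jumpSum (t j.castSucc) ω).toReal : ℝ))) := by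
  simp_rw [pointSum_incrementExponent]
  refine Tendsto.congr (fun M => Finset.sum_comm) ?_
  refine tendsto_finsetSum _ fun j _ => ?_
  simp_rw [← Finset.mul_sum, ← Complex.ofReal_sum]
  refine Tendsto.const_mul _ ((Complex.continuous_ofReal.tendsto _).comp ?_)
  exact ((hasSum_jumpSum (h _)).sub (hasSum_jumpSum (h _))).tendsto_sum_nat

section Law

variable {r : ℕ → ℝ≥0} {η : ℕ → Measure (ℝ × ℝ≥0)} [∀ n, IsProbabilityMeasure (η n)]

/-- With the convention `e^{-s∞} = 0`, the Laplace transform of the sum of jumps is `e^{-t(ψ(s) - b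
s)}`. It is bounded by the probability that the sum is finite, and it tends to 1 as `s → 0`. -/
theorem HasCharacteristics.ae_jumpSum_ne_top (h : HasCharacteristics ψ 0 b μ)
    (hm : jumpIntensity μ = Measure.sum fun n => r n • η n) (t : ℝ≥0) :
    ∀ᵐ ω ∂(poissonProcess r η), jumpSum t ω ≠ ∞ := by
  have hset : MeasurableSet {ω | jumpSum t ω ≠ ∞} :=
    (measurable_jumpSum t) (measurableSet_singleton ∞).compl
  have key : ∀ s : ℝ, 0 < s →
      Real.exp (t * -(ψ s - b * s)) ≤ (poissonProcess r η).real {ω | jumpSum t ω ≠ ∞} := by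
    intro s hs
    set τ : Fin 2 → ℝ≥0 := ![0, t] with hτ
    set z : Fin 1 → ℂ := ![((-s : ℝ) : ℂ)] with hz
    have hτm : Monotone τ := by
      intro i j hij
      fin_cases i <;> fin_cases j <;> simp [hτ] at hij ⊢
    have hzre : ∀ j, (z j).re ≤ 0 := by
      intro j
      fin_cases j
      simp [hz, hs.le]
    set U : (ℕ → ℕ × (ℕ → ℝ × ℝ≥0)) → ℂ := Set.indicator {ω | jumpSum t ω ≠ ∞}
      fun ω => Complex.exp ((-s * (jumpSum t ω).toReal : ℝ) : ℂ) with hU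
    have h1 : ∀ ω, Tendsto (fun M => Complex.exp (∑ n ∈ Finset.range M,
        pointSum (incrementExponent τ z) (ω n))) atTop (𝓝 (U ω)) := by
      intro ω
      by_cases hω : jumpSum t ω = ∞
      · rw [hU, Set.indicator_of_notMem (by simpa using hω)]
        have h2 : ∀ k, pointSum (incrementExponent τ z) (ω k)
            = ((-s * ((pointSum (jumpUpTo t) (ω k) : ℝ≥0) : ℝ) : ℝ) : ℂ) := by
          intro k
          rw [pointSum_incrementExponent, Fin.sum_univ_one]
          have h3 := ENNReal.tsum_eq_zero.1 (jumpSum_zero ω) k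
          rw [ENNReal.coe_eq_zero] at h3
          have h4 : τ (Fin.castSucc 0) = 0 := rfl
          have h5 : τ (Fin.succ 0) = t := rfl
          rw [h4, h5, h3, hz]
          simp
        simp_rw [h2, ← Complex.ofReal_sum, ← Finset.mul_sum, ← Complex.ofReal_exp]
        rw [← Complex.ofReal_zero]
        refine (Complex.continuous_ofReal.tendsto _).comp ?_
        refine Real.tendsto_exp_atBot.comp ?_
        refine Tendsto.const_mul_atTop_of_neg (neg_lt_zero.2 hs) ?_
        rw [← not_summable_iff_tendsto_nat_atTop_of_nonneg fun k => NNReal.coe_nonneg _,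
          NNReal.summable_coe, ← ENNReal.tsum_coe_ne_top_iff_summable]
        simpa [jumpSum] using hω
      · rw [hU, Set.indicator_of_mem (by simpa using hω)]
        refine (Complex.continuous_exp.tendsto _).comp ?_
        convert tendsto_sum_pointSum_incrementExponent τ z (ω := ω) ?_ using 2
        · rw [Fin.sum_univ_one]
          have h4 : τ (Fin.castSucc 0) = 0 := rfl
          have h5 : τ (Fin.succ 0) = t := rfl
          rw [h4, h5, jumpSum_zero, hz]
          simp
        · intro j
          fin_cases j
          · simp [hτ, jumpSum_zero]
          · simpa [hτ] using hω
    have h2 := integral_eq_cexp_of_tendsto hm (measurable_incrementExponent τ z)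
      (re_incrementExponent_nonpos hτm hzre) (h.integrable_cexp_incrementExponent hτm hzre)
      (ae_of_all (poissonProcess r η) h1)
    rw [h.integral_cexp_incrementExponent hτm hzre, Fin.sum_univ_one] at h2
    have h3 : levyIntegral μ (z 0) = ((-(ψ s - b * s) : ℝ) : ℂ) := by
      have := h.levyIntegral_neg hs
      have h4 : z 0 = ((-s : ℝ) : ℂ) := rfl
      rw [h4, eq_sub_of_add_eq' this]
      push_cast
      ring
    have h4 : τ (Fin.castSucc 0) = 0 := rfl
    have h5 : τ (Fin.succ 0) = t := rfl
    rw [h3, h4, h5, NNReal.coe_zero, sub_zero, ← Complex.ofReal_mul, ← Complex.ofReal_exp] at h2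
    have h6 : ‖∫ ω, U ω ∂(poissonProcess r η)‖ = Real.exp (t * -(ψ s - b * s)) := by
      rw [h2, Complex.norm_real, Real.norm_of_nonneg (Real.exp_pos _).le]
    rw [← h6]
    refine (norm_integral_le_integral_norm _).trans ?_
    rw [← integral_indicator_one hset]
    refine integral_mono_of_nonneg (ae_of_all _ fun ω => norm_nonneg _)
      ((integrable_const _).indicator hset) (ae_of_all _ fun ω => ?_)
    simp only [hU, Set.indicator_apply]
    split_ifs
    · refine norm_cexp_le_one ?_
      rw [Complex.ofReal_re]
      have : 0 ≤ s * (jumpSum t ω).toReal := mul_nonneg hs.le ENNReal.toReal_nonneg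
      linarith
    · simp
  have hlim : Tendsto (fun s => Real.exp (t * -(ψ s - b * s))) (𝓝[>] 0) (𝓝 1) := by
    have h1 : Tendsto (fun s : ℝ => b * s) (𝓝[>] 0) (𝓝 0) := by
      have : Continuous fun s : ℝ => b * s := by fun_prop
      simpa using (this.tendsto 0).mono_left nhdsWithin_le_nhds
    have h2 := ((h.tendsto_zero.sub h1).neg.const_mul (t : ℝ))
    have h3 := (Real.continuous_exp.tendsto _).comp h2
    simpa [Function.comp_def] using h3
  have h1 : 1 ≤ (poissonProcess r η).real {ω | jumpSum t ω ≠ ∞} := by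
    refine le_of_tendsto hlim ?_
    filter_upwards [self_mem_nhdsWithin] with s hs using key s hs
  have h2 : (poissonProcess r η) {ω | jumpSum t ω ≠ ∞} = 1 := by
    have h3 := le_antisymm measureReal_le_one h1
    rw [measureReal_def] at h3
    exact (ENNReal.toReal_eq_one_iff _).1 h3
  exact (prob_compl_eq_zero_iff hset).2 h2

theorem HasCharacteristics.ae_forall_jumpSum_ne_top (h : HasCharacteristics ψ 0 b μ)
    (hm : jumpIntensity μ = Measure.sum fun n => r n • η n) :
    ∀ᵐ ω ∂(poissonProcess r η), ∀ t, jumpSum t ω ≠ ∞ := by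
  filter_upwards [ae_all_iff.2 fun n : ℕ => h.ae_jumpSum_ne_top hm (n : ℝ≥0)] with ω hω t
  obtain ⟨n, hn⟩ := exists_nat_ge t
  exact ne_top_of_le_ne_top (hω n) (jumpSum_mono ω hn)

/-- The subordinator with drift `b` and with the given jumps. -/
noncomputable def poissonSubordinator (b : ℝ) (t : ℝ≥0) (ω : ℕ → ℕ × (ℕ → ℝ × ℝ≥0)) : ℝ :=
  b * t + (jumpSum t ω).toReal

theorem measurable_uncurry_poissonSubordinator (b : ℝ) :
    Measurable fun p : ℝ≥0 × (ℕ → ℕ × (ℕ → ℝ × ℝ≥0)) => poissonSubordinator b p.1 p.2 := by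
  have := measurable_uncurry_jumpSum.ennreal_toReal
  unfold poissonSubordinator
  fun_prop

theorem measurable_poissonSubordinator (b : ℝ) (t : ℝ≥0) : Measurable (poissonSubordinator b t) :=
  (measurable_uncurry_poissonSubordinator b).comp measurable_prodMk_left

/-- The joint Laplace–Fourier transform of the increments of the subordinator. -/
theorem HasCharacteristics.integral_cexp_increments (h : HasCharacteristics ψ 0 b μ)
    (hm : jumpIntensity μ = Measure.sum fun n => r n • η n) {n : ℕ} {t : Fin (n + 1) → ℝ≥0}
    (ht : Monotone t) {z : Fin n → ℂ} (hz : ∀ j, (z j).re ≤ 0) :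
    ∫ ω, Complex.exp (∑ j : Fin n, z j * (poissonSubordinator b (t j.succ) ω
        - poissonSubordinator b (t j.castSucc) ω : ℝ)) ∂(poissonProcess r η)
      = ∏ j : Fin n, Complex.exp (((t j.succ : ℝ) - t j.castSucc : ℝ)
        * (b * z j + levyIntegral μ (z j))) := by
  have h1 := integral_eq_cexp_of_tendsto (r := r) (η := η) hm (measurable_incrementExponent t z)
    (re_incrementExponent_nonpos ht hz) (h.integrable_cexp_incrementExponent ht hz)
    (U := fun ω => Complex.exp (∑ j : Fin n, z j *
        ((jumpSum (t j.succ) ω).toReal - (jumpSum (t j.castSucc) ω).toReal : ℝ))) (by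
      filter_upwards [h.ae_forall_jumpSum_ne_top hm] with ω hω
      exact (Complex.continuous_exp.tendsto _).comp
        (tendsto_sum_pointSum_incrementExponent t z fun j => hω _))
  rw [h.integral_cexp_incrementExponent ht hz] at h1
  have h2 : ∀ ω, Complex.exp (∑ j : Fin n, z j * (poissonSubordinator b (t j.succ) ω
        - poissonSubordinator b (t j.castSucc) ω : ℝ))
      = Complex.exp (∑ j : Fin n, z j * (b * ((t j.succ : ℝ) - t j.castSucc : ℝ)))
        * Complex.exp (∑ j : Fin n, z j *
        ((jumpSum (t j.succ) ω).toReal - (jumpSum (t j.castSucc) ω).toReal : ℝ)) := by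
    intro ω
    rw [← Complex.exp_add, ← Finset.sum_add_distrib]
    congr 1
    refine Finset.sum_congr rfl fun j _ => ?_
    simp only [poissonSubordinator]
    push_cast
    ring
  simp_rw [h2]
  rw [integral_const_mul, h1, ← Complex.exp_add, ← Complex.exp_sum, ← Finset.sum_add_distrib]
  congr 1
  refine Finset.sum_congr rfl fun j _ => ?_
  ring

theorem HasCharacteristics.integral_cexp_increment (h : HasCharacteristics ψ 0 b μ)
    (hm : jumpIntensity μ = Measure.sum fun n => r n • η n) {s t : ℝ≥0} (hst : s ≤ t)
    {z : ℂ} (hz : z.re ≤ 0) :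
    ∫ ω, Complex.exp (z * (poissonSubordinator b t ω - poissonSubordinator b s ω : ℝ))
        ∂(poissonProcess r η)
      = Complex.exp (((t : ℝ) - s : ℝ) * (b * z + levyIntegral μ z)) := by
  have h1 := h.integral_cexp_increments hm (t := ![s, t]) (z := ![z]) (by
    intro i j hij
    fin_cases i <;> fin_cases j <;> simp [hst] at hij ⊢) (by
    intro j
    fin_cases j
    simpa using hz)
  simpa using h1

/-- Each finite configuration gives a right-continuous sum; domination by the values at `t + 1`
passes this to the series. Left limits come from monotonicity. -/
theorem isCadlag_poissonSubordinator {b : ℝ} (hb : 0 ≤ b) {ω : ℕ → ℕ × (ℕ → ℝ × ℝ≥0)}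
    (hω : ∀ t, jumpSum t ω ≠ ∞) :
    Monotone (fun t => poissonSubordinator b t ω) ∧
      IsCadlag (fun t => poissonSubordinator b t ω) := by
  have hmono : Monotone (fun t => poissonSubordinator b t ω) := fun s t hst =>
    add_le_add (mul_le_mul_of_nonneg_left (NNReal.coe_le_coe.2 hst) hb)
      (ENNReal.toReal_mono (hω t) (jumpSum_mono ω hst))
  refine ⟨hmono, fun t => ⟨?_, _, hmono.tendsto_leftLim t⟩⟩
  refine ContinuousWithinAt.add (by fun_prop) ?_
  have heq : ∀ u, (jumpSum u ω).toReal = ∑' n, ((pointSum (jumpUpTo u) (ω n) : ℝ≥0) : ℝ) :=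
    fun u => (hasSum_jumpSum (hω u)).tsum_eq.symm
  unfold ContinuousWithinAt
  simp_rw [heq]
  refine tendsto_tsum_of_dominated_convergence (hasSum_jumpSum (hω (t + 1))).summable ?_ ?_
  · intro n
    have h1 : ∀ᶠ v : ℝ≥0 in 𝓝[≥] t, ∀ i ∈ Finset.range (ω n).1,
        (((ω n).2 i).1 ≤ v ↔ ((ω n).2 i).1 ≤ t) :=
      (eventually_all_finset _).2 fun i _ => eventually_le_iff_nhdsGE _ t
    refine tendsto_const_nhds.congr' ?_
    filter_upwards [h1] with v hv
    congr 1
    refine Finset.sum_congr rfl fun i hi => ?_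
    simp only [jumpUpTo, hv i hi]
  · filter_upwards [nhdsWithin_le_nhds (Iio_mem_nhds (lt_add_one t))] with v hv n
    rw [Real.norm_of_nonneg (NNReal.coe_nonneg _)]
    exact NNReal.coe_le_coe.2 (pointSum_jumpUpTo_mono (ω n) (le_of_lt hv))

/-- Independence of increments is the factorisation of their joint characteristic function, and
stationarity holds because each factor depends on `t - s` only. -/
theorem HasCharacteristics.isSubordinator_poissonSubordinator (h : HasCharacteristics ψ 0 b μ)
    (hm : jumpIntensity μ = Measure.sum fun n => r n • η n) :
    IsSubordinator ψ (poissonSubordinator b) (poissonProcess r η) := by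
  have hzero : ∀ ω, poissonSubordinator b 0 ω = 0 := fun ω => by
    simp [poissonSubordinator, jumpSum_zero]
  have hmeas := measurable_poissonSubordinator b
  have hinc : ∀ s t, Measurable fun ω => poissonSubordinator b t ω - poissonSubordinator b s ω :=
    fun s t => (hmeas t).sub (hmeas s)
  have hchar : ∀ {s t : ℝ≥0}, s ≤ t → ∀ ξ : ℝ,
      charFun ((poissonProcess r η).map fun ω =>
        poissonSubordinator b t ω - poissonSubordinator b s ω) ξ
      = Complex.exp (((t : ℝ) - s : ℝ) * (b * (ξ * Complex.I) + levyIntegral μ (ξ * Complex.I))) := by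
    intro s t hst ξ
    rw [← h.integral_cexp_increment hm hst (by simp), charFun_apply, integral_map
      (hinc s t).aemeasurable (by fun_prop)]
    refine integral_congr_ae (ae_of_all _ fun ω => ?_)
    simp only [Real.inner_apply]
    congr 1
    push_cast
    ring
  refine ⟨hmeas, ae_of_all _ hzero, ?_, ?_, ?_, ?_⟩
  · filter_upwards [h.ae_forall_jumpSum_ne_top hm] with ω hω
    exact isCadlag_poissonSubordinator h.b_nonneg hω
  · intro n t ht
    rw [iIndepFun_iff_charFun_pi fun i => (hinc _ _).aemeasurable]
    intro ξ
    rw [charFun_apply, integral_map ?_ (by fun_prop)]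
    · have h1 := h.integral_cexp_increments hm ht (z := fun j => (ξ j : ℂ) * Complex.I)
        fun j => by simp
      rw [Finset.prod_congr rfl fun i _ => hchar (ht (Fin.castSucc_le_succ i)) (ξ i), ← h1]
      refine integral_congr_ae (ae_of_all _ fun ω => ?_)
      simp only [PiLp.inner_apply, Real.inner_apply]
      congr 1
      push_cast
      rw [Finset.sum_mul]
      refine Finset.sum_congr rfl fun j _ => ?_
      ring
    · refine Measurable.aemeasurable ?_
      exact (WithLp.measurable_toLp 2 _).comp
        (measurable_pi_lambda _ fun i => hinc _ _)
  · intro t u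
    refine ⟨(hinc _ _).aemeasurable, (hmeas _).aemeasurable, ?_⟩
    have : (poissonSubordinator b u) = fun ω => poissonSubordinator b u ω
        - poissonSubordinator b 0 ω := by
      ext ω
      rw [hzero, sub_zero]
    rw [this]
    have := Measure.isProbabilityMeasure_map (μ := poissonProcess r η)
      (hinc t (t + u)).aemeasurable
    have := Measure.isProbabilityMeasure_map (μ := poissonProcess r η)
      (hinc 0 u).aemeasurable
    refine Measure.ext_of_charFun (funext fun ξ => ?_)
    rw [hchar le_self_add, hchar zero_le]
    congr 3
    push_cast
    ring
  · intro t s hs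
    have h1 := h.integral_cexp_increment hm (zero_le (a := t)) (z := ((-s : ℝ) : ℂ))
      (by simpa using hs.le)
    rw [h.levyIntegral_neg hs] at h1
    simp only [hzero, sub_zero, NNReal.coe_zero] at h1
    rw [← Complex.ofReal_mul, ← Complex.ofReal_exp] at h1
    simp_rw [← Complex.ofReal_mul, ← Complex.ofReal_exp] at h1
    rw [integral_complex_ofReal, Complex.ofReal_inj] at h1
    simpa using h1

end Law

end CTRW

namespace CTRW

/-! ### Existence of subordinators -/

/-- A path as every path of a subordinator with unbounded symbol almost surely is. -/
structure IsRegularPath (D : ℝ≥0 → ℝ) : Prop where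
  zero : D 0 = 0
  mono : Monotone D
  cadlag : IsCadlag D
  tendsto : Tendsto D atTop atTop

theorem isRegularPath_coe : IsRegularPath fun t : ℝ≥0 => (t : ℝ) where
  zero := rfl
  mono := NNReal.coe_mono
  cadlag t := ⟨NNReal.continuous_coe.continuousWithinAt, t,
    NNReal.continuous_coe.continuousWithinAt⟩
  tendsto := NNReal.tendsto_coe_atTop.2 tendsto_id

theorem IsSubordinator.congr {ψ : ℝ → ℝ} {Ω : Type*} [MeasurableSpace Ω] {P : Measure Ω}
    {D D' : ℝ≥0 → Ω → ℝ} (h : IsSubordinator ψ D P) (hm : ∀ t, Measurable (D' t))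
    (hae : ∀ᵐ ω ∂P, ∀ t, D t ω = D' t ω) : IsSubordinator ψ D' P where
  measurable := hm
  zero := by filter_upwards [h.zero, hae] with ω h1 h2 using by rw [← h2, h1]
  paths := by
    filter_upwards [h.paths, hae] with ω h1 h2
    have : (fun t => D' t ω) = fun t => D t ω := funext fun t => (h2 t).symm
    rwa [this]
  indepIncrements n t ht := (h.indepIncrements n t ht).congr fun i => by
    filter_upwards [hae] with ω h1
    simp only [h1]
  stationary t u := by
    refine ((IdentDistrib.of_ae_eq ((hm _).sub (hm _)).aemeasurable ?_).trans
      (h.stationary t u)).trans (IdentDistrib.of_ae_eq (h.measurable u).aemeasurable ?_)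
    · filter_upwards [hae] with ω h1
      simp [h1]
    · filter_upwards [hae] with ω h1 using h1 u
  laplace_eq t s hs := by
    rw [← h.laplace_eq t s hs]
    refine integral_congr_ae ?_
    filter_upwards [hae] with ω h1
    rw [h1]

/-- Evaluation at random times calls for joint measurability and for good behaviour of every path,
so the identity path is substituted on the exceptional null set. -/
theorem HasCharacteristics.exists_isSubordinator {ψ : ℝ → ℝ} {b : ℝ} {μ : Measure ℝ}
    (h : HasCharacteristics ψ 0 b μ) (hb : ¬ BddAbove (ψ '' Set.Ioi 0)) :
    ∃ (Ω : Type) (_ : MeasurableSpace Ω) (P : Measure Ω) (_ : IsProbabilityMeasure P)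
      (D : ℝ≥0 → Ω → ℝ), IsSubordinator ψ D P ∧ Measurable (fun p : ℝ≥0 × Ω => D p.1 p.2) ∧
        ∀ ω, IsRegularPath fun t => D t ω := by
  classical
  have := h.sFinite
  have hsf : SFinite (jumpIntensity μ) := by unfold jumpIntensity; infer_instance
  choose r η hη hr using fun n => exists_smul_probability (sfiniteSeq (jumpIntensity μ) n)
  have hm : jumpIntensity μ = Measure.sum fun n => r n • η n := by
    simp_rw [← hr]
    exact (sum_sfiniteSeq _).symm
  have hD := h.isSubordinator_poissonSubordinator hm
  -- Only integer times enter, which makes the good set measurable; monotonicity extends its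
  -- properties to all times.
  set G : Set (ℕ → ℕ × (ℕ → ℝ × ℝ≥0)) := {ω | (∀ n : ℕ, jumpSum n ω ≠ ∞) ∧
    Tendsto (fun n : ℕ => poissonSubordinator b n ω) atTop atTop} with hG
  have hGm : MeasurableSet G := by
    refine MeasurableSet.inter (s₁ := {ω | ∀ n : ℕ, jumpSum n ω ≠ ∞}) ?_ ?_
    · rw [Set.ofPred_forall]
      exact MeasurableSet.iInter fun n =>
        measurable_jumpSum _ (measurableSet_singleton ∞).compl
    · exact measurableSet_tendsto _ fun n => measurable_poissonSubordinator b _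
  have hGae : ∀ᵐ ω ∂(poissonProcess r η), ω ∈ G := by
    filter_upwards [h.ae_forall_jumpSum_ne_top hm, hD.ae_paths (h.tendsto_atTop_atTop hb)]
      with ω h1 h2
    exact ⟨fun n => h1 n, h2.2.2.2.comp tendsto_natCast_atTop_atTop⟩
  set D : ℝ≥0 → (ℕ → ℕ × (ℕ → ℝ × ℝ≥0)) → ℝ := fun t ω =>
    if ω ∈ G then poissonSubordinator b t ω else t with hDdef
  have hDm : Measurable fun p : ℝ≥0 × (ℕ → ℕ × (ℕ → ℝ × ℝ≥0)) => D p.1 p.2 :=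
    Measurable.ite (measurable_snd hGm) (measurable_uncurry_poissonSubordinator b) (by fun_prop)
  refine ⟨_, inferInstance, poissonProcess r η, inferInstance, D, ?_, hDm, fun ω => ?_⟩
  · refine hD.congr (fun t => hDm.comp measurable_prodMk_left) ?_
    filter_upwards [hGae] with ω hω t
    simp only [hDdef, if_pos hω]
  · by_cases hω : ω ∈ G
    · have h1 : (fun t => D t ω) = fun t => poissonSubordinator b t ω := by
        ext t
        simp only [hDdef, if_pos hω]
      have h2 : ∀ t, jumpSum t ω ≠ ∞ := fun t => by
        obtain ⟨n, hn⟩ := exists_nat_ge t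
        exact ne_top_of_le_ne_top (hω.1 n) (jumpSum_mono ω hn)
      have h3 := isCadlag_poissonSubordinator h.b_nonneg h2
      rw [h1]
      refine ⟨by simp [poissonSubordinator, jumpSum_zero], h3.1, h3.2, ?_⟩
      refine tendsto_atTop_atTop_of_monotone h3.1 fun c => ?_
      obtain ⟨n, hn⟩ := (hω.2.eventually_ge_atTop c).exists
      exact ⟨n, hn⟩
    · have h1 : (fun t => D t ω) = fun t : ℝ≥0 => (t : ℝ) := by
        ext t
        simp only [hDdef, if_neg hω]
      rw [h1]
      exact isRegularPath_coe

/-- By monotonicity, the infimum being below `c` is witnessed at a point of a countable dense set.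
-/
theorem measurable_pathInverse {Ω : Type*} [MeasurableSpace Ω] {D : ℝ≥0 → Ω → ℝ}
    (hm : ∀ t, Measurable (D t)) (h : ∀ ω, IsRegularPath fun t => D t ω) (r : ℝ≥0) :
    Measurable fun ω => pathInverse (fun t => D t ω) r := by
  obtain ⟨R, hRc, hRd⟩ := TopologicalSpace.exists_countable_dense ℝ≥0
  refine measurable_of_Iio fun c => ?_
  have : (fun ω => pathInverse (fun t => D t ω) r) ⁻¹' Set.Iio c
      = ⋃ u ∈ R, {ω | u < c ∧ (r : ℝ) < D u ω} := by
    ext ω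
    simp only [Set.mem_preimage, Set.mem_Iio, Set.mem_iUnion, Set.mem_ofPred_eq, exists_prop]
    constructor
    · intro hc
      obtain ⟨v, hv, hv'⟩ := exists_lt_of_pathInverse_lt (h ω).tendsto hc
      obtain ⟨u, hu, hvu, huc⟩ := hRd.exists_between hv
      exact ⟨u, hu, huc, hv'.trans_le ((h ω).mono hvu.le)⟩
    · rintro ⟨u, -, huc, hu⟩
      exact (pathInverse_le hu).trans_lt huc
  rw [this]
  refine MeasurableSet.biUnion hRc fun u _ => ?_
  by_cases huc : u < c
  · simpa [huc] using measurableSet_lt measurable_const (hm u)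
  · simp [huc]

theorem IsSubordinator.comp_measurePreserving {ψ : ℝ → ℝ} {Ω Ω' : Type*} [MeasurableSpace Ω]
    [MeasurableSpace Ω'] {P : Measure Ω} {P' : Measure Ω'} [IsProbabilityMeasure P]
    [IsProbabilityMeasure P'] {D : ℝ≥0 → Ω → ℝ} (h : IsSubordinator ψ D P) {f : Ω' → Ω}
    (hf : MeasurePreserving f P' P) : IsSubordinator ψ (fun t ω => D t (f ω)) P' where
  measurable t := (h.measurable t).comp hf.measurable
  zero := hf.quasiMeasurePreserving.ae h.zero
  paths := hf.quasiMeasurePreserving.ae h.paths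
  indepIncrements n t ht := by
    have hinc : ∀ i : Fin n, Measurable fun ω => D (t i.succ) ω - D (t i.castSucc) ω :=
      fun i => (h.measurable _).sub (h.measurable _)
    have h1 := h.indepIncrements n t ht
    have hm : ∀ i : Fin n, P.map (fun ω => D (t i.succ) ω - D (t i.castSucc) ω)
        = P'.map fun ω => D (t i.succ) (f ω) - D (t i.castSucc) (f ω) := fun i => by
      rw [← hf.map_eq, Measure.map_map (hinc i) hf.measurable]
      rfl
    rw [iIndepFun_iff_map_fun_eq_infinitePi_map hinc] at h1
    simp_rw [hm] at h1
    rw [← hf.map_eq, Measure.map_map (measurable_pi_lambda _ hinc) hf.measurable] at h1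
    exact (iIndepFun_iff_map_fun_eq_infinitePi_map fun i => (hinc i).comp hf.measurable).2 h1
  stationary t u := by
    have h1 := h.stationary t u
    have hinc : Measurable fun ω => D (t + u) ω - D t ω := (h.measurable _).sub (h.measurable _)
    refine ⟨(hinc.comp hf.measurable).aemeasurable,
      ((h.measurable u).comp hf.measurable).aemeasurable, ?_⟩
    have h2 := h1.map_eq
    rwa [← hf.map_eq, Measure.map_map hinc hf.measurable,
      Measure.map_map (h.measurable u) hf.measurable] at h2
  laplace_eq t s hs := by
    have hD : Measurable fun ω => Real.exp (-(s * D t ω)) :=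
      Real.measurable_exp.comp ((h.measurable t).const_mul s).neg
    rw [← h.laplace_eq t s hs, ← hf.map_eq,
      integral_map hf.measurable.aemeasurable hD.aestronglyMeasurable]

/-! ### Increments of a subordinator along a random walk -/

section Marked

variable {ψ : ℝ → ℝ} {Ω : Type*} [MeasurableSpace Ω] {P : Measure Ω} {D : ℝ≥0 → Ω → ℝ}
  {M : Type*} [MeasurableSpace M] {η : Measure M} {a : M → ℝ≥0}

/-- The time after `n` steps. -/
def walkTime (a : M → ℝ≥0) (n : ℕ) (x : ℕ → M) : ℝ≥0 := ∑ i ∈ Finset.range n, a (x i)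

/-- The increment of `D` over the `k`-th step. -/
def walkIncrement (D : ℝ≥0 → Ω → ℝ) (a : M → ℝ≥0) (k : ℕ) (p : Ω × (ℕ → M)) : ℝ :=
  D (walkTime a (k + 1) p.2) p.1 - D (walkTime a k p.2) p.1

theorem measurable_walkTime (ha : Measurable a) (n : ℕ) : Measurable (walkTime a n) :=
  Finset.measurable_fun_sum _ fun i _ => ha.comp (measurable_pi_apply i)

theorem walkTime_mono {M : Type*} (a : M → ℝ≥0) (x : ℕ → M) : Monotone fun n => walkTime a n x :=
  fun _ _ hmn => Finset.sum_le_sum_of_subset (Finset.range_mono hmn)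

theorem measurable_walkIncrement (hD : Measurable fun p : ℝ≥0 × Ω => D p.1 p.2)
    (ha : Measurable a) (k : ℕ) : Measurable (walkIncrement D a k) := by
  have h : ∀ n, Measurable fun p : Ω × (ℕ → M) => D (walkTime a n p.2) p.1 := fun n =>
    hD.comp (((measurable_walkTime ha n).comp measurable_snd).prodMk measurable_fst)
  exact (h _).sub (h _)

/-- The increments of a subordinator over the steps of an independent random walk, together with
the steps, are i.i.d. -/
theorem IsSubordinator.map_walkIncrement [IsProbabilityMeasure P] [IsProbabilityMeasure η]
    (h : IsSubordinator ψ D P) (hD : Measurable fun p : ℝ≥0 × Ω => D p.1 p.2) (ha : Measurable a) :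
    (P.prod (Measure.infinitePi fun _ : ℕ => η)).map
        (fun p k => (walkIncrement D a k p, p.2 k))
      = Measure.infinitePi fun _ => (P.prod η).map fun q => (D (a q.2) q.1, q.2) := by
  have hstep : Measurable fun q : Ω × M => (D (a q.2) q.1, q.2) :=
    (hD.comp ((ha.comp measurable_snd).prodMk measurable_fst)).prodMk measurable_snd
  have hjoint : Measurable fun (p : Ω × (ℕ → M)) k => (walkIncrement D a k p, p.2 k) :=
    measurable_pi_lambda _ fun k => (measurable_walkIncrement hD ha k).prodMk
      ((measurable_pi_apply k).comp measurable_snd)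
  have := Measure.isProbabilityMeasure_map (μ := P.prod η) hstep.aemeasurable
  refine Measure.eq_infinitePi _ fun s t ht => ?_
  have hpi : MeasurableSet ((s : Set ℕ).pi t) := MeasurableSet.pi s.countable_toSet fun i _ => ht i
  set f : ℕ → M → ℝ≥0∞ := fun k m => P ((fun ω => (D (a m) ω, m)) ⁻¹' t k) with hf
  have hfm : ∀ k, Measurable (f k) := fun k =>
    measurable_measure_prodMk_right (hstep (ht k))
  have hint : ∀ k, ∫⁻ m, f k m ∂η = (P.prod η).map (fun q => (D (a q.2) q.1, q.2)) (t k) := by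
    intro k
    rw [Measure.map_apply hstep (ht k), Measure.prod_apply_symm (hstep (ht k))]
    rfl
  rw [Measure.map_apply hjoint hpi, Measure.prod_apply_symm (hjoint hpi)]
  -- For a frozen walk the increments are over consecutive deterministic intervals, hence
  -- independent; stationarity then makes the `k`-th factor a function of the step `x k` alone.
  have hfix : ∀ x : ℕ → M, P ((fun ω => (ω, x)) ⁻¹'
      ((fun (p : Ω × (ℕ → M)) k => (walkIncrement D a k p, p.2 k)) ⁻¹' (s : Set ℕ).pi t))
      = ∏ k ∈ s, f k (x k) := by
    intro x
    have h1 := (h.indepIncrements.nat (walkTime_mono a x)).measure_inter_preimage_eq_mul s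
      (sets := fun k => {v | (v, x k) ∈ t k}) fun k _ => measurable_prodMk_right (ht k)
    have h2 : (fun ω => (ω, x)) ⁻¹'
        ((fun (p : Ω × (ℕ → M)) k => (walkIncrement D a k p, p.2 k)) ⁻¹' (s : Set ℕ).pi t)
        = ⋂ k ∈ s, (fun ω => D (walkTime a (k + 1) x) ω - D (walkTime a k x) ω) ⁻¹'
          {v | (v, x k) ∈ t k} := by
      ext ω
      simp [walkIncrement, Set.mem_pi]
    rw [h2, h1]
    refine Finset.prod_congr rfl fun k _ => ?_
    have h3 : walkTime a (k + 1) x = walkTime a k x + a (x k) := Finset.sum_range_succ _ _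
    have hs : MeasurableSet {v | (v, x k) ∈ t k} := measurable_prodMk_right (ht k)
    rw [h3]
    exact (h.stationary _ _).measure_mem_eq hs
  simp_rw [hfix]
  have hind : iIndepFun (fun (k : ℕ) (x : ℕ → M) => f k (x k)) (Measure.infinitePi fun _ => η) :=
    iIndepFun_infinitePi (P := fun _ : ℕ => η) (X := f) hfm
  have h4 := lintegral_prod_eq_prod_lintegral_of_indepFun s (fun (k : ℕ) (x : ℕ → M) => f k (x k))
    hind fun k => (hfm k).comp (measurable_pi_apply k)
  rw [h4]
  refine Finset.prod_congr rfl fun k _ => ?_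
  have h5 := measurePreserving_eval_infinitePi (fun _ : ℕ => η) k
  rw [← hint]
  exact h5.lintegral_comp (hfm k)

end Marked

/-! ### The direct direction -/

section Direct

variable {E : Type*} [NormedAddCommGroup E] [MeasurableSpace E] [BorelSpace E]
  [SecondCountableTopology E]

/-- The path law is an image of the law of the jump sequence, so equality in law of two sequences is
enough for equality of `J₁` laws. -/
theorem hasJ1Law_of_ae_mem_regularJumps {Ω : Type*} [MeasurableSpace Ω] {P : Measure Ω}
    {J : ℕ → Ω → E} {V : ℕ → Ω → ℝ} (hJ : ∀ k, Measurable (J k)) (hV : ∀ k, Measurable (V k))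
    {Z : ℝ≥0 → Ω → E} (h : ∀ᵐ ω ∂P, (fun k => (J k ω, V k ω)) ∈ regularJumps E ∧
      ∀ t, Z t ω = jumpPath (fun n => J n ω) (fun n => jumpTime V n ω) t) :
    HasJ1Law Z ((P.map fun ω k => (J k ω, V k ω)).map toSkorokhod) P := by
  have hm : Measurable fun ω k => (J k ω, V k ω) :=
    measurable_pi_lambda _ fun k => (hJ k).prodMk (hV k)
  refine ⟨fun ω => toSkorokhod fun k => (J k ω, V k ω),
    ⟨(measurable_toSkorokhod.comp hm).aemeasurable, ?_⟩, ?_⟩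
  · rw [Measure.map_map measurable_toSkorokhod hm]
    rfl
  · filter_upwards [h] with ω hω t
    rw [hω.2, toSkorokhod_val hω.1]
    rfl

/-- Sampling from the conditional distribution given the first coordinate. -/
theorem exists_measurable_sampling {E : Type*} [MeasurableSpace E] [StandardBorelSpace E]
    [Nonempty E] {Ω : Type*} [MeasurableSpace Ω]
    {P : Measure Ω} [IsProbabilityMeasure P] {X : Ω → E} {V : Ω → ℝ} (hX : Measurable X)
    (hV : Measurable V) : ∃ F : ℝ → unitInterval → E, Measurable (Function.uncurry F) ∧
      ((P.map V).prod volume).map (fun q => (F q.1 q.2, q.1)) = P.map fun ω => (X ω, V ω) := by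
  obtain ⟨F, hF, hFκ⟩ := (condDistrib X V P).exists_measurable_map_eq_unitInterval
  refine ⟨F, hF, ?_⟩
  have hF' : Measurable fun q : ℝ × unitInterval => F q.1 q.2 := hF
  have := Measure.isProbabilityMeasure_map (μ := P) hV.aemeasurable
  have h1 : ((P.map V).prod volume).map (fun q => (q.1, F q.1 q.2)) = P.map fun ω => (V ω, X ω) := by
    rw [← compProd_map_condDistrib hX.aemeasurable]
    refine Measure.ext fun s hs => ?_
    have hm : Measurable fun q : ℝ × unitInterval => (q.1, F q.1 q.2) := measurable_fst.prodMk hF'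
    rw [Measure.map_apply hm hs, Measure.prod_apply (hm hs), Measure.compProd_apply hs]
    refine lintegral_congr fun v => ?_
    have hFv : Measurable (F v) := hF'.comp measurable_prodMk_left
    rw [← hFκ, Measure.map_apply hFv (measurable_prodMk_left hs)]
    rfl
  have h2 := congrArg (Measure.map Prod.swap) h1
  rwa [Measure.map_map measurable_swap (measurable_fst.prodMk hF'),
    Measure.map_map measurable_swap (hV.prodMk hX)] at h2

theorem map_toNNReal_map_coe {ν : Measure ℝ} (hν : ν ∈ probHalfLine) :
    (ν.map Real.toNNReal).map ((↑) : ℝ≥0 → ℝ) = ν := by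
  rw [Measure.map_map measurable_coe_nnreal_real measurable_real_toNNReal]
  have : ((↑) : ℝ≥0 → ℝ) ∘ Real.toNNReal =ᵐ[ν] id := by
    filter_upwards [ae_nonneg_of_mem_probHalfLine hν] with x hx
    exact Real.coe_toNNReal _ hx
  rw [Measure.map_congr this, Measure.map_id]

/-- A subordinator at an independent random time with law `ν` has the law `Φ_ψ(ν)`. -/
theorem IsSubordinator.map_eq_of_isPhi {ψ : ℝ → ℝ} {Ω : Type*} [MeasurableSpace Ω] {P : Measure Ω}
    [IsProbabilityMeasure P] {D : ℝ≥0 → Ω → ℝ} (h : IsSubordinator ψ D P)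
    (hD : Measurable fun p : ℝ≥0 × Ω => D p.1 p.2) (hnn : ∀ t ω, 0 ≤ D t ω) {ν ρ : Measure ℝ}
    (hΦ : IsPhi ψ ν ρ) :
    (P.prod (ν.map Real.toNNReal)).map (fun q => D q.2 q.1) = ρ := by
  obtain ⟨hν, hρ, hνρ⟩ := hΦ
  have := hν.1
  have := Measure.isProbabilityMeasure_map (μ := ν) measurable_real_toNNReal.aemeasurable
  have hm : Measurable fun q : Ω × ℝ≥0 => D q.2 q.1 := hD.comp measurable_swap
  refine ext_of_laplace (mem_probHalfLine_map hm (ae_of_all _ fun q => hnn _ _)) hρ fun s hs => ?_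
  have he : Measurable fun q : Ω × ℝ≥0 => Real.exp (-(s * D q.2 q.1)) :=
    Real.measurable_exp.comp (hm.const_mul s).neg
  have hint : Integrable (fun q : Ω × ℝ≥0 => Real.exp (-(s * D q.2 q.1)))
      (P.prod (ν.map Real.toNNReal)) := by
    refine Integrable.of_bound he.aestronglyMeasurable 1 (ae_of_all _ fun q => ?_)
    rw [Real.norm_eq_abs, Real.abs_exp]
    refine Real.exp_le_one_iff.2 ?_
    have := mul_nonneg hs.le (hnn q.2 q.1)
    linarith
  rw [laplace, integral_map hm.aemeasurable (by fun_prop), integral_prod_symm _ hint, hνρ s hs,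
    laplace]
  conv_rhs => rw [← map_toNNReal_map_coe hν, integral_map (by fun_prop) (by fun_prop)]
  refine integral_congr_ae (ae_of_all _ fun w => ?_)
  simp only
  rw [h.laplace_eq w s hs, mul_comm]

theorem exists_sameJ1Law_timeChange [StandardBorelSpace E] {ψ : ℝ → ℝ} {b : ℝ} {μ : Measure ℝ}
    (h : HasCharacteristics ψ 0 b μ) (hb : ¬ BddAbove (ψ '' Set.Ioi 0))
    {Ω : Type*} [MeasurableSpace Ω] {P : Measure Ω} [IsProbabilityMeasure P]
    {J : ℕ → Ω → E} {V : ℕ → Ω → ℝ} (hY : IsIIDJumps J V P)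
    (hV : P.map (V 0) ∈ layerImage id ψ) :
    ∃ (Ω' : Type) (_ : MeasurableSpace Ω') (P' : Measure Ω') (_ : IsProbabilityMeasure P')
      (J' : ℕ → Ω' → E) (W : ℕ → Ω' → ℝ) (T : ℝ≥0 → Ω' → ℝ≥0),
      IsIIDJumps J' W P' ∧ P'.map (W 0) ∈ layer id ∧ IsInverseSubordinator ψ T P' ∧
      IndepFun (fun ω t => T t ω) (fun ω k => W k ω) P' ∧
      SameJ1Law (ctrw J V) P (timeChange (ctrw J' W) T) P' := by
  obtain ⟨ν, hνl, hΦ⟩ := hV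
  obtain ⟨Ω₀, _, P₀, _, D, hD, hDm, hreg⟩ := h.exists_isSubordinator hb
  have hν := hΦ.1
  have := hν.1
  have hν0 := measure_Ioi_ne_zero_of_mem_layer hνl
  have hρ0 : P.map (V 0) (Set.Ioi 0) ≠ 0 := fun h0 => by
    have h1 := hΦ.2.2 1 one_pos
    rw [laplace_eq_one_of_null hΦ.2.1 h0] at h1
    exact (laplace_lt_one hν hν0 (h.pos hb one_pos)).ne h1.symm
  have hDnn : ∀ t ω, 0 ≤ D t ω := fun t ω => by
    rw [← (hreg ω).zero]
    exact (hreg ω).mono zero_le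
  obtain ⟨F, hF, hFlaw⟩ := exists_measurable_sampling (P := P) (hY.measurable_jump 0)
    (hY.measurable_wait 0)
  have hF' : Measurable fun q : ℝ × unitInterval => F q.1 q.2 := hF
  have := Measure.isProbabilityMeasure_map (μ := ν) measurable_real_toNNReal.aemeasurable
  set η : Measure (ℝ≥0 × unitInterval) := (ν.map Real.toNNReal).prod volume with hη
  set a : ℝ≥0 × unitInterval → ℝ≥0 := Prod.fst with ha
  set Q : Measure (Ω₀ × (ℕ → ℝ≥0 × unitInterval)) := P₀.prod (Measure.infinitePi fun _ => η) with hQ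
  set L : Measure (ℝ × ℝ≥0 × unitInterval) := (P₀.prod η).map fun q => (D (a q.2) q.1, q.2) with hL
  set V' : ℕ → Ω₀ × (ℕ → ℝ≥0 × unitInterval) → ℝ := walkIncrement D a with hV'
  set W : ℕ → Ω₀ × (ℕ → ℝ≥0 × unitInterval) → ℝ := fun k p => ((p.2 k).1 : ℝ) with hW
  set J' : ℕ → Ω₀ × (ℕ → ℝ≥0 × unitInterval) → E := fun k p => F (V' k p) (p.2 k).2 with hJ'
  have hstep : Measurable fun q : Ω₀ × (ℝ≥0 × unitInterval) => (D (a q.2) q.1, q.2) :=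
    (hDm.comp ((measurable_fst.comp measurable_snd).prodMk measurable_fst)).prodMk measurable_snd
  have : IsProbabilityMeasure L := Measure.isProbabilityMeasure_map hstep.aemeasurable
  have hV'm : ∀ k, Measurable (V' k) := measurable_walkIncrement hDm measurable_fst
  have hpm : ∀ k, Measurable fun p : Ω₀ × (ℕ → ℝ≥0 × unitInterval) => (V' k p, p.2 k) := fun k =>
    (hV'm k).prodMk ((measurable_pi_apply k).comp measurable_snd)
  have hjoint : Q.map (fun p k => (V' k p, p.2 k)) = Measure.infinitePi fun _ => L :=
    hD.map_walkIncrement hDm measurable_fst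
  have hmarg : ∀ k, Q.map (fun p => (V' k p, p.2 k)) = L := by
    intro k
    have h1 := congrArg (Measure.map fun x : ℕ → ℝ × ℝ≥0 × unitInterval => x k) hjoint
    rw [Measure.map_map (measurable_pi_apply k) (measurable_pi_lambda _ hpm)] at h1
    refine h1.trans ?_
    exact Measure.infinitePi_map_eval (fun _ : ℕ => L) k
  have hiid : iIndepFun (fun k p => (V' k p, p.2 k)) Q := by
    rw [iIndepFun_iff_map_fun_eq_infinitePi_map hpm, hjoint]
    simp_rw [hmarg]
  have hid : ∀ k, IdentDistrib (fun p => (V' k p, p.2 k)) (fun p => (V' 0 p, p.2 0)) Q Q := fun k =>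
    ⟨(hpm k).aemeasurable, (hpm 0).aemeasurable, (hmarg k).trans (hmarg 0).symm⟩
  have hg₁ : Measurable fun y : ℝ × ℝ≥0 × unitInterval => (F y.1 y.2.2, (y.2.1 : ℝ)) :=
    (hF'.comp (measurable_fst.prodMk measurable_snd.snd)).prodMk (by fun_prop)
  have hg₂ : Measurable fun y : ℝ × ℝ≥0 × unitInterval => (F y.1 y.2.2, y.1) :=
    (hF'.comp (measurable_fst.prodMk measurable_snd.snd)).prodMk (by fun_prop)
  have hX : IsIIDJumps J' W Q := by
    refine ⟨fun k => (hg₁.comp (hpm k)).fst, fun k => (hg₁.comp (hpm k)).snd, ?_, fun k => ?_⟩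
    · exact hiid.comp (fun _ y => (F y.1 y.2.2, (y.2.1 : ℝ))) fun _ => hg₁
    · exact (hid k).comp hg₁
  have hWlaw : Q.map (W 0) = ν := by
    have h1 : Q.map (fun p => p.2 0) = η := by
      have h2 := (measurePreserving_eval_infinitePi (fun _ : ℕ => η) 0).comp
        (measurePreserving_snd (μ := P₀) (ν := Measure.infinitePi fun _ : ℕ => η))
      exact h2.map_eq
    have h3 : Q.map (W 0) = (η.map Prod.fst).map ((↑) : ℝ≥0 → ℝ) := by
      rw [← h1, Measure.map_map measurable_fst
        ((measurable_pi_apply 0).comp measurable_snd), Measure.map_map (by fun_prop)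
        (measurable_fst.comp ((measurable_pi_apply 0).comp measurable_snd))]
      rfl
    rw [h3, hη, Measure.map_fst_prod, measure_univ, one_smul, map_toNNReal_map_coe hν]
  have hVlaw : L.map (fun y => (F y.1 y.2.2, y.1)) = P.map fun ω => (J 0 ω, V 0 ω) := by
    -- The increment depends on the subordinator and the waiting mark only, so it is independent of
    -- the uniform mark, as the sampling requires.
    have h1 : L.map (fun y => (y.1, y.2.2)) = (P.map (V 0)).prod volume := by
      have h2 := hD.map_eq_of_isPhi hDm hDnn hΦ
      have hm2 : Measurable fun q : Ω₀ × ℝ≥0 => D q.2 q.1 := hDm.comp measurable_swap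
      rw [← h2]
      conv_rhs => rw [← Measure.map_id (μ := (volume : Measure unitInterval))]
      rw [Measure.map_prod_map _ _ hm2 measurable_id, hL,
        Measure.map_map (by fun_prop) hstep, hη, ← Measure.prodAssoc_prod,
        Measure.map_map (by fun_prop) (by fun_prop)]
      rfl
    rw [← hFlaw, ← h1, Measure.map_map (hF'.prodMk measurable_fst) (by fun_prop)]
    rfl
  have hseq : Q.map (fun p k => (J' k p, V' k p)) = P.map fun ω k => (J k ω, V k ω) := by
    have hm : ∀ k, Measurable fun ω => (J k ω, V k ω) := fun k =>
      (hY.measurable_jump k).prodMk (hY.measurable_wait k)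
    have hm' : ∀ k, Measurable fun p => (J' k p, V' k p) := fun k => hg₂.comp (hpm k)
    have hind : iIndepFun (fun k p => (J' k p, V' k p)) Q :=
      hiid.comp (fun _ y => (F y.1 y.2.2, y.1)) fun _ => hg₂
    have hk : ∀ k, P.map (fun ω => (J k ω, V k ω)) = Q.map fun p => (J' k p, V' k p) := fun k => by
      rw [(hY.identDistrib k).map_eq, ← hVlaw, ← hmarg k, Measure.map_map hg₂ (hpm k)]
      rfl
    rw [(iIndepFun_iff_map_fun_eq_infinitePi_map hm).1 hY.indep,
      (iIndepFun_iff_map_fun_eq_infinitePi_map hm').1 hind]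
    simp_rw [hk]
  refine ⟨_, inferInstance, Q, inferInstance, J', W, fun t p => pathInverse (fun u => D u p.1) t,
    hX, hWlaw ▸ hνl, ⟨fun t => ?_, fun t p => D t p.1, ?_, ae_of_all _ fun p t => rfl⟩, ?_, ?_⟩
  · exact (measurable_pathInverse hD.measurable hreg t).comp measurable_fst
  · exact hD.comp_measurePreserving measurePreserving_fst
  · exact indepFun_prod (X := fun ω t => pathInverse (fun u => D u ω) t)
      (Y := fun (x : ℕ → ℝ≥0 × unitInterval) k => ((x k).1 : ℝ))
      (measurable_pi_lambda _ fun t => measurable_pathInverse hD.measurable hreg t) (by fun_prop)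
  · refine ⟨(P.map fun ω k => (J k ω, V k ω)).map toSkorokhod,
      hasJ1Law_of_ae_mem_regularJumps hY.measurable_jump hY.measurable_wait ?_, hseq ▸
      hasJ1Law_of_ae_mem_regularJumps (fun k => (hg₁.comp (hpm k)).fst) hV'm ?_⟩
    · filter_upwards [hY.ae_tendsto_jumpTime
        (ae_nonneg_of_map_mem (hY.measurable_wait 0) hΦ.2.1) hρ0] with ω hω
      exact ⟨hω, fun t => rfl⟩
    · filter_upwards [hX.ae_tendsto_jumpTime (ae_of_all _ fun p => NNReal.coe_nonneg _)
        (hWlaw ▸ hν0)] with p hp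
      have hS : ∀ n, (jumpTime W n p).toNNReal = walkTime a (n + 1) p.2 := fun n => by
        rw [jumpTime, walkTime]
        simp only [hW, ha, ← NNReal.coe_sum, Real.toNNReal_coe]
      -- The increments telescope: the jump times built from `V'` are the values of `D` at those
      -- built from `W`.
      have htel : ∀ n, jumpTime V' n p = D (jumpTime W n p).toNNReal p.1 := fun n => by
        rw [hS, jumpTime]
        simp only [hV', walkIncrement]
        rw [Finset.sum_range_sub (fun k => D (walkTime a k p.2) p.1)]
        simp [walkTime, (hreg p.1).zero]
      refine ⟨⟨fun k => sub_nonneg.2 ((hreg p.1).mono (walkTime_mono a p.2 k.le_succ)), ?_⟩,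
        fun t => ?_⟩
      · have h1 := (hreg p.1).tendsto.comp (tendsto_real_toNNReal_atTop.comp hp.2)
        exact h1.congr fun n => (htel n).symm
      · rw [timeChange_ctrw_eq (D := fun t p => D t p.1) (hreg p.1).mono
          (fun t => ((hreg p.1).cadlag t).1) (hreg p.1).tendsto (hreg p.1).zero (fun t => rfl)
          hp.1 hp.2]
        simp_rw [htel]
        rfl

end Direct

end CTRW

/-! ### The proposition -/

theorem mainTheorem4 (d : ℕ) (ψ : ℝ → ℝ) (hψ : ψ ∈ CTRW.unboundedBernstein)
    {Ω : Type*} [MeasurableSpace Ω] (P : Measure Ω) [IsProbabilityMeasure P]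
    (J : ℕ → Ω → EuclideanSpace ℝ (Fin d)) (V : ℕ → Ω → ℝ) (hY : CTRW.IsIIDJumps J V P) :
    (P.map (V 0) ∈ CTRW.layerImage id ψ →
      ∃ (Ω' : Type) (_ : MeasurableSpace Ω') (P' : Measure Ω') (_ : IsProbabilityMeasure P')
        (J' : ℕ → Ω' → EuclideanSpace ℝ (Fin d)) (W : ℕ → Ω' → ℝ) (T : ℝ≥0 → Ω' → ℝ≥0),
        CTRW.IsIIDJumps J' W P' ∧
        P'.map (W 0) ∈ CTRW.layer id ∧
        CTRW.IsInverseSubordinator ψ T P' ∧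
        IndepFun (fun ω t => T t ω) (fun ω k => W k ω) P' ∧
        CTRW.SameJ1Law (CTRW.ctrw J V) P (CTRW.timeChange (CTRW.ctrw J' W) T) P') ∧
    (∀ (b : ℝ) (μ : Measure ℝ), CTRW.HasCharacteristics ψ 0 b μ →
      (CTRW.SubHomogeneous μ ∨ CTRW.SuperHomogeneous μ) →
      P.map (V 0) ∈ CTRW.layer ψ →
      (∀ᵐ ω ∂P, J 0 ω ≠ 0) →
      ∀ {Ω' : Type*} [MeasurableSpace Ω'] (P' : Measure Ω') [IsProbabilityMeasure P']
        (J' : ℕ → Ω' → EuclideanSpace ℝ (Fin d)) (W : ℕ → Ω' → ℝ) (T : ℝ≥0 → Ω' → ℝ≥0),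
        CTRW.IsIIDJumps J' W P' →
        (∀ᵐ ω ∂P', J' 0 ω ≠ 0) →
        (∀ᵐ ω ∂P', 0 < W 0 ω) →
        CTRW.IsInverseSubordinator ψ T P' →
        IndepFun (fun ω t => T t ω) (fun ω k => W k ω) P' →
        CTRW.SameJ1Law (CTRW.ctrw J V) P (CTRW.timeChange (CTRW.ctrw J' W) T) P' →
        P.map (V 0) ∈ CTRW.layerImage id ψ ∧ P'.map (W 0) ∈ CTRW.layer id) := by
  obtain ⟨⟨b₀, μ₀, h₀⟩, hb⟩ := hψ
  refine ⟨fun hV => CTRW.exists_sameJ1Law_timeChange h₀ hb hY hV, ?_⟩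
  intro b μ h hμ hV hJ Ω' _ P' _ J' W T hX hJ' hW hT hind hlaw
  exact CTRW.mem_layer_of_sameJ1Law h hb hμ hY hV hJ hX hJ' hW hT hind hlaw
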